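/- Let $M$ be a compact smooth manifold of dimension $n\ge 1$ with (possibly empty) boundary $\partial M$, equipped with a smooth Riemannian metric $\langle\cdot,\cdot\rangle$, with Laplace–Beltrami operator $\Delta=\operatorname{div}\nabla$ and, on $\partial M$, outward unit normal $\nu$. Let $\kappa\in\mathbb{R}$ and assume that $\mathrm{Ric}(v,v)\ge (n-1)\kappa\,\langle v,v\rangle$ for every tangent vector $v$ of $M$. Let $g:\mathbb{R}\to\mathbb{R}$ be continuous and put $G(t)=\int_0^t g(\sigma)\,d\sigma$. Let $u:M\to\mathbb{R}$ be non-negative, of class $C^1$ on $M$ (up to the boundary) and of class $C^3$ in the interior $M\setminus\partial M$, and suppose that $$-\Delta u=g(u)\ \text{ in } M\setminus\partial M,\qquad u=0\ \text{ on }\partial M .$$ Then $$\int_M g(u)\left(\frac{2(n-1)\,u\,g(u)}{n}-3G(u)-(n-1)\kappa u^2\right)\ \ge\ \int_{\partial M}\left(\frac{\partial u}{\partial\nu}\right)^3 ,$$ where the integrals are taken with respect to the Riemannian measures of $M$ and of $\partial M$ with the induced metric (counting measure on $\partial M$ if $n=1$). If $\partial M=\emptyset$, the right-hand side is $0$. 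-/

import Mathlib

open Set MeasureTheory
open scoped Manifold ContDiff

noncomputable section

namespace RiemannianGeom

/-! ### Tensor calculus in a coordinate domain

`S` is the coordinate domain (all of `ℝⁿ`, or a closed half-space), `γ` the matrix field `(γ_{ij})`
of a Riemannian metric on it. -/

section Coordinates

variable {n : ℕ}

/-- The partial derivative `∂_i f (y)`, one-sided at boundary points of `S`. -/
def partialD (S : Set (EuclideanSpace ℝ (Fin n))) (i : Fin n)
    (f : EuclideanSpace ℝ (Fin n) → ℝ) (y : EuclideanSpace ℝ (Fin n)) : ℝ :=
  fderivWithin ℝ f S y (EuclideanSpace.single i 1)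

/-- The Christoffel symbol
`Γ^k_{ij} = ½ ∑_l γ^{kl} (∂_i γ_{jl} + ∂_j γ_{il} - ∂_l γ_{ij})`. -/
def christoffel (S : Set (EuclideanSpace ℝ (Fin n)))
    (γ : EuclideanSpace ℝ (Fin n) → Matrix (Fin n) (Fin n) ℝ) (k i j : Fin n)
    (y : EuclideanSpace ℝ (Fin n)) : ℝ :=
  (1 / 2 : ℝ) * ∑ l, (γ y)⁻¹ k l *
    (partialD S i (fun z => γ z j l) y + partialD S j (fun z => γ z i l) y
      - partialD S l (fun z => γ z i j) y)

/-- The component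
`R_{ij} = ∑_k (∂_k Γ^k_{ij} - ∂_j Γ^k_{ik}) + ∑_{k,l} (Γ^k_{kl} Γ^l_{ij} - Γ^k_{jl} Γ^l_{ik})`
of the Ricci tensor. -/
def ricciCoord (S : Set (EuclideanSpace ℝ (Fin n)))
    (γ : EuclideanSpace ℝ (Fin n) → Matrix (Fin n) (Fin n) ℝ) (i j : Fin n)
    (y : EuclideanSpace ℝ (Fin n)) : ℝ :=
  ∑ k, (partialD S k (christoffel S γ k i j) y - partialD S j (christoffel S γ k i k) y)
    + ∑ k, ∑ l, (christoffel S γ k k l y * christoffel S γ l i j y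
        - christoffel S γ k j l y * christoffel S γ l i k y)

/-- The Laplace-Beltrami operator
`Δ f = (det γ)^{-1/2} ∑_{i,j} ∂_i ((det γ)^{1/2} γ^{ij} ∂_j f)`. -/
def laplaceCoord (S : Set (EuclideanSpace ℝ (Fin n)))
    (γ : EuclideanSpace ℝ (Fin n) → Matrix (Fin n) (Fin n) ℝ)
    (f : EuclideanSpace ℝ (Fin n) → ℝ) (y : EuclideanSpace ℝ (Fin n)) : ℝ :=
  (Real.sqrt (γ y).det)⁻¹ * ∑ i, ∑ j,
    partialD S i (fun z => Real.sqrt (γ z).det * (γ z)⁻¹ i j * partialD S j f z) y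

end Coordinates

/-! ### Riemannian manifolds, possibly with boundary -/

section Manifold

variable {n : ℕ} {H : Type*} [TopologicalSpace H]
  (I : ModelWithCorners ℝ (EuclideanSpace ℝ (Fin n)) H)
  {M : Type*} [TopologicalSpace M] [ChartedSpace H M]

/-- The coordinate vector field `∂_i` of the chart around `p`, at the point with coordinates `y`. -/
def coordVec (p : M) (i : Fin n) (y : EuclideanSpace ℝ (Fin n)) :
    TangentSpace I ((extChartAt I p).symm y) :=
  mfderivWithin 𝓘(ℝ, EuclideanSpace ℝ (Fin n)) I (extChartAt I p).symm (range I) y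
    (EuclideanSpace.single i 1 : EuclideanSpace ℝ (Fin n))

/-- The components of a tangent vector at `x` in the chart around `x`. -/
def coordsOf (x : M) (v : TangentSpace I x) : EuclideanSpace ℝ (Fin n) :=
  mfderiv I 𝓘(ℝ, EuclideanSpace ℝ (Fin n)) (extChartAt I x) x v

variable [IsManifold I ∞ M]
  (m : Bundle.ContMDiffRiemannianMetric I ∞ (EuclideanSpace ℝ (Fin n))
    (fun x : M => TangentSpace I x))

/-- The matrix `(γ_{ij})` of the metric `m` in the chart around `p`, as a function of the
coordinates. -/
def gram (p : M) (y : EuclideanSpace ℝ (Fin n)) : Matrix (Fin n) (Fin n) ℝ :=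
  Matrix.of fun i j =>
    m.inner ((extChartAt I p).symm y) (coordVec I p i y) (coordVec I p j y)

/-- The Ricci curvature `Ric(v, w)`, computed in the chart around `x`. -/
def ricci (x : M) (v w : TangentSpace I x) : ℝ :=
  ∑ i, ∑ j, ricciCoord (range I) (gram I m x) i j (extChartAt I x x)
    * coordsOf I x v i * coordsOf I x w j

/-- The Laplace-Beltrami operator of the metric `m`, computed in the chart around `x`. -/
def laplacian (u : M → ℝ) (x : M) : ℝ :=
  laplaceCoord (range I) (gram I m x) (fun y => u ((extChartAt I x).symm y)) (extChartAt I x x)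

/-- The Riemannian measure of the domain of the chart around `p`: the measure
`(det γ)^{1/2} dy` on the image of the chart, carried to `M`. -/
def chartVolume [MeasurableSpace M] (p : M) : Measure M :=
  (((volume : Measure (EuclideanSpace ℝ (Fin n))).restrict (extChartAt I p).target).withDensity
    (fun y => ENNReal.ofReal (Real.sqrt (gram I m p y).det))).map (extChartAt I p).symm

/-- The Riemannian measure on `M`. The measures `chartVolume I m p` agree on overlaps of chart
domains, so their least upper bound is the measure that restricts to each of them. -/
def riemVolume [MeasurableSpace M] : Measure M :=
  ⨆ p : M, chartVolume I m p

end Manifold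

/-! ### The boundary

The dimension is `d + 1`; the boundary of the model half-space is `{y | y 0 = 0}`, and the
half-space itself is `{y | 0 ≤ y 0}`. -/

section Boundary

variable {d : ℕ} {H : Type*} [TopologicalSpace H]
  (I : ModelWithCorners ℝ (EuclideanSpace ℝ (Fin (d + 1))) H)
  {M : Type*} [TopologicalSpace M] [ChartedSpace H M]

/-- The inclusion `z ↦ (0, z)` of `ℝᵈ` as the hyperplane `y 0 = 0`. -/
def hyperplaneIncl (z : Fin d → ℝ) : EuclideanSpace ℝ (Fin (d + 1)) :=
  WithLp.toLp 2 (Fin.cons 0 z)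

variable [IsManifold I ∞ M]
  (m : Bundle.ContMDiffRiemannianMetric I ∞ (EuclideanSpace ℝ (Fin (d + 1)))
    (fun x : M => TangentSpace I x))

/-- The Riemannian measure, for the induced metric `(γ_{ij})_{i,j ≥ 1}`, of the part of the
boundary that lies in the domain of the chart around `p`. -/
def chartArea [MeasurableSpace M] (p : M) : Measure M :=
  (((volume : Measure (Fin d → ℝ)).restrict
      {z | hyperplaneIncl z ∈ (extChartAt I p).target ∧
        (extChartAt I p).symm (hyperplaneIncl z) ∈ I.boundary M}).withDensity
    (fun z => ENNReal.ofReal (Real.sqrt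
      ((gram I m p (hyperplaneIncl z)).submatrix Fin.succ Fin.succ).det))).map
    (fun z => (extChartAt I p).symm (hyperplaneIncl z))

/-- The Riemannian measure of the boundary with the induced metric, as a measure on `M`
concentrated on the boundary (counting measure on the boundary if `M` is one-dimensional). -/
def boundaryArea [MeasurableSpace M] : Measure M :=
  ⨆ p : M, chartArea I m p

/-- The coordinates `ν^i = - γ^{0i} / (γ^{00})^{1/2}` of the outward unit normal at a boundary
point, in the chart around that point. The vector `ν` is orthogonal to `∂_1, …, ∂_d`, has length
one, and points out of the half-space. -/
def normalCoord (x : M) (i : Fin (d + 1)) : ℝ :=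
  - (gram I m x (extChartAt I x x))⁻¹ 0 i /
    Real.sqrt ((gram I m x (extChartAt I x x))⁻¹ 0 0)

/-- The outward normal derivative `∂u/∂ν = ∑_i ν^i ∂_i u` at a boundary point. -/
def normalDeriv (u : M → ℝ) (x : M) : ℝ :=
  ∑ i, normalCoord I m x i *
    partialD (range I) i (fun y => u ((extChartAt I x).symm y)) (extChartAt I x x)

end Boundary

end RiemannianGeom

end

noncomputable section

namespace RiemannianGeom

/-!
Bochner's inequality `½ Δ|∇u|² ≥ (Δu)² / n + ⟨∇Δu, ∇u⟩ + Ric(∇u, ∇u)` is tested against `u`. Since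
`u` is of class `C³` only in the interior, `u` is first replaced by `η_ε(u)`, which vanishes near
`∂M`. Integrating by parts leaves the term `½ ∫ η_ε''(u) |∇u|⁴`, which concentrates at `∂M` as
`ε → 0`. As `|∇u|²` is merely continuous up to `∂M`, one factor `|∇u|²` is bounded by a smooth
`ψ ≤ |∇u|² + δ` before Green's formula turns the term into the boundary integral of `ψ |∇u|`.
Almost everywhere on `{u = 0} \ ∂M` both `∇u` and `Δu` vanish, so dominated convergence applies,
and `δ → 0` gives
`∫ ((1/n - 1) u g(u)² + 3/2 g(u) |∇u|² + (n - 1) κ u |∇u|²) ≤ ½ ∫_{∂M} |∇u|³`.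
Green's formula with test functions `u²` and `G(u)` eliminates `|∇u|²` on the left, and
`∂u/∂ν = -|∇u|` on `∂M`.
-/

/-! ### Partial derivatives -/

section PartialDerivatives

open Filter Topology

variable {n : ℕ} {S W : Set (EuclideanSpace ℝ (Fin n))} {y : EuclideanSpace ℝ (Fin n)}
  {f f' : EuclideanSpace ℝ (Fin n) → ℝ}

theorem partialD_eq_fderiv (hS : S ∈ 𝓝 y) (i : Fin n) :
    partialD S i f y = fderiv ℝ f y (EuclideanSpace.single i 1) := by
  rw [partialD, fderivWithin_of_mem_nhds hS]

theorem partialD_eventuallyEq_fderiv (hS : S ∈ 𝓝 y) (i : Fin n) :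
    partialD S i f =ᶠ[𝓝 y] fun z => fderiv ℝ f z (EuclideanSpace.single i 1) :=
  (eventually_mem_nhds_iff.2 hS).mono fun _ hz => partialD_eq_fderiv hz i

theorem partialD_congr (h : f =ᶠ[𝓝[S] y] f') (hy : f y = f' y) (i : Fin n) :
    partialD S i f y = partialD S i f' y := by
  rw [partialD, partialD, h.fderivWithin_eq hy]

theorem partialD_congr_of_eventuallyEq (h : f =ᶠ[𝓝 y] f') (i : Fin n) :
    partialD S i f y = partialD S i f' y :=
  partialD_congr (h.filter_mono nhdsWithin_le_nhds) h.self_of_nhds i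

theorem partialD_congr_of_eqOn (hW : IsOpen W) (h : EqOn f f' W) (hy : y ∈ W) (i : Fin n) :
    partialD S i f y = partialD S i f' y :=
  partialD_congr_of_eventuallyEq (h.eventuallyEq_of_mem (hW.mem_nhds hy)) i

theorem partialD_add (hS : S ∈ 𝓝 y) (hf : DifferentiableAt ℝ f y)
    (hf' : DifferentiableAt ℝ f' y) (i : Fin n) :
    partialD S i (fun z => f z + f' z) y = partialD S i f y + partialD S i f' y := by
  simp only [partialD_eq_fderiv hS, fderiv_fun_add hf hf', add_apply]

theorem partialD_mul (hS : S ∈ 𝓝 y) (hf : DifferentiableAt ℝ f y)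
    (hf' : DifferentiableAt ℝ f' y) (i : Fin n) :
    partialD S i (fun z => f z * f' z) y
      = partialD S i f y * f' y + f y * partialD S i f' y := by
  simp only [partialD_eq_fderiv hS, fderiv_fun_mul hf hf', add_apply,
    smul_apply, smul_eq_mul]
  ring

theorem partialD_const_mul (hS : S ∈ 𝓝 y) (hf : DifferentiableAt ℝ f y) (c : ℝ) (i : Fin n) :
    partialD S i (fun z => c * f z) y = c * partialD S i f y := by
  simp only [partialD_eq_fderiv hS, fderiv_const_mul hf, smul_apply,
    smul_eq_mul]

theorem partialD_sum (hS : S ∈ 𝓝 y) {ι : Type*} (s : Finset ι)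
    {F : ι → EuclideanSpace ℝ (Fin n) → ℝ} (hF : ∀ k ∈ s, DifferentiableAt ℝ (F k) y) (i : Fin n) :
    partialD S i (fun z => ∑ k ∈ s, F k z) y = ∑ k ∈ s, partialD S i (F k) y := by
  simp only [partialD_eq_fderiv hS, fderiv_fun_sum hF, sum_apply]

theorem partialD_sum_mul (hS : S ∈ 𝓝 y) {ι : Type*} [Fintype ι]
    {a b : ι → EuclideanSpace ℝ (Fin n) → ℝ} (ha : ∀ k, DifferentiableAt ℝ (a k) y)
    (hb : ∀ k, DifferentiableAt ℝ (b k) y) (i : Fin n) :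
    partialD S i (fun z => ∑ k, a k z * b k z) y
      = ∑ k, (partialD S i (a k) y * b k y + a k y * partialD S i (b k) y) := by
  rw [partialD_sum hS _ fun k _ => (ha k).fun_mul (hb k)]
  exact Finset.sum_congr rfl fun k _ => partialD_mul hS (ha k) (hb k) i

theorem contDiffOn_partialD (hW : IsOpen W) (hWS : W ⊆ S) {k l : WithTop ℕ∞}
    (hf : ContDiffOn ℝ l f W) (hkl : k + 1 ≤ l) (i : Fin n) :
    ContDiffOn ℝ k (partialD S i f) W := by
  have hfderiv : ContDiffOn ℝ k (fun z => fderiv ℝ f z (EuclideanSpace.single i 1)) W :=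
    (hf.fderiv_of_isOpen hW hkl).clm_apply contDiffOn_const
  exact hfderiv.congr fun z hz => partialD_eq_fderiv (mem_of_superset (hW.mem_nhds hz) hWS) i

theorem partialD_comm (hS : S ∈ 𝓝 y) (hf : ContDiffAt ℝ 2 f y) (i j : Fin n) :
    partialD S i (partialD S j f) y = partialD S j (partialD S i f) y := by
  have hdiff : DifferentiableAt ℝ (fderiv ℝ f) y :=
    (hf.fderiv_right (m := 1) (by norm_num)).differentiableAt one_ne_zero
  have second_fderiv (i j : Fin n) : partialD S i (partialD S j f) y
      = fderiv ℝ (fderiv ℝ f) y (EuclideanSpace.single i 1) (EuclideanSpace.single j 1) := by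
    rw [partialD_congr_of_eventuallyEq (partialD_eventuallyEq_fderiv hS j),
      partialD_eq_fderiv hS, fderiv_clm_apply hdiff (by fun_prop)]
    simp
  rw [second_fderiv, second_fderiv]
  exact (hf.isSymmSndFDerivAt (by simp)) _ _

end PartialDerivatives

/-! ### Matrix fields -/

section MatrixFields

variable {ι : Type*} [Fintype ι] [DecidableEq ι]
  {V : Type*} [NormedAddCommGroup V] [NormedSpace ℝ V] {k : WithTop ℕ∞} {s : Set V}
  {γ : V → Matrix ι ι ℝ}

theorem contDiffOn_det (hγ : ∀ i j, ContDiffOn ℝ k (fun z => γ z i j) s) :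
    ContDiffOn ℝ k (fun z => (γ z).det) s := by
  simp only [Matrix.det_apply']
  exact ContDiffOn.sum fun σ _ => contDiffOn_const.mul (contDiffOn_prod fun i _ => hγ _ _)

theorem contDiffOn_inv_apply (hγ : ∀ i j, ContDiffOn ℝ k (fun z => γ z i j) s)
    (hdet : ∀ z ∈ s, (γ z).det ≠ 0) (i j : ι) :
    ContDiffOn ℝ k (fun z => (γ z)⁻¹ i j) s := by
  simp only [Matrix.inv_def, Ring.inverse_eq_inv', Matrix.smul_apply, Matrix.adjugate_apply,
    smul_eq_mul]
  refine ((contDiffOn_det hγ).inv hdet).mul (contDiffOn_det fun a b => ?_)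
  simp only [Matrix.updateRow_apply]
  split_ifs
  · exact contDiffOn_const
  · exact hγ a b

theorem fderiv_det_eq_sum_adjugate {z : V} (hγ : ∀ i j, DifferentiableAt ℝ (fun z => γ z i j) z)
    (v : V) :
    fderiv ℝ (fun z => (γ z).det) z v
      = ∑ i, ∑ j, (γ z).adjugate j i * fderiv ℝ (fun z => γ z i j) z v := by
  let D : ContinuousMultilinearMap ℝ (fun _ : ι => ι → ℝ) ℝ :=
    ⟨(Matrix.detRowAlternating (R := ℝ) (n := ι)).toMultilinearMap,
      (continuous_id.matrix_det : Continuous fun A : Matrix ι ι ℝ => A.det)⟩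
  have hrows : HasFDerivAt (fun z => fun i j => γ z i j)
      (ContinuousLinearMap.pi fun i => ContinuousLinearMap.pi fun j =>
        fderiv ℝ (fun z => γ z i j) z) z :=
    hasFDerivAt_pi.2 fun i => hasFDerivAt_pi.2 fun j => (hγ i j).hasFDerivAt
  change fderiv ℝ (D ∘ fun z => fun i j => γ z i j) z v = _
  rw [(HasFDerivAt.comp z (D.hasFDerivAt fun i j => γ z i j) hrows).fderiv]
  simp only [ContinuousLinearMap.comp_apply, ContinuousMultilinearMap.linearDeriv_apply]
  refine Finset.sum_congr rfl fun i _ => ?_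
  change ((γ z).updateRow i fun j => fderiv ℝ (fun z => γ z i j) z v).det = _
  rw [← Matrix.cramer_transpose_apply, Matrix.cramer_eq_adjugate_mulVec,
    ← Matrix.adjugate_transpose]
  rfl

theorem fderiv_det {z : V} (hγ : ∀ i j, DifferentiableAt ℝ (fun z => γ z i j) z)
    (hdet : (γ z).det ≠ 0) (v : V) :
    fderiv ℝ (fun z => (γ z).det) z v
      = (γ z).det * ∑ i, ∑ j, (γ z)⁻¹ j i * fderiv ℝ (fun z => γ z i j) z v := by
  simp only [fderiv_det_eq_sum_adjugate hγ, Finset.mul_sum, Matrix.inv_def, Ring.inverse_eq_inv',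
    Matrix.smul_apply, smul_eq_mul, mul_assoc, mul_inv_cancel_left₀ hdet]

omit [DecidableEq ι] in
theorem trace_mul_nonneg_of_posSemidef {A B : Matrix ι ι ℝ} (hA : A.PosSemidef)
    (hB : B.PosSemidef) : 0 ≤ (A * B).trace := by
  obtain ⟨m, v, rfl⟩ := Matrix.posSemidef_iff_eq_sum_vecMulVec.1 hA
  rw [Finset.sum_mul, Matrix.trace_sum]
  refine Finset.sum_nonneg fun k _ => ?_
  rw [Matrix.vecMulVec_mul, Matrix.trace_vecMulVec, dotProduct_comm, ← Matrix.dotProduct_mulVec]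
  simpa using hB.dotProduct_mulVec_nonneg (v k)

omit [DecidableEq ι] in
theorem trace_mul_self_nonneg {P A : Matrix ι ι ℝ} (hP : P.PosDef) (hA : (P * A).IsSymm) :
    0 ≤ (A * A).trace := by
  classical
  have hdet : IsUnit P.det := (Matrix.isUnit_iff_isUnit_det P).1 hP.isUnit
  have hfactor : A * A = P⁻¹ * ((P * A) * P⁻¹ * (P * A)) := by
    rw [Matrix.mul_assoc (P * A), Matrix.nonsing_inv_mul_cancel_left _ _ hdet,
      ← Matrix.mul_assoc, Matrix.nonsing_inv_mul_cancel_left _ _ hdet]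
  have hpos : ((P * A) * P⁻¹ * (P * A)).PosSemidef := by
    have := hP.inv.posSemidef.conjTranspose_mul_mul_same (P * A)
    rwa [Matrix.conjTranspose_eq_transpose_of_trivial, hA] at this
  rw [hfactor]
  exact trace_mul_nonneg_of_posSemidef hP.inv.posSemidef hpos

omit [DecidableEq ι] in
theorem sq_trace_div_card_le_trace_mul_self [Nonempty ι] {P A : Matrix ι ι ℝ} (hP : P.PosDef)
    (hA : (P * A).IsSymm) : A.trace ^ 2 / (Fintype.card ι : ℝ) ≤ (A * A).trace := by
  classical
  have hcard : (Fintype.card ι : ℝ) ≠ 0 := Nat.cast_ne_zero.2 Fintype.card_ne_zero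
  have hPsymm : P.IsSymm := by
    simpa only [Matrix.IsSymm, Matrix.IsHermitian, Matrix.conjTranspose_eq_transpose_of_trivial]
      using hP.isHermitian
  set t : ℝ := A.trace / Fintype.card ι with ht
  have hdeviator : 0 ≤ ((A - t • 1) * (A - t • 1)).trace := by
    refine trace_mul_self_nonneg hP ?_
    rw [Matrix.IsSymm, Matrix.mul_sub, Matrix.transpose_sub, hA]
    simp [hPsymm.eq]
  have hexpand : ((A - t • 1) * (A - t • 1)).trace
      = (A * A).trace - A.trace ^ 2 / Fintype.card ι := by
    simp only [Matrix.sub_mul, Matrix.mul_sub, Matrix.smul_mul, Matrix.mul_smul, Matrix.one_mul,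
      Matrix.mul_one, Matrix.trace_sub, Matrix.trace_smul, Matrix.trace_one, smul_eq_mul, ht]
    field_simp
    ring
  linarith

end MatrixFields

/-! ### Riemannian metrics on a coordinate domain -/

section CoordinateMetric

open Filter Topology

variable {n : ℕ}

/-- `γ` is the matrix field of a smooth Riemannian metric on the set `W` of coordinates. -/
structure IsMetricOn (W : Set (EuclideanSpace ℝ (Fin n)))
    (γ : EuclideanSpace ℝ (Fin n) → Matrix (Fin n) (Fin n) ℝ) : Prop where
  smooth : ∀ i j, ContDiffOn ℝ ∞ (fun z => γ z i j) W
  posDef : ∀ z ∈ W, (γ z).PosDef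

/-- The component `∇^i f = ∑_j γ^{ij} ∂_j f` of the gradient. -/
def gradCoord (S : Set (EuclideanSpace ℝ (Fin n)))
    (γ : EuclideanSpace ℝ (Fin n) → Matrix (Fin n) (Fin n) ℝ)
    (f : EuclideanSpace ℝ (Fin n) → ℝ) (i : Fin n) (y : EuclideanSpace ℝ (Fin n)) : ℝ :=
  ∑ j, (γ y)⁻¹ i j * partialD S j f y

/-- The inner product `⟨∇a, ∇b⟩ = ∑_i ∂_i a ∇^i b` of two gradients. -/
def gradInnerCoord (S : Set (EuclideanSpace ℝ (Fin n)))
    (γ : EuclideanSpace ℝ (Fin n) → Matrix (Fin n) (Fin n) ℝ)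
    (a b : EuclideanSpace ℝ (Fin n) → ℝ) (y : EuclideanSpace ℝ (Fin n)) : ℝ :=
  ∑ i, partialD S i a y * gradCoord S γ b i y

variable {S W : Set (EuclideanSpace ℝ (Fin n))}
  {γ : EuclideanSpace ℝ (Fin n) → Matrix (Fin n) (Fin n) ℝ} {y : EuclideanSpace ℝ (Fin n)}
  {f f' : EuclideanSpace ℝ (Fin n) → ℝ}

theorem differentiableAt_of_contDiffOn {k : WithTop ℕ∞} (hf : ContDiffOn ℝ k f W)
    (hk : k ≠ 0) (hW : IsOpen W) (hy : y ∈ W) : DifferentiableAt ℝ f y :=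
  (hf.contDiffAt (hW.mem_nhds hy)).differentiableAt hk

namespace IsMetricOn

theorem mono {W' : Set (EuclideanSpace ℝ (Fin n))} (h : IsMetricOn W γ) (hW : W' ⊆ W) :
    IsMetricOn W' γ :=
  ⟨fun i j => (h.smooth i j).mono hW, fun z hz => h.posDef z (hW hz)⟩

theorem det_pos (h : IsMetricOn W γ) (hy : y ∈ W) : 0 < (γ y).det := (h.posDef y hy).det_pos

theorem sqrt_det_pos (h : IsMetricOn W γ) (hy : y ∈ W) : 0 < √(γ y).det :=
  Real.sqrt_pos.2 (h.det_pos hy)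

theorem isUnit_det (h : IsMetricOn W γ) (hy : y ∈ W) : IsUnit (γ y).det :=
  isUnit_iff_ne_zero.2 (h.det_pos hy).ne'

theorem symm (h : IsMetricOn W γ) (hy : y ∈ W) (i j : Fin n) : γ y i j = γ y j i := by
  simpa using (h.posDef y hy).isHermitian.apply j i

theorem inv_symm (h : IsMetricOn W γ) (hy : y ∈ W) (i j : Fin n) :
    (γ y)⁻¹ i j = (γ y)⁻¹ j i := by
  simpa using (h.posDef y hy).inv.isHermitian.apply j i

theorem sum_mul_inv (h : IsMetricOn W γ) (hy : y ∈ W) (l : Fin n) (v : Fin n → ℝ) :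
    ∑ k, γ y l k * ∑ j, (γ y)⁻¹ k j * v j = v l := by
  change (γ y).mulVec ((γ y)⁻¹.mulVec v) l = v l
  rw [Matrix.mulVec_mulVec, Matrix.mul_nonsing_inv _ (h.isUnit_det hy), Matrix.one_mulVec]

theorem sum_inv_mul (h : IsMetricOn W γ) (hy : y ∈ W) (l : Fin n) (v : Fin n → ℝ) :
    ∑ k, (γ y)⁻¹ l k * ∑ j, γ y k j * v j = v l := by
  change (γ y)⁻¹.mulVec ((γ y).mulVec v) l = v l
  rw [Matrix.mulVec_mulVec, Matrix.nonsing_inv_mul _ (h.isUnit_det hy), Matrix.one_mulVec]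

theorem sum_mul_gradCoord (h : IsMetricOn W γ) (hy : y ∈ W) (l : Fin n) :
    ∑ k, γ y l k * gradCoord S γ f k y = partialD S l f y :=
  h.sum_mul_inv hy l _

theorem sum_mul_christoffel (h : IsMetricOn W γ) (hy : y ∈ W) (l i j : Fin n) :
    ∑ k, γ y l k * christoffel S γ k i j y = (1 / 2 : ℝ) *
      (partialD S i (fun z => γ z j l) y + partialD S j (fun z => γ z i l) y
        - partialD S l (fun z => γ z i j) y) := by
  simp only [christoffel, mul_left_comm _ (1 / 2 : ℝ), ← Finset.mul_sum]
  rw [h.sum_mul_inv hy l fun l => partialD S i (fun z => γ z j l) y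
    + partialD S j (fun z => γ z i l) y - partialD S l (fun z => γ z i j) y]

theorem contDiffOn_inv (h : IsMetricOn W γ) (i j : Fin n) :
    ContDiffOn ℝ ∞ (fun z => (γ z)⁻¹ i j) W :=
  contDiffOn_inv_apply h.smooth (fun _ hz => (h.det_pos hz).ne') i j

theorem contDiffOn_sqrt_det (h : IsMetricOn W γ) : ContDiffOn ℝ ∞ (fun z => √(γ z).det) W :=
  (contDiffOn_det h.smooth).sqrt fun _ hz => (h.det_pos hz).ne'

theorem contDiffOn_christoffel (h : IsMetricOn W γ) (hW : IsOpen W) (hWS : W ⊆ S)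
    (k i j : Fin n) : ContDiffOn ℝ ∞ (christoffel S γ k i j) W := by
  have hmetric (l i j : Fin n) : ContDiffOn ℝ ∞ (partialD S l fun z => γ z i j) W :=
    contDiffOn_partialD hW hWS (h.smooth i j) (by simp) l
  exact contDiffOn_const.mul (ContDiffOn.sum fun l _ => (h.contDiffOn_inv k l).mul
    (((hmetric i j l).add (hmetric j i l)).sub (hmetric l i j)))

theorem contDiffOn_gradCoord (h : IsMetricOn W γ) (hW : IsOpen W) (hWS : W ⊆ S)
    {k l : WithTop ℕ∞} (hf : ContDiffOn ℝ l f W) (hkl : k + 1 ≤ l) (hk : k ≤ ∞) (i : Fin n) :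
    ContDiffOn ℝ k (gradCoord S γ f i) W :=
  ContDiffOn.sum fun j _ => ((h.contDiffOn_inv i j).of_le hk).mul
    (contDiffOn_partialD hW hWS hf hkl j)

theorem contDiffOn_gradInnerCoord (h : IsMetricOn W γ) (hW : IsOpen W) (hWS : W ⊆ S)
    {k l l' : WithTop ℕ∞} (hf : ContDiffOn ℝ l f W) (hf' : ContDiffOn ℝ l' f' W)
    (hkl : k + 1 ≤ l) (hkl' : k + 1 ≤ l') (hk : k ≤ ∞) :
    ContDiffOn ℝ k (gradInnerCoord S γ f f') W :=
  ContDiffOn.sum fun j _ => (contDiffOn_partialD hW hWS hf hkl j).mul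
    (h.contDiffOn_gradCoord hW hWS hf' hkl' hk j)

theorem differentiableAt_metric (h : IsMetricOn W γ) (hW : IsOpen W) (hy : y ∈ W)
    (i j : Fin n) : DifferentiableAt ℝ (fun z => γ z i j) y :=
  differentiableAt_of_contDiffOn (h.smooth i j) (by simp) hW hy

theorem differentiableAt_gradCoord (h : IsMetricOn W γ) (hW : IsOpen W) (hWS : W ⊆ S)
    (hf : ContDiffOn ℝ 2 f W) (hy : y ∈ W) (i : Fin n) :
    DifferentiableAt ℝ (gradCoord S γ f i) y :=
  differentiableAt_of_contDiffOn (h.contDiffOn_gradCoord (k := 1) hW hWS hf (by norm_num)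
    (by exact_mod_cast le_top) i) one_ne_zero hW hy

theorem partialD_metric_symm (h : IsMetricOn W γ) (hW : IsOpen W) (hy : y ∈ W) (l i j : Fin n) :
    partialD S l (fun z => γ z i j) y = partialD S l (fun z => γ z j i) y :=
  partialD_congr_of_eqOn hW (fun _ hz => h.symm hz i j) hy l

theorem christoffel_symm (h : IsMetricOn W γ) (hW : IsOpen W) (hy : y ∈ W) (k i j : Fin n) :
    christoffel S γ k i j y = christoffel S γ k j i y := by
  simp only [christoffel, h.partialD_metric_symm hW hy _ i j]
  congr! 4
  ring

theorem partialD_christoffel_symm (h : IsMetricOn W γ) (hW : IsOpen W) (hy : y ∈ W)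
    (a k i j : Fin n) :
    partialD S a (christoffel S γ k i j) y = partialD S a (christoffel S γ k j i) y :=
  partialD_congr_of_eqOn hW (fun _ hz => h.christoffel_symm hW hz k i j) hy a

theorem sum_christoffel (h : IsMetricOn W γ) (hW : IsOpen W) (hy : y ∈ W) (k : Fin n) :
    ∑ l, christoffel S γ l l k y
      = (1 / 2 : ℝ) * ∑ l, ∑ m, (γ y)⁻¹ l m * partialD S k (fun z => γ z l m) y := by
  simp only [christoffel, ← Finset.mul_sum]
  congr 1
  have hcancel : ∑ l, ∑ m, (γ y)⁻¹ l m * partialD S l (fun z => γ z k m) y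
      = ∑ l, ∑ m, (γ y)⁻¹ l m * partialD S m (fun z => γ z l k) y := by
    rw [Finset.sum_comm]
    refine Finset.sum_congr rfl fun l _ => Finset.sum_congr rfl fun m _ => ?_
    rw [h.inv_symm hy, h.partialD_metric_symm hW hy m k l]
  simp only [mul_sub, mul_add, Finset.sum_add_distrib, Finset.sum_sub_distrib, hcancel]
  ring

theorem partialD_sqrt_det (h : IsMetricOn W γ) (hW : IsOpen W) (hWS : W ⊆ S) (hy : y ∈ W)
    (k : Fin n) :
    partialD S k (fun z => √(γ z).det) y = √(γ y).det * ∑ l, christoffel S γ l l k y := by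
  have hS : S ∈ 𝓝 y := mem_of_superset (hW.mem_nhds hy) hWS
  have hdet : DifferentiableAt ℝ (fun z => (γ z).det) y :=
    differentiableAt_of_contDiffOn (contDiffOn_det h.smooth) (by simp) hW hy
  have hpos := h.det_pos hy
  have hsqrt : (γ y).det = √(γ y).det * √(γ y).det := (Real.mul_self_sqrt hpos.le).symm
  have htrace : ∑ i, ∑ j, (γ y)⁻¹ j i * fderiv ℝ (fun z => γ z i j) y (EuclideanSpace.single k 1)
      = 2 * ∑ l, christoffel S γ l l k y := by
    rw [h.sum_christoffel hW hy, ← mul_assoc, mul_one_div_cancel two_ne_zero, one_mul]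
    refine Finset.sum_congr rfl fun l _ => Finset.sum_congr rfl fun m _ => ?_
    rw [h.inv_symm hy, partialD_eq_fderiv hS]
  rw [partialD_eq_fderiv hS, fderiv_sqrt hdet hpos.ne', smul_apply, smul_eq_mul,
    fderiv_det (h.differentiableAt_metric hW hy) hpos.ne', htrace]
  have := (h.sqrt_det_pos hy).ne'
  generalize √(γ y).det = t at *
  rw [hsqrt]
  field_simp

theorem laplaceCoord_eq_div_gradCoord (h : IsMetricOn W γ) (hW : IsOpen W) (hWS : W ⊆ S)
    (hf : ContDiffOn ℝ 2 f W) (hy : y ∈ W) :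
    laplaceCoord S γ f y = ∑ k, (partialD S k (gradCoord S γ f k) y
      + (∑ l, christoffel S γ l l k y) * gradCoord S γ f k y) := by
  have hS : S ∈ 𝓝 y := mem_of_superset (hW.mem_nhds hy) hWS
  have hsqrt : DifferentiableAt ℝ (fun z => √(γ z).det) y :=
    differentiableAt_of_contDiffOn h.contDiffOn_sqrt_det (by simp) hW hy
  have hinv (i j : Fin n) : DifferentiableAt ℝ (fun z => (γ z)⁻¹ i j) y :=
    differentiableAt_of_contDiffOn (h.contDiffOn_inv i j) (by simp) hW hy
  have hpartial (j : Fin n) : DifferentiableAt ℝ (partialD S j f) y :=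
    differentiableAt_of_contDiffOn (contDiffOn_partialD (k := 1) hW hWS hf (by norm_num) j)
      one_ne_zero hW hy
  rw [laplaceCoord, inv_mul_eq_iff_eq_mul₀ (h.sqrt_det_pos hy).ne', Finset.mul_sum]
  refine Finset.sum_congr rfl fun i _ => ?_
  have hflux : (fun z => ∑ j, √(γ z).det * (γ z)⁻¹ i j * partialD S j f z)
      = fun z => √(γ z).det * gradCoord S γ f i z := by
    simp only [gradCoord, Finset.mul_sum, mul_assoc]
  rw [← partialD_sum (F := fun j z => √(γ z).det * (γ z)⁻¹ i j * partialD S j f z) hS _ fun j _ =>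
      (hsqrt.mul (hinv i j)).mul (hpartial j), hflux,
    partialD_mul hS hsqrt (h.differentiableAt_gradCoord hW hWS hf hy i),
    h.partialD_sqrt_det hW hWS hy]
  ring

theorem contDiffOn_laplaceCoord (h : IsMetricOn W γ) (hW : IsOpen W) (hWS : W ⊆ S)
    {k l : WithTop ℕ∞} (hf : ContDiffOn ℝ l f W) (hkl : k + 2 ≤ l) (hk : k + 1 ≤ ∞) :
    ContDiffOn ℝ k (laplaceCoord S γ f) W := by
  have hgrad (j : Fin n) : ContDiffOn ℝ (k + 1) (gradCoord S γ f j) W :=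
    h.contDiffOn_gradCoord hW hWS hf (by rwa [add_assoc, one_add_one_eq_two]) hk j
  refine ContDiffOn.congr ?_ fun z hz =>
    h.laplaceCoord_eq_div_gradCoord hW hWS (hf.of_le (le_trans (by simp) hkl)) hz
  exact ContDiffOn.sum fun j _ => (contDiffOn_partialD hW hWS (hgrad j) le_rfl j).add
    ((ContDiffOn.sum fun i _ => (h.contDiffOn_christoffel hW hWS i i j).of_le
      (le_trans (by simp) hk)).mul ((hgrad j).of_le (by simp)))

end IsMetricOn

end CoordinateMetric

/-! ### The Bochner inequality in coordinates -/

section Bochner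

open Filter Topology

variable {n : ℕ} {S W : Set (EuclideanSpace ℝ (Fin n))}
  {γ : EuclideanSpace ℝ (Fin n) → Matrix (Fin n) (Fin n) ℝ} {y : EuclideanSpace ℝ (Fin n)}
  {f : EuclideanSpace ℝ (Fin n) → ℝ}

/-- The component `∇_i ∇^k f = ∂_i ∇^k f + ∑_l Γ^k_{il} ∇^l f` of the Hessian endomorphism. -/
def hessCoord (S : Set (EuclideanSpace ℝ (Fin n)))
    (γ : EuclideanSpace ℝ (Fin n) → Matrix (Fin n) (Fin n) ℝ)
    (f : EuclideanSpace ℝ (Fin n) → ℝ) (k i : Fin n) (y : EuclideanSpace ℝ (Fin n)) : ℝ :=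
  partialD S i (gradCoord S γ f k) y + ∑ l, christoffel S γ k i l y * gradCoord S γ f l y

namespace IsMetricOn

theorem sum_mul_hessCoord (h : IsMetricOn W γ) (hy : y ∈ W) (l i : Fin n) :
    ∑ k, γ y l k * hessCoord S γ f k i y
      = ∑ k, γ y l k * partialD S i (gradCoord S γ f k) y
        + (1 / 2 : ℝ) * ∑ m, (partialD S i (fun z => γ z m l) y
          + partialD S m (fun z => γ z i l) y - partialD S l (fun z => γ z i m) y)
          * gradCoord S γ f m y := by
  have hlower : ∑ k, γ y l k * ∑ m, christoffel S γ k i m y * gradCoord S γ f m y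
      = ∑ m, (∑ k, γ y l k * christoffel S γ k i m y) * gradCoord S γ f m y := by
    simp only [Finset.mul_sum, Finset.sum_mul, mul_assoc]
    exact Finset.sum_comm
  simp only [hessCoord, mul_add, Finset.sum_add_distrib]
  rw [hlower]
  simp only [h.sum_mul_christoffel hy, mul_assoc, ← Finset.mul_sum]

theorem partialD_partialD (h : IsMetricOn W γ) (hW : IsOpen W) (hWS : W ⊆ S)
    (hf : ContDiffOn ℝ 2 f W) (hy : y ∈ W) (i l : Fin n) :
    partialD S i (partialD S l f) y
      = ∑ k, (partialD S i (fun z => γ z l k) y * gradCoord S γ f k y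
        + γ y l k * partialD S i (gradCoord S γ f k) y) := by
  rw [partialD_congr_of_eqOn (f' := fun z => ∑ k, γ z l k * gradCoord S γ f k z) hW
    (fun z hz => (h.sum_mul_gradCoord hz l).symm) hy]
  exact partialD_sum_mul (mem_of_superset (hW.mem_nhds hy) hWS) (h.differentiableAt_metric hW hy l)
    (h.differentiableAt_gradCoord hW hWS hf hy) i

theorem isSymm_mul_hessCoord (h : IsMetricOn W γ) (hW : IsOpen W) (hWS : W ⊆ S)
    (hf : ContDiffOn ℝ 2 f W) (hy : y ∈ W) :
    (γ y * Matrix.of fun k i => hessCoord S γ f k i y).IsSymm := by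
  have hessian_lower (l i : Fin n) : ∑ k, γ y l k * hessCoord S γ f k i y
      = partialD S i (partialD S l f) y - (1 / 2 : ℝ) * ∑ m, (partialD S i (fun z => γ z l m) y
        + partialD S l (fun z => γ z i m) y - partialD S m (fun z => γ z i l) y)
        * gradCoord S γ f m y := by
    rw [h.sum_mul_hessCoord hy, h.partialD_partialD hW hWS hf hy, Finset.mul_sum, Finset.mul_sum,
      ← Finset.sum_add_distrib, ← Finset.sum_sub_distrib]
    refine Finset.sum_congr rfl fun m _ => ?_
    rw [h.partialD_metric_symm hW hy i m l]
    ring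
  refine Matrix.IsSymm.ext fun l i => ?_
  simp only [Matrix.mul_apply, Matrix.of_apply, hessian_lower]
  rw [partialD_comm (mem_of_superset (hW.mem_nhds hy) hWS) (hf.contDiffAt (hW.mem_nhds hy))]
  simp only [h.partialD_metric_symm hW hy _ i l, add_comm]

theorem partialD_gradInnerCoord_self (h : IsMetricOn W γ) (hW : IsOpen W) (hWS : W ⊆ S)
    (hf : ContDiffOn ℝ 2 f W) (hy : y ∈ W) (l : Fin n) :
    partialD S l (gradInnerCoord S γ f f) y
      = 2 * ∑ i, (∑ k, γ y i k * hessCoord S γ f k l y) * gradCoord S γ f i y := by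
  have hpartial (j : Fin n) : DifferentiableAt ℝ (partialD S j f) y :=
    differentiableAt_of_contDiffOn (contDiffOn_partialD (k := 1) hW hWS hf (by norm_num) j)
      one_ne_zero hW hy
  have hexpand := partialD_sum_mul (mem_of_superset (hW.mem_nhds hy) hWS) hpartial
    (h.differentiableAt_gradCoord hW hWS hf hy) l
  set X : Fin n → ℝ := fun i => gradCoord S γ f i y with hX
  have hswap : ∑ i, ∑ k, γ y i k * X k * partialD S l (gradCoord S γ f i) y
      = ∑ i, ∑ k, γ y i k * partialD S l (gradCoord S γ f k) y * X i := by
    rw [Finset.sum_comm]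
    refine Finset.sum_congr rfl fun i _ => Finset.sum_congr rfl fun k _ => ?_
    rw [h.symm hy k i]
    ring
  have hcancel : ∑ i, ∑ m, partialD S m (fun z => γ z l i) y * X m * X i
      = ∑ i, ∑ m, partialD S i (fun z => γ z l m) y * X m * X i := by
    rw [Finset.sum_comm]
    exact Finset.sum_congr rfl fun i _ => Finset.sum_congr rfl fun m _ => by ring
  have hsymm : ∑ i, ∑ k, partialD S l (fun z => γ z i k) y * X k * X i
      = ∑ i, ∑ k, partialD S l (fun z => γ z k i) y * X k * X i := by
    simp only [h.partialD_metric_symm hW hy l]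
  simp only [h.partialD_partialD hW hWS hf hy, ← h.sum_mul_gradCoord (S := S) (f := f) hy,
    add_mul, Finset.sum_add_distrib, Finset.sum_mul] at hexpand
  change partialD S l (fun z => ∑ i, partialD S i f z * gradCoord S γ f i z) y = _
  rw [hexpand]
  simp only [h.sum_mul_hessCoord hy, add_mul, sub_mul, mul_assoc, Finset.sum_add_distrib,
    Finset.sum_sub_distrib, Finset.sum_mul, ← Finset.mul_sum, ← hX] at *
  linarith

theorem gradCoord_gradInnerCoord_self (h : IsMetricOn W γ) (hW : IsOpen W) (hWS : W ⊆ S)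
    (hf : ContDiffOn ℝ 2 f W) (hy : y ∈ W) (k : Fin n) :
    gradCoord S γ (gradInnerCoord S γ f f) k y
      = 2 * ∑ i, hessCoord S γ f k i y * gradCoord S γ f i y := by
  have hsymm (i l : Fin n) : ∑ j, γ y i j * hessCoord S γ f j l y
      = ∑ j, γ y l j * hessCoord S γ f j i y := by
    simpa only [Matrix.mul_apply, Matrix.of_apply] using
      (h.isSymm_mul_hessCoord hW hWS hf hy).apply l i
  rw [← h.sum_inv_mul hy k fun j => ∑ i, hessCoord S γ f j i y * gradCoord S γ f i y, gradCoord,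
    Finset.mul_sum]
  refine Finset.sum_congr rfl fun l _ => ?_
  simp only [h.partialD_gradInnerCoord_self hW hWS hf hy, hsymm _ l, mul_left_comm _ (2 : ℝ),
    Finset.sum_mul, Finset.mul_sum, mul_assoc]
  rw [Finset.sum_comm]

end IsMetricOn

section Algebra

variable (X : Fin n → ℝ) (dX C : Fin n → Fin n → ℝ) {Γ : Fin n → Fin n → Fin n → ℝ}
  {dΓ : Fin n → Fin n → Fin n → Fin n → ℝ}

theorem sum_christoffel_mul_christoffel (hΓ : ∀ k i j, Γ k i j = Γ k j i) :
    ∑ k, ∑ i, (∑ l, Γ k i l * X l) * ∑ l, Γ i k l * X l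
      = ∑ i, ∑ j, (∑ k, ∑ l, Γ k j l * Γ l i k) * X i * X j := by
  have hproduct (k l : Fin n) : (∑ j, Γ k l j * X j) * ∑ i, Γ l k i * X i
      = ∑ i, ∑ j, Γ k j l * Γ l i k * X i * X j := by
    rw [mul_comm, Finset.sum_mul_sum]
    refine Finset.sum_congr rfl fun i _ => Finset.sum_congr rfl fun j _ => ?_
    rw [hΓ k l j, hΓ l k i]
    ring
  simp only [hproduct, Finset.sum_mul]
  calc ∑ k, ∑ l, ∑ i, ∑ j, Γ k j l * Γ l i k * X i * X j
    _ = ∑ k, ∑ i, ∑ j, ∑ l, Γ k j l * Γ l i k * X i * X j := by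
      refine Finset.sum_congr rfl fun k _ => ?_
      rw [Finset.sum_comm]
      exact Finset.sum_congr rfl fun i _ => Finset.sum_comm
    _ = ∑ i, ∑ j, ∑ k, ∑ l, Γ k j l * Γ l i k * X i * X j := by
      rw [Finset.sum_comm]
      exact Finset.sum_congr rfl fun i _ => Finset.sum_comm

theorem sum_ricci_contraction (hΓ : ∀ k i j, Γ k i j = Γ k j i)
    (hdΓ : ∀ a k i j, dΓ a k i j = dΓ a k j i) :
    ∑ i, ∑ j, (∑ k, (dΓ k k i j - dΓ j k i k)
        + ∑ k, ∑ l, (Γ k k l * Γ l i j - Γ k j l * Γ l i k)) * X i * X j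
      = ∑ k, ∑ i, (∑ l, dΓ k k i l * X l) * X i - ∑ i, X i * ∑ k, (∑ l, dΓ i l l k) * X k
        + ∑ k, (∑ l, Γ l l k) * ∑ i, (∑ l, Γ k i l * X l) * X i
        - ∑ k, ∑ i, (∑ l, Γ k i l * X l) * ∑ l, Γ i k l * X l := by
  have hdiv : ∑ k, ∑ i, (∑ l, dΓ k k i l * X l) * X i
      = ∑ i, ∑ j, (∑ k, dΓ k k i j) * X i * X j := by
    simp only [Finset.sum_mul]
    rw [Finset.sum_comm]
    refine Finset.sum_congr rfl fun i _ => ?_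
    rw [Finset.sum_comm]
    exact Finset.sum_congr rfl fun j _ => Finset.sum_congr rfl fun k _ => by ring
  have htrace : ∑ i, X i * ∑ k, (∑ l, dΓ i l l k) * X k
      = ∑ i, ∑ j, (∑ k, dΓ j k i k) * X i * X j := by
    simp only [Finset.mul_sum, hdΓ _ _ _ (_ : Fin n)]
    rw [Finset.sum_comm]
    exact Finset.sum_congr rfl fun i _ => Finset.sum_congr rfl fun j _ => by ring
  have hproduct : ∑ k, (∑ l, Γ l l k) * ∑ i, (∑ l, Γ k i l * X l) * X i
      = ∑ i, ∑ j, (∑ k, ∑ l, Γ k k l * Γ l i j) * X i * X j := by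
    have hinner (i j : Fin n) :
        ∑ k, ∑ l, Γ k k l * Γ l i j = ∑ l, (∑ k, Γ k k l) * Γ l i j := by
      rw [Finset.sum_comm]
      simp only [Finset.sum_mul]
    obtain ⟨t, ht⟩ : ∃ t : Fin n → ℝ, ∀ k, ∑ l, Γ l l k = t k := ⟨_, fun _ => rfl⟩
    simp only [hinner, ht, Finset.sum_mul, Finset.mul_sum]
    rw [Finset.sum_comm]
    refine Finset.sum_congr rfl fun i _ => ?_
    rw [Finset.sum_comm]
    exact Finset.sum_congr rfl fun j _ => Finset.sum_congr rfl fun k _ => by ring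
  simp only [add_mul, sub_mul, Finset.sum_add_distrib, Finset.sum_sub_distrib, hdiv, htrace,
    hproduct, sum_christoffel_mul_christoffel X hΓ]
  ring

/-- The Bochner identity as a statement about arrays of numbers: `X` stands for a vector field,
`dX i k` for `∂_i X^k`, `C i k` for `∂_k ∂_i X^k`, and `dΓ a k i j` for `∂_a Γ^k_{ij}`. -/
theorem bochner_algebraic_identity (hΓ : ∀ k i j, Γ k i j = Γ k j i)
    (hdΓ : ∀ a k i j, dΓ a k i j = dΓ a k j i) :
    ∑ k, (∑ i, ((C i k + ∑ l, (dΓ k k i l * X l + Γ k i l * dX k l)) * X i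
        + (dX i k + ∑ l, Γ k i l * X l) * dX k i)
      + (∑ l, Γ l l k) * ∑ i, (dX i k + ∑ l, Γ k i l * X l) * X i)
    = ∑ k, ∑ i, (dX i k + ∑ l, Γ k i l * X l) * (dX k i + ∑ l, Γ i k l * X l)
      + ∑ i, (∑ k, (C i k + ((∑ l, dΓ i l l k) * X k + (∑ l, Γ l l k) * dX i k))) * X i
      + ∑ i, ∑ j, (∑ k, (dΓ k k i j - dΓ j k i k)
          + ∑ k, ∑ l, (Γ k k l * Γ l i j - Γ k j l * Γ l i k)) * X i * X j := by
  have hsecond : ∑ k, ∑ i, C i k * X i = ∑ i, (∑ k, C i k) * X i := by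
    rw [Finset.sum_comm]
    simp only [Finset.sum_mul]
  have hmixed : ∑ k, ∑ i, (∑ l, Γ k i l * dX k l) * X i
      = ∑ k, ∑ i, dX i k * ∑ l, Γ i k l * X l := by
    calc ∑ k, ∑ i, (∑ l, Γ k i l * dX k l) * X i
      _ = ∑ k, ∑ l, ∑ i, Γ k i l * dX k l * X i := by
        simp only [Finset.sum_mul]
        exact Finset.sum_congr rfl fun k _ => Finset.sum_comm
      _ = ∑ l, ∑ k, ∑ i, Γ k i l * dX k l * X i := Finset.sum_comm
      _ = ∑ k, ∑ i, dX i k * ∑ l, Γ i k l * X l := by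
        simp only [Finset.mul_sum]
        refine Finset.sum_congr rfl fun k _ => Finset.sum_congr rfl fun i _ =>
          Finset.sum_congr rfl fun l _ => ?_
        rw [hΓ i l k]
        ring
  have htrace : ∑ k, (∑ l, Γ l l k) * ∑ i, dX i k * X i
      = ∑ i, (∑ k, (∑ l, Γ l l k) * dX i k) * X i := by
    obtain ⟨t, ht⟩ : ∃ t : Fin n → ℝ, ∀ k, ∑ l, Γ l l k = t k := ⟨_, fun _ => rfl⟩
    simp only [ht, Finset.sum_mul, Finset.mul_sum, mul_assoc]
    exact Finset.sum_comm
  rw [sum_ricci_contraction X hΓ hdΓ]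
  simp only [add_mul, mul_add, Finset.sum_add_distrib]
  rw [hsecond, hmixed, htrace]
  simp only [mul_comm (X _)]
  ring

end Algebra

namespace IsMetricOn

theorem laplaceCoord_eq_trace_hessCoord (h : IsMetricOn W γ) (hW : IsOpen W) (hWS : W ⊆ S)
    (hf : ContDiffOn ℝ 2 f W) (hy : y ∈ W) :
    laplaceCoord S γ f y = (Matrix.of fun k i => hessCoord S γ f k i y).trace := by
  simp only [h.laplaceCoord_eq_div_gradCoord hW hWS hf hy, Matrix.trace, Matrix.diag_apply,
    Matrix.of_apply, hessCoord, Finset.sum_add_distrib, Finset.sum_mul, add_right_inj]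
  exact Finset.sum_comm

theorem differentiableAt_christoffel (h : IsMetricOn W γ) (hW : IsOpen W) (hWS : W ⊆ S)
    (hy : y ∈ W) (k i j : Fin n) : DifferentiableAt ℝ (christoffel S γ k i j) y :=
  differentiableAt_of_contDiffOn (h.contDiffOn_christoffel hW hWS k i j) (by simp) hW hy

theorem differentiableAt_partialD_gradCoord (h : IsMetricOn W γ) (hW : IsOpen W) (hWS : W ⊆ S)
    (hf : ContDiffOn ℝ 3 f W) (hy : y ∈ W) (i k : Fin n) :
    DifferentiableAt ℝ (partialD S i (gradCoord S γ f k)) y :=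
  differentiableAt_of_contDiffOn (contDiffOn_partialD (k := 1) hW hWS
    (h.contDiffOn_gradCoord (k := 2) hW hWS hf (by norm_num) (WithTop.coe_le_coe.2 le_top) k)
    (by norm_num) i) one_ne_zero hW hy

theorem differentiableAt_hessCoord (h : IsMetricOn W γ) (hW : IsOpen W) (hWS : W ⊆ S)
    (hf : ContDiffOn ℝ 3 f W) (hy : y ∈ W) (k i : Fin n) :
    DifferentiableAt ℝ (hessCoord S γ f k i) y :=
  (h.differentiableAt_partialD_gradCoord hW hWS hf hy i k).add
    (DifferentiableAt.fun_sum fun l _ => (h.differentiableAt_christoffel hW hWS hy k i l).fun_mul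
      (h.differentiableAt_gradCoord hW hWS (hf.of_le (by norm_num)) hy l))

theorem partialD_hessCoord (h : IsMetricOn W γ) (hW : IsOpen W) (hWS : W ⊆ S)
    (hf : ContDiffOn ℝ 3 f W) (hy : y ∈ W) (a k i : Fin n) :
    partialD S a (hessCoord S γ f k i) y = partialD S a (partialD S i (gradCoord S γ f k)) y
      + ∑ l, (partialD S a (christoffel S γ k i l) y * gradCoord S γ f l y
        + christoffel S γ k i l y * partialD S a (gradCoord S γ f l) y) := by
  have hS : S ∈ 𝓝 y := mem_of_superset (hW.mem_nhds hy) hWS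
  have hX := h.differentiableAt_gradCoord hW hWS (hf.of_le (by norm_num)) hy
  have hΓ := h.differentiableAt_christoffel hW hWS hy k i
  rw [← partialD_sum_mul hS hΓ hX a]
  exact partialD_add hS (h.differentiableAt_partialD_gradCoord hW hWS hf hy i k)
    (DifferentiableAt.fun_sum fun l _ => (hΓ l).fun_mul (hX l)) a

theorem half_laplaceCoord_gradInnerCoord_self (h : IsMetricOn W γ) (hW : IsOpen W) (hWS : W ⊆ S)
    (hf : ContDiffOn ℝ 3 f W) (hy : y ∈ W) :
    (1 / 2 : ℝ) * laplaceCoord S γ (gradInnerCoord S γ f f) y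
      = ∑ k, (∑ i, (partialD S k (hessCoord S γ f k i) y * gradCoord S γ f i y
          + hessCoord S γ f k i y * partialD S k (gradCoord S γ f i) y)
        + (∑ l, christoffel S γ l l k y)
          * ∑ i, hessCoord S γ f k i y * gradCoord S γ f i y) := by
  have hS : S ∈ 𝓝 y := mem_of_superset (hW.mem_nhds hy) hWS
  have hf2 : ContDiffOn ℝ 2 f W := hf.of_le (by norm_num)
  have hX := h.differentiableAt_gradCoord hW hWS hf2 hy
  have hA (k : Fin n) := h.differentiableAt_hessCoord hW hWS hf hy k
  have hsq : ContDiffOn ℝ 2 (gradInnerCoord S γ f f) W :=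
    h.contDiffOn_gradInnerCoord hW hWS hf hf (by norm_num) (by norm_num)
      (WithTop.coe_le_coe.2 le_top)
  rw [h.laplaceCoord_eq_div_gradCoord hW hWS hsq hy, Finset.mul_sum]
  refine Finset.sum_congr rfl fun k _ => ?_
  rw [partialD_congr_of_eqOn hW (fun z hz => h.gradCoord_gradInnerCoord_self hW hWS hf2 hz k) hy,
    partialD_const_mul hS (DifferentiableAt.fun_sum fun i _ => (hA k i).fun_mul (hX i)),
    partialD_sum_mul hS (hA k) hX, h.gradCoord_gradInnerCoord_self hW hWS hf2 hy]
  ring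

theorem partialD_laplaceCoord (h : IsMetricOn W γ) (hW : IsOpen W) (hWS : W ⊆ S)
    (hf : ContDiffOn ℝ 3 f W) (hy : y ∈ W) (i : Fin n) :
    partialD S i (laplaceCoord S γ f) y
      = ∑ k, (partialD S k (partialD S i (gradCoord S γ f k)) y
        + ((∑ l, partialD S i (christoffel S γ l l k) y) * gradCoord S γ f k y
          + (∑ l, christoffel S γ l l k y) * partialD S i (gradCoord S γ f k) y)) := by
  have hS : S ∈ 𝓝 y := mem_of_superset (hW.mem_nhds hy) hWS
  have hf2 : ContDiffOn ℝ 2 f W := hf.of_le (by norm_num)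
  have hX := h.differentiableAt_gradCoord hW hWS hf2 hy
  have hdX (k : Fin n) := h.differentiableAt_partialD_gradCoord hW hWS hf hy k k
  have hΓ (k l : Fin n) := h.differentiableAt_christoffel hW hWS hy l l k
  have htrace (k : Fin n) : DifferentiableAt ℝ (fun z => ∑ l, christoffel S γ l l k z) y :=
    DifferentiableAt.fun_sum fun l _ => hΓ k l
  rw [partialD_congr_of_eqOn hW (fun z hz => h.laplaceCoord_eq_div_gradCoord hW hWS hf2 hz) hy,
    partialD_sum hS _ fun k _ => (hdX k).fun_add ((htrace k).fun_mul (hX k))]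
  refine Finset.sum_congr rfl fun k _ => ?_
  have hXk : ContDiffOn ℝ 2 (gradCoord S γ f k) W :=
    h.contDiffOn_gradCoord hW hWS hf (by norm_num) (WithTop.coe_le_coe.2 le_top) k
  rw [partialD_add hS (hdX k) ((htrace k).fun_mul (hX k)), partialD_mul hS (htrace k) (hX k),
    partialD_sum hS _ fun l _ => hΓ k l, partialD_comm hS (hXk.contDiffAt (hW.mem_nhds hy))]

theorem bochner_identity (h : IsMetricOn W γ) (hW : IsOpen W) (hWS : W ⊆ S)
    (hf : ContDiffOn ℝ 3 f W) (hy : y ∈ W) :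
    (1 / 2 : ℝ) * laplaceCoord S γ (gradInnerCoord S γ f f) y
      = ∑ k, ∑ i, hessCoord S γ f k i y * hessCoord S γ f i k y
        + gradInnerCoord S γ (laplaceCoord S γ f) f y
        + ∑ i, ∑ j, ricciCoord S γ i j y * gradCoord S γ f i y * gradCoord S γ f j y := by
  have halgebra := bochner_algebraic_identity (fun i => gradCoord S γ f i y)
    (fun i k => partialD S i (gradCoord S γ f k) y)
    (fun i k => partialD S k (partialD S i (gradCoord S γ f k)) y)
    (fun k i j => h.christoffel_symm (S := S) hW hy k i j)
    (fun a k i j => h.partialD_christoffel_symm (S := S) hW hy a k i j)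
  rw [h.half_laplaceCoord_gradInnerCoord_self hW hWS hf hy, gradInnerCoord]
  simp only [h.partialD_hessCoord hW hWS hf hy, h.partialD_laplaceCoord hW hWS hf hy]
  exact halgebra

theorem bochner_inequality [NeZero n] (h : IsMetricOn W γ) (hW : IsOpen W) (hWS : W ⊆ S)
    (hf : ContDiffOn ℝ 3 f W) (hy : y ∈ W) :
    laplaceCoord S γ f y ^ 2 / n + gradInnerCoord S γ (laplaceCoord S γ f) f y
        + ∑ i, ∑ j, ricciCoord S γ i j y * gradCoord S γ f i y * gradCoord S γ f j y
      ≤ (1 / 2 : ℝ) * laplaceCoord S γ (gradInnerCoord S γ f f) y := by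
  have hf2 : ContDiffOn ℝ 2 f W := hf.of_le (by norm_num)
  have htrace := sq_trace_div_card_le_trace_mul_self (h.posDef y hy)
    (h.isSymm_mul_hessCoord (S := S) hW hWS hf2 hy)
  rw [← h.laplaceCoord_eq_trace_hessCoord hW hWS hf2 hy, Fintype.card_fin] at htrace
  rw [h.bochner_identity hW hWS hf hy, add_assoc, add_assoc]
  gcongr
  simpa [Matrix.trace, Matrix.mul_apply] using htrace

end IsMetricOn

end Bochner

/-! ### Change of coordinates -/

section ChangeOfCoordinates

open Filter Topology

variable {n : ℕ} {S W W' : Set (EuclideanSpace ℝ (Fin n))}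
  {γ γ' : EuclideanSpace ℝ (Fin n) → Matrix (Fin n) (Fin n) ℝ} {y : EuclideanSpace ℝ (Fin n)}
  {f f' : EuclideanSpace ℝ (Fin n) → ℝ} {τ : EuclideanSpace ℝ (Fin n) → EuclideanSpace ℝ (Fin n)}

/-- The Jacobian matrix `(∂_i τ^a)_{a, i}` of a map, one-sided at boundary points of `S`. -/
def jacobianMat (S : Set (EuclideanSpace ℝ (Fin n)))
    (τ : EuclideanSpace ℝ (Fin n) → EuclideanSpace ℝ (Fin n)) (y : EuclideanSpace ℝ (Fin n)) :
    Matrix (Fin n) (Fin n) ℝ :=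
  Matrix.of fun a i => fderivWithin ℝ τ S y (EuclideanSpace.single i 1) a

/-- The entrywise partial derivative `∂_k A` of a matrix field. -/
def partialMat (S : Set (EuclideanSpace ℝ (Fin n))) (k : Fin n)
    (A : EuclideanSpace ℝ (Fin n) → Matrix (Fin n) (Fin n) ℝ) (y : EuclideanSpace ℝ (Fin n)) :
    Matrix (Fin n) (Fin n) ℝ :=
  Matrix.of fun a b => partialD S k (fun z => A z a b) y

/-- At `y`, the map `τ` of `S` to itself is a change of coordinates that pulls the metric `γ'` back
to `γ`. The point `y` may lie on the boundary of `S`. -/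
structure IsCoordIsometryAt (S : Set (EuclideanSpace ℝ (Fin n)))
    (γ γ' : EuclideanSpace ℝ (Fin n) → Matrix (Fin n) (Fin n) ℝ)
    (τ : EuclideanSpace ℝ (Fin n) → EuclideanSpace ℝ (Fin n))
    (y : EuclideanSpace ℝ (Fin n)) : Prop where
  mem : y ∈ S
  uniqueDiff : UniqueDiffWithinAt ℝ S y
  differentiableWithinAt : DifferentiableWithinAt ℝ τ S y
  eventually_mem : ∀ᶠ z in 𝓝[S] y, τ z ∈ S
  isUnit_det : IsUnit (γ y).det
  pullback : γ y = (jacobianMat S τ y).transpose * γ' (τ y) * jacobianMat S τ y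

/-- `τ` is a `C²` map of open sets of coordinates `W → W'` that pulls the metric `γ'` back
to `γ`. -/
structure IsCoordIsometryOn (S W W' : Set (EuclideanSpace ℝ (Fin n)))
    (γ γ' : EuclideanSpace ℝ (Fin n) → Matrix (Fin n) (Fin n) ℝ)
    (τ : EuclideanSpace ℝ (Fin n) → EuclideanSpace ℝ (Fin n)) : Prop where
  isOpen : IsOpen W
  isOpen' : IsOpen W'
  subset : W ⊆ S
  subset' : W' ⊆ S
  metric : IsMetricOn W γ
  metric' : IsMetricOn W' γ'
  contDiffOn : ContDiffOn ℝ 2 τ W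
  mapsTo : MapsTo τ W W'
  pullback : ∀ z ∈ W, γ z = (jacobianMat S τ z).transpose * γ' (τ z) * jacobianMat S τ z

theorem euclidean_eq_sum_single (v : EuclideanSpace ℝ (Fin n)) :
    v = ∑ i, v i • EuclideanSpace.single i (1 : ℝ) := by
  ext j
  simp [Finset.sum_apply, Pi.single_apply]

theorem jacobianMat_eq_partialD (hS : UniqueDiffWithinAt ℝ S y)
    (hτ : DifferentiableWithinAt ℝ τ S y) (a i : Fin n) :
    jacobianMat S τ y a i = partialD S i (fun z => τ z a) y := by
  have hcoord : fderivWithin ℝ (fun z => τ z a) S y = _ :=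
    ((EuclideanSpace.proj a : EuclideanSpace ℝ (Fin n) →L[ℝ] ℝ).hasFDerivAt.comp_hasFDerivWithinAt
      y hτ.hasFDerivWithinAt).fderivWithin hS
  rw [partialD, hcoord]
  rfl

theorem partialD_comp (hyS : y ∈ S) (hS : UniqueDiffWithinAt ℝ S y)
    (hτ : DifferentiableWithinAt ℝ τ S y) (hτS : ∀ᶠ z in 𝓝[S] y, τ z ∈ S)
    (hf' : DifferentiableWithinAt ℝ f' S (τ y)) (hff : f =ᶠ[𝓝[S] y] f' ∘ τ) (i : Fin n) :
    partialD S i f y = ∑ a, jacobianMat S τ y a i * partialD S a f' (τ y) := by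
  have hcomp : HasFDerivWithinAt (f' ∘ τ)
      ((fderivWithin ℝ f' S (τ y)).comp (fderivWithin ℝ τ S y)) S y :=
    hf'.hasFDerivWithinAt.comp_of_tendsto y hτ.hasFDerivWithinAt
      (tendsto_nhdsWithin_iff.2 ⟨hτ.continuousWithinAt, hτS⟩)
  rw [partialD, hff.fderivWithin_eq (hff.self_of_nhdsWithin hyS), hcomp.fderivWithin hS,
    ContinuousLinearMap.comp_apply,
    euclidean_eq_sum_single (fderivWithin ℝ τ S y (EuclideanSpace.single i 1)), map_sum]
  simp only [map_smul, smul_eq_mul, jacobianMat, partialD, Matrix.of_apply]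

section MatrixIdentities

variable {P P' J : Matrix (Fin n) (Fin n) ℝ}

theorem mulVec_inv_transform (hJ : IsUnit J.det) (v : Fin n → ℝ) :
    J.mulVec ((J.transpose * P * J)⁻¹.mulVec (J.transpose.mulVec v)) = P⁻¹.mulVec v := by
  have hJt : IsUnit J.transpose.det := by rwa [Matrix.det_transpose]
  rw [Matrix.mulVec_mulVec, Matrix.mulVec_mulVec, Matrix.mul_inv_rev, Matrix.mul_inv_rev]
  congr 1
  rw [← Matrix.mul_assoc, Matrix.mul_nonsing_inv _ hJ, Matrix.one_mul, Matrix.mul_assoc,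
    Matrix.nonsing_inv_mul _ hJt, Matrix.mul_one]

theorem isUnit_det_of_eq_transpose_mul_mul (hP : P = J.transpose * P' * J) (hdet : IsUnit P.det) :
    IsUnit J.det := by
  rw [hP, Matrix.det_mul] at hdet
  exact isUnit_of_mul_isUnit_right hdet

/-- With `P' = Jᵀ P J` and `dP'` its derivative, this is the logarithmic derivative
`d log det P' = 2 d log det J + d log det P`. -/
theorem trace_inv_mul_transform {dP dJ : Matrix (Fin n) (Fin n) ℝ} (hJ : IsUnit J.det)
    (hP : IsUnit P.det) :
    ((J.transpose * P * J)⁻¹ * ((dJ.transpose * P + J.transpose * dP) * J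
      + J.transpose * P * dJ)).trace = 2 * (J⁻¹ * dJ).trace + (P⁻¹ * dP).trace := by
  have hJt : IsUnit J.transpose.det := by rwa [Matrix.det_transpose]
  have hright : ((J.transpose * P * J)⁻¹ * (J.transpose * P * dJ)).trace = (J⁻¹ * dJ).trace := by
    have hJP : IsUnit (J.transpose * P).det := by rw [Matrix.det_mul]; exact hJt.mul hP
    rw [Matrix.mul_inv_rev, Matrix.mul_assoc, Matrix.nonsing_inv_mul_cancel_left _ _ hJP]
  have hconj (X : Matrix (Fin n) (Fin n) ℝ) : ((J.transpose * P * J)⁻¹ * (X * J)).trace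
      = (P⁻¹ * (J.transpose⁻¹ * X)).trace := by
    rw [Matrix.mul_inv_rev, Matrix.mul_inv_rev, Matrix.mul_assoc, Matrix.trace_mul_comm,
      Matrix.mul_assoc, Matrix.mul_assoc, Matrix.mul_assoc, Matrix.mul_nonsing_inv _ hJ,
      Matrix.mul_one]
  have hleft : (P⁻¹ * (J.transpose⁻¹ * (dJ.transpose * P))).trace = (J⁻¹ * dJ).trace := by
    rw [Matrix.trace_mul_comm, Matrix.mul_assoc, Matrix.mul_assoc, Matrix.mul_nonsing_inv _ hP,
      Matrix.mul_one, ← Matrix.transpose_nonsing_inv, ← Matrix.transpose_mul,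
      Matrix.trace_transpose, Matrix.trace_mul_comm]
  rw [Matrix.mul_add, Matrix.trace_add, hright, hconj, Matrix.mul_add, Matrix.mul_add,
    Matrix.trace_add, hleft, Matrix.nonsing_inv_mul_cancel_left _ _ hJt]
  ring

end MatrixIdentities

theorem partialMat_mul (hS : S ∈ 𝓝 y)
    {A B : EuclideanSpace ℝ (Fin n) → Matrix (Fin n) (Fin n) ℝ}
    (hA : ∀ a b, DifferentiableAt ℝ (fun z => A z a b) y)
    (hB : ∀ a b, DifferentiableAt ℝ (fun z => B z a b) y) (k : Fin n) :
    partialMat S k (fun z => A z * B z) y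
      = partialMat S k A y * B y + A y * partialMat S k B y := by
  ext a b
  simp only [partialMat, Matrix.of_apply, Matrix.add_apply, Matrix.mul_apply]
  rw [partialD_sum_mul hS (hA a) fun c => hB c b, Finset.sum_add_distrib]

namespace IsCoordIsometryAt

theorem isUnit_jacobianMat_det (h : IsCoordIsometryAt S γ γ' τ y) :
    IsUnit (jacobianMat S τ y).det :=
  isUnit_det_of_eq_transpose_mul_mul h.pullback h.isUnit_det

theorem partialD_comp (h : IsCoordIsometryAt S γ γ' τ y)
    (hf' : DifferentiableWithinAt ℝ f' S (τ y)) (hff : f =ᶠ[𝓝[S] y] f' ∘ τ) (i : Fin n) :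
    partialD S i f y = ∑ a, jacobianMat S τ y a i * partialD S a f' (τ y) :=
  RiemannianGeom.partialD_comp h.mem h.uniqueDiff h.differentiableWithinAt h.eventually_mem hf'
    hff i

theorem gradCoord_comp (h : IsCoordIsometryAt S γ γ' τ y)
    (hf' : DifferentiableWithinAt ℝ f' S (τ y)) (hff : f =ᶠ[𝓝[S] y] f' ∘ τ) (a : Fin n) :
    gradCoord S γ' f' a (τ y) = ∑ k, jacobianMat S τ y a k * gradCoord S γ f k y := by
  have htransform := congrFun (mulVec_inv_transform (P := γ' (τ y)) h.isUnit_jacobianMat_det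
    fun b => partialD S b f' (τ y)) a
  have hpartial : (jacobianMat S τ y).transpose.mulVec (fun b => partialD S b f' (τ y))
      = fun i => partialD S i f y :=
    funext fun i => (h.partialD_comp hf' hff i).symm
  rw [hpartial, ← h.pullback] at htransform
  exact htransform.symm

theorem gradInnerCoord_comp {b b' : EuclideanSpace ℝ (Fin n) → ℝ}
    (h : IsCoordIsometryAt S γ γ' τ y)
    (hf' : DifferentiableWithinAt ℝ f' S (τ y)) (hff : f =ᶠ[𝓝[S] y] f' ∘ τ)
    (hb' : DifferentiableWithinAt ℝ b' S (τ y)) (hbb : b =ᶠ[𝓝[S] y] b' ∘ τ) :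
    gradInnerCoord S γ f b y = gradInnerCoord S γ' f' b' (τ y) := by
  simp only [gradInnerCoord, h.gradCoord_comp hb' hbb, h.partialD_comp hf' hff, Finset.sum_mul,
    Finset.mul_sum]
  rw [Finset.sum_comm]
  exact Finset.sum_congr rfl fun i _ => Finset.sum_congr rfl fun k _ => by ring

end IsCoordIsometryAt

theorem IsMetricOn.sum_christoffel_eq_trace (h : IsMetricOn W γ) (hW : IsOpen W) (hy : y ∈ W)
    (k : Fin n) :
    ∑ l, christoffel S γ l l k y = (1 / 2 : ℝ) * ((γ y)⁻¹ * partialMat S k γ y).trace := by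
  simp only [h.sum_christoffel hW hy, Matrix.trace, Matrix.diag_apply, Matrix.mul_apply, partialMat,
    Matrix.of_apply, h.partialD_metric_symm hW hy _ _]

namespace IsCoordIsometryOn

theorem mem_nhds (h : IsCoordIsometryOn S W W' γ γ' τ) (hy : y ∈ W) : S ∈ 𝓝 y :=
  mem_of_superset (h.isOpen.mem_nhds hy) h.subset

theorem isometryAt (h : IsCoordIsometryOn S W W' γ γ' τ) (hy : y ∈ W) :
    IsCoordIsometryAt S γ γ' τ y where
  mem := h.subset hy
  uniqueDiff := uniqueDiffWithinAt_of_mem_nhds (h.mem_nhds hy)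
  differentiableWithinAt :=
    ((h.contDiffOn.contDiffAt (h.isOpen.mem_nhds hy)).differentiableAt
      two_ne_zero).differentiableWithinAt
  eventually_mem := mem_nhdsWithin_of_mem_nhds <|
    mem_of_superset (h.isOpen.mem_nhds hy) fun _ hz => h.subset' (h.mapsTo hz)
  isUnit_det := h.metric.isUnit_det hy
  pullback := h.pullback y hy

theorem partialD_comp (h : IsCoordIsometryOn S W W' γ γ' τ) (hf' : ContDiffOn ℝ 1 f' W')
    (hff : EqOn f (f' ∘ τ) W) (hy : y ∈ W) (i : Fin n) :
    partialD S i f y = ∑ b, jacobianMat S τ y b i * partialD S b f' (τ y) :=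
  (h.isometryAt hy).partialD_comp
    (differentiableAt_of_contDiffOn hf' one_ne_zero h.isOpen'
      (h.mapsTo hy)).differentiableWithinAt
    (mem_nhdsWithin_of_mem_nhds (mem_of_superset (h.isOpen.mem_nhds hy) hff)) i

theorem gradCoord_comp (h : IsCoordIsometryOn S W W' γ γ' τ) (hf' : ContDiffOn ℝ 2 f' W')
    (hff : EqOn f (f' ∘ τ) W) (hy : y ∈ W) (a : Fin n) :
    gradCoord S γ' f' a (τ y) = ∑ k, jacobianMat S τ y a k * gradCoord S γ f k y :=
  (h.isometryAt hy).gradCoord_comp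
    (differentiableAt_of_contDiffOn hf' two_ne_zero h.isOpen'
      (h.mapsTo hy)).differentiableWithinAt
    (mem_nhdsWithin_of_mem_nhds (mem_of_superset (h.isOpen.mem_nhds hy) hff)) a

theorem contDiffOn_coord (h : IsCoordIsometryOn S W W' γ γ' τ) (a : Fin n) :
    ContDiffOn ℝ 2 (fun z => τ z a) W :=
  (EuclideanSpace.proj a : EuclideanSpace ℝ (Fin n) →L[ℝ] ℝ).contDiff.comp_contDiffOn h.contDiffOn

theorem jacobianMat_eqOn_partialD (h : IsCoordIsometryOn S W W' γ γ' τ) (a i : Fin n) :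
    EqOn (fun z => jacobianMat S τ z a i) (partialD S i fun z => τ z a) W := fun _ hz =>
  jacobianMat_eq_partialD (h.isometryAt hz).uniqueDiff (h.isometryAt hz).differentiableWithinAt a i

theorem differentiableAt_jacobianMat (h : IsCoordIsometryOn S W W' γ γ' τ) (hy : y ∈ W)
    (a i : Fin n) : DifferentiableAt ℝ (fun z => jacobianMat S τ z a i) y :=
  differentiableAt_of_contDiffOn (k := 1) ((contDiffOn_partialD h.isOpen h.subset
    (h.contDiffOn_coord a) (by norm_num) i).congr (h.jacobianMat_eqOn_partialD a i))
    one_ne_zero h.isOpen hy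

theorem partialD_jacobianMat_symm (h : IsCoordIsometryOn S W W' γ γ' τ) (hy : y ∈ W)
    (a i k : Fin n) :
    partialD S i (fun z => jacobianMat S τ z a k) y
      = partialD S k (fun z => jacobianMat S τ z a i) y := by
  rw [partialD_congr_of_eqOn h.isOpen (h.jacobianMat_eqOn_partialD a k) hy,
    partialD_congr_of_eqOn h.isOpen (h.jacobianMat_eqOn_partialD a i) hy,
    partialD_comm (h.mem_nhds hy) ((h.contDiffOn_coord a).contDiffAt (h.isOpen.mem_nhds hy))]

theorem contDiffOn_comp (h : IsCoordIsometryOn S W W' γ γ' τ) (hf' : ContDiffOn ℝ 2 f' W')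
    (hff : EqOn f (f' ∘ τ) W) : ContDiffOn ℝ 2 f W :=
  (hf'.comp h.contDiffOn h.mapsTo).congr hff

/-- The derivative of the transformation law `X' ∘ τ = J X` of the gradient. -/
theorem partialD_gradCoord_mul_jacobianMat (h : IsCoordIsometryOn S W W' γ γ' τ)
    (hf' : ContDiffOn ℝ 2 f' W') (hff : EqOn f (f' ∘ τ) W) (hy : y ∈ W) :
    (Matrix.of fun a b => partialD S b (gradCoord S γ' f' a) (τ y)) * jacobianMat S τ y
      = ∑ k, gradCoord S γ f k y • partialMat S k (jacobianMat S τ) y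
        + jacobianMat S τ y * Matrix.of fun k i => partialD S i (gradCoord S γ f k) y := by
  ext a i
  have hgrad' : ContDiffOn ℝ 1 (gradCoord S γ' f' a) W' :=
    h.metric'.contDiffOn_gradCoord h.isOpen' h.subset' hf' (by norm_num)
      (by exact_mod_cast le_top) a
  have hchain := h.partialD_comp (f := fun z => ∑ k, jacobianMat S τ z a k * gradCoord S γ f k z)
    hgrad' (fun z hz => (h.gradCoord_comp hf' hff hz a).symm) hy i
  rw [partialD_sum_mul (h.mem_nhds hy) (h.differentiableAt_jacobianMat hy a)
    (h.metric.differentiableAt_gradCoord h.isOpen h.subset (h.contDiffOn_comp hf' hff) hy)]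
    at hchain
  simp only [Matrix.mul_apply, Matrix.of_apply, Matrix.add_apply, Matrix.sum_apply,
    Matrix.smul_apply, partialMat, smul_eq_mul, mul_comm (partialD S _ (gradCoord S γ' f' a) _)]
  rw [← hchain, ← Finset.sum_add_distrib]
  exact Finset.sum_congr rfl fun k _ => by rw [h.partialD_jacobianMat_symm hy a i k]; ring

theorem sum_partialD_gradCoord_comp (h : IsCoordIsometryOn S W W' γ γ' τ)
    (hf' : ContDiffOn ℝ 2 f' W') (hff : EqOn f (f' ∘ τ) W) (hy : y ∈ W) :
    ∑ a, partialD S a (gradCoord S γ' f' a) (τ y)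
      = ∑ k, gradCoord S γ f k y
          * ((jacobianMat S τ y)⁻¹ * partialMat S k (jacobianMat S τ) y).trace
        + ∑ k, partialD S k (gradCoord S γ f k) y := by
  have hJ := (h.isometryAt hy).isUnit_jacobianMat_det
  have htrace := congrArg (fun A => ((jacobianMat S τ y)⁻¹ * A).trace)
    (h.partialD_gradCoord_mul_jacobianMat hf' hff hy)
  simp only [Matrix.mul_add, Matrix.trace_add] at htrace
  rw [Matrix.nonsing_inv_mul_cancel_left _ _ hJ, ← Matrix.mul_assoc, Matrix.trace_mul_comm,
    ← Matrix.mul_assoc, Matrix.mul_nonsing_inv _ hJ, Matrix.one_mul, Matrix.mul_sum,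
    Matrix.trace_sum] at htrace
  simp only [Matrix.mul_smul, Matrix.trace_smul, smul_eq_mul] at htrace
  exact htrace

theorem partialMat_metric (h : IsCoordIsometryOn S W W' γ γ' τ) (hy : y ∈ W) (k : Fin n) :
    partialMat S k γ y = ((partialMat S k (jacobianMat S τ) y).transpose * γ' (τ y)
        + (jacobianMat S τ y).transpose
          * ∑ b, jacobianMat S τ y b k • partialMat S b γ' (τ y)) * jacobianMat S τ y
      + (jacobianMat S τ y).transpose * γ' (τ y) * partialMat S k (jacobianMat S τ) y := by
  have hS := h.mem_nhds hy
  have hJ := h.differentiableAt_jacobianMat hy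
  have hτ : DifferentiableAt ℝ τ y :=
    (h.contDiffOn.contDiffAt (h.isOpen.mem_nhds hy)).differentiableAt two_ne_zero
  have hγ' (a b : Fin n) : DifferentiableAt ℝ (fun z => γ' (τ z) a b) y :=
    (h.metric'.differentiableAt_metric h.isOpen' (h.mapsTo hy) a b).comp y hτ
  have hJt (a b : Fin n) : DifferentiableAt ℝ (fun z => (jacobianMat S τ z).transpose a b) y :=
    hJ b a
  have hJγ' (a b : Fin n) : DifferentiableAt ℝ
      (fun z => ((jacobianMat S τ z).transpose * γ' (τ z)) a b) y := by
    simp only [Matrix.mul_apply]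
    exact DifferentiableAt.fun_sum fun c _ => (hJt a c).fun_mul (hγ' c b)
  have hpullback : partialMat S k γ y = partialMat S k
      (fun z => (jacobianMat S τ z).transpose * γ' (τ z) * jacobianMat S τ z) y := by
    ext a b
    exact partialD_congr_of_eqOn h.isOpen (fun z hz => by simp only [h.pullback z hz]) hy k
  have hchain : partialMat S k (fun z => γ' (τ z)) y
      = ∑ b, jacobianMat S τ y b k • partialMat S b γ' (τ y) := by
    ext a c
    simp only [partialMat, Matrix.of_apply, Matrix.sum_apply, Matrix.smul_apply, smul_eq_mul]
    exact h.partialD_comp ((h.metric'.smooth a c).of_le (by exact_mod_cast le_top))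
      (fun _ _ => rfl) hy k
  rw [hpullback, partialMat_mul hS hJγ' hJ, partialMat_mul hS hJt hγ', hchain]
  rfl

theorem sum_christoffel_comp (h : IsCoordIsometryOn S W W' γ γ' τ) (hy : y ∈ W) (k : Fin n) :
    ∑ l, christoffel S γ l l k y
      = ((jacobianMat S τ y)⁻¹ * partialMat S k (jacobianMat S τ) y).trace
        + ∑ b, jacobianMat S τ y b k * ∑ l, christoffel S γ' l l b (τ y) := by
  rw [h.metric.sum_christoffel_eq_trace h.isOpen hy, h.partialMat_metric hy, h.pullback y hy,
    trace_inv_mul_transform (h.isometryAt hy).isUnit_jacobianMat_det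
      (h.metric'.isUnit_det (h.mapsTo hy)), Matrix.mul_sum, Matrix.trace_sum]
  simp only [Matrix.mul_smul, Matrix.trace_smul, smul_eq_mul, mul_add, Finset.mul_sum,
    h.metric'.sum_christoffel_eq_trace h.isOpen' (h.mapsTo hy)]
  congr 1
  · ring
  · exact Finset.sum_congr rfl fun b _ => by ring

theorem laplaceCoord_comp (h : IsCoordIsometryOn S W W' γ γ' τ) (hf' : ContDiffOn ℝ 2 f' W')
    (hff : EqOn f (f' ∘ τ) W) (hy : y ∈ W) :
    laplaceCoord S γ f y = laplaceCoord S γ' f' (τ y) := by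
  rw [h.metric.laplaceCoord_eq_div_gradCoord h.isOpen h.subset (h.contDiffOn_comp hf' hff) hy,
    h.metric'.laplaceCoord_eq_div_gradCoord h.isOpen' h.subset' hf' (h.mapsTo hy),
    Finset.sum_add_distrib, Finset.sum_add_distrib, h.sum_partialD_gradCoord_comp hf' hff hy]
  have hcontract : ∑ a, (∑ l, christoffel S γ' l l a (τ y)) * gradCoord S γ' f' a (τ y)
      = ∑ k, (∑ b, jacobianMat S τ y b k * ∑ l, christoffel S γ' l l b (τ y))
        * gradCoord S γ f k y := by
    simp only [h.gradCoord_comp hf' hff hy]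
    obtain ⟨t, ht⟩ : ∃ t : Fin n → ℝ, ∀ b, ∑ l, christoffel S γ' l l b (τ y) = t b :=
      ⟨_, fun _ => rfl⟩
    simp only [ht, Finset.mul_sum, Finset.sum_mul]
    rw [Finset.sum_comm]
    exact Finset.sum_congr rfl fun i _ => Finset.sum_congr rfl fun k _ => by ring
  simp only [hcontract, h.sum_christoffel_comp hy, add_mul, Finset.sum_add_distrib,
    mul_comm (gradCoord S γ f _ y)]
  ring

end IsCoordIsometryOn

end ChangeOfCoordinates

/-! ### The metric in charts -/

section Charts

open Filter Topology

variable {n : ℕ} {H : Type*} [TopologicalSpace H]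
  (I : ModelWithCorners ℝ (EuclideanSpace ℝ (Fin n)) H)
  {M : Type*} [TopologicalSpace M] [ChartedSpace H M]

/-- The derivative of the inverse of the chart around `p`, as an endomorphism of the model space,
to which the tangent spaces of `M` are definitionally equal. -/
def chartD (p : M) (y : EuclideanSpace ℝ (Fin n)) :
    EuclideanSpace ℝ (Fin n) →L[ℝ] EuclideanSpace ℝ (Fin n) :=
  mfderivWithin 𝓘(ℝ, EuclideanSpace ℝ (Fin n)) I (extChartAt I p).symm (range I) y

/-- The change of coordinates from the chart around `p` to the chart around `q`. -/
def transition (p q : M) (y : EuclideanSpace ℝ (Fin n)) : EuclideanSpace ℝ (Fin n) :=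
  extChartAt I q ((extChartAt I p).symm y)

/-- The part of the image of the chart around `p` that lies in the domain of the chart
around `q`. -/
def overlap (p q : M) : Set (EuclideanSpace ℝ (Fin n)) :=
  (extChartAt I p).target ∩ (extChartAt I p).symm ⁻¹' (extChartAt I q).source

variable {I} {p q x : M} {y : EuclideanSpace ℝ (Fin n)}

theorem mem_overlap (hp : x ∈ (extChartAt I p).source) (hq : x ∈ (extChartAt I q).source) :
    extChartAt I p x ∈ overlap I p q :=
  ⟨(extChartAt I p).map_source hp, by rwa [mem_preimage, (extChartAt I p).left_inv hp]⟩

theorem overlap_mem_nhdsWithin (hy : y ∈ overlap I p q) : overlap I p q ∈ 𝓝[range I] y := by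
  refine inter_mem (extChartAt_target_mem_nhdsWithin_of_mem hy.1) ?_
  have hpreimage := (continuousOn_extChartAt_symm (I := I) p y hy.1).preimage_mem_nhdsWithin
    ((isOpen_extChartAt_source (I := I) q).mem_nhds hy.2)
  rwa [nhdsWithin_extChartAt_target_eq_of_mem hy.1] at hpreimage

theorem transition_mem_overlap (hy : y ∈ overlap I p q) :
    transition I p q y ∈ overlap I q p := by
  refine ⟨(extChartAt I q).map_source hy.2, ?_⟩
  rw [mem_preimage, transition, (extChartAt I q).left_inv hy.2]
  exact (extChartAt I p).map_target hy.1

theorem symm_transition (hy : y ∈ overlap I p q) :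
    (extChartAt I q).symm (transition I p q y) = (extChartAt I p).symm y :=
  (extChartAt I q).left_inv hy.2

theorem transition_transition (hy : y ∈ overlap I p q) :
    transition I q p (transition I p q y) = y := by
  rw [transition, symm_transition hy, (extChartAt I p).right_inv hy.1]

theorem transition_extChartAt (q : M) (hp : x ∈ (extChartAt I p).source) :
    transition I p q (extChartAt I p x) = extChartAt I q x := by
  rw [transition, (extChartAt I p).left_inv hp]

theorem interior_target_subset_range (p : M) : interior (extChartAt I p).target ⊆ range I :=
  interior_subset.trans (extChartAt_target_subset_range p)

theorem range_mem_nhds (hy : y ∈ interior (extChartAt I p).target) : range I ∈ 𝓝 y :=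
  mem_of_superset (isOpen_interior.mem_nhds hy) (interior_target_subset_range p)

theorem uniqueDiffWithinAt_range (hy : y ∈ (extChartAt I p).target) :
    UniqueDiffWithinAt ℝ (range I) y :=
  I.uniqueDiffOn _ (extChartAt_target_subset_range p hy)

variable [IsManifold I ∞ M]

theorem mem_interior_iff (p : M) (hx : x ∈ (extChartAt I p).source) :
    x ∈ I.interior M ↔ extChartAt I p x ∈ interior (extChartAt I p).target := by
  rw [extChartAt_source] at hx
  exact I.isInteriorPoint_iff_of_mem_atlas (n := ∞) (by simp) (chart_mem_atlas H p) hx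

theorem symm_mem_interior_iff (hy : y ∈ (extChartAt I p).target) :
    (extChartAt I p).symm y ∈ I.interior M ↔ y ∈ interior (extChartAt I p).target := by
  rw [mem_interior_iff p ((extChartAt I p).map_target hy), (extChartAt I p).right_inv hy]

theorem isOpen_manifold_interior : IsOpen (I.interior M) := I.isOpen_interior (n := ∞) (by simp)

theorem contDiffWithinAt_transition (hy : y ∈ overlap I p q) :
    ContDiffWithinAt ℝ ∞ (transition I p q) (range I) y := by
  refine contDiffWithinAt_ext_coord_change q p ?_
  rw [PartialEquiv.trans_source, PartialEquiv.symm_source]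
  exact hy

theorem differentiableWithinAt_transition (hy : y ∈ overlap I p q) :
    DifferentiableWithinAt ℝ (transition I p q) (range I) y :=
  (contDiffWithinAt_transition hy).differentiableWithinAt (by simp)

theorem chartD_injective (hy : y ∈ (extChartAt I p).target) :
    Function.Injective (chartD I p y) := by
  have hinv := mfderiv_extChartAt_comp_mfderivWithin_extChartAt_symm (I := I) hy
  intro v w hvw
  exact ((congrArg (fun L => L v) hinv).symm.trans (congrArg
    (mfderiv I 𝓘(ℝ, EuclideanSpace ℝ (Fin n)) (extChartAt I p) ((extChartAt I p).symm y))
    hvw)).trans (congrArg (fun L => L w) hinv)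

theorem coordsOf_chartD (x : M) (v : EuclideanSpace ℝ (Fin n)) :
    coordsOf I x (chartD I x (extChartAt I x x) v) = v :=
  congrArg (fun L => L v) (mfderiv_extChartAt_comp_mfderivWithin_extChartAt_symm' (I := I)
    (mem_extChartAt_source (I := I) x))

theorem chartD_transition (hy : y ∈ overlap I p q) (v : EuclideanSpace ℝ (Fin n)) :
    chartD I p y v = chartD I q (transition I p q y)
      (fderivWithin ℝ (transition I p q) (range I) y v) := by
  have hsource : (extChartAt I p).symm y ∈ (chartAt H q).source := by
    rw [← extChartAt_source I]; exact hy.2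
  have hchain := mfderiv_comp_mfderivWithin (I := 𝓘(ℝ, EuclideanSpace ℝ (Fin n))) (I' := I)
    (I'' := 𝓘(ℝ, EuclideanSpace ℝ (Fin n))) y (g := extChartAt I q)
    (f := (extChartAt I p).symm) (s := range I) (mdifferentiableAt_extChartAt hsource)
    (mdifferentiableWithinAt_extChartAt_symm hy.1)
    (I.uniqueMDiffOn _ (extChartAt_target_subset_range p hy.1))
  rw [mfderivWithin_eq_fderivWithin] at hchain
  have happly := congrArg (fun L => L v) hchain
  change fderivWithin ℝ (transition I p q) (range I) y v = _ at happly
  rw [happly]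
  exact (congrArg (fun L => L (chartD I p y v))
    (mfderivWithin_extChartAt_symm_comp_mfderiv_extChartAt' (I := I) hy.2)).symm

variable (m : Bundle.ContMDiffRiemannianMetric I ∞ (EuclideanSpace ℝ (Fin n))
    (fun x : M => TangentSpace I x))

/-- The metric at `x`, as a bilinear form on the model space. -/
def metricForm (x : M) :
    EuclideanSpace ℝ (Fin n) →L[ℝ] EuclideanSpace ℝ (Fin n) →L[ℝ] ℝ := m.inner x

theorem gram_apply (p : M) (y : EuclideanSpace ℝ (Fin n)) (i j : Fin n) :
    gram I m p y i j = metricForm m ((extChartAt I p).symm y)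
      (chartD I p y (EuclideanSpace.single i 1)) (chartD I p y (EuclideanSpace.single j 1)) := rfl

theorem metricForm_sum (x : M) (v w : Fin n → EuclideanSpace ℝ (Fin n)) (a b : Fin n → ℝ) :
    metricForm m x (∑ i, a i • v i) (∑ j, b j • w j)
      = ∑ i, ∑ j, a i * b j * metricForm m x (v i) (w j) := by
  simp only [map_sum, map_smul, sum_apply, smul_apply, smul_eq_mul, Finset.mul_sum]
  rw [Finset.sum_comm]
  exact Finset.sum_congr rfl fun i _ => Finset.sum_congr rfl fun j _ => by ring

theorem metricForm_chartD (p : M) (y v w : EuclideanSpace ℝ (Fin n)) :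
    metricForm m ((extChartAt I p).symm y) (chartD I p y v) (chartD I p y w)
      = ∑ i, ∑ j, v i * w j * gram I m p y i j := by
  have hsum (v : EuclideanSpace ℝ (Fin n)) : chartD I p y v
      = ∑ i, v i • chartD I p y (EuclideanSpace.single i 1) := by
    conv_lhs => rw [euclidean_eq_sum_single v, map_sum]
    simp only [map_smul]
  rw [hsum v, hsum w, metricForm_sum]
  rfl

theorem gram_transition (hy : y ∈ overlap I p q) :
    gram I m p y = (jacobianMat (range I) (transition I p q) y).transpose
      * gram I m q (transition I p q y) * jacobianMat (range I) (transition I p q) y := by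
  ext i j
  rw [gram_apply, chartD_transition hy, chartD_transition hy, ← symm_transition hy,
    metricForm_chartD]
  simp only [Matrix.mul_apply, Matrix.transpose_apply, Finset.sum_mul, jacobianMat,
    Matrix.of_apply]
  rw [Finset.sum_comm]
  exact Finset.sum_congr rfl fun i _ => Finset.sum_congr rfl fun j _ => by ring

theorem gram_posDef (hy : y ∈ (extChartAt I p).target) : (gram I m p y).PosDef := by
  refine Matrix.PosDef.of_dotProduct_mulVec_pos ?_ fun v hv => ?_
  · ext i j
    simp only [Matrix.conjTranspose_apply, star_trivial]
    exact m.symm _ _ _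
  · have hform : star v ⬝ᵥ (gram I m p y).mulVec v = metricForm m ((extChartAt I p).symm y)
        (chartD I p y (WithLp.toLp 2 v)) (chartD I p y (WithLp.toLp 2 v)) := by
      rw [metricForm_chartD]
      simp only [dotProduct, Matrix.mulVec, Finset.mul_sum, Pi.star_apply, star_trivial]
      exact Finset.sum_congr rfl fun i _ => Finset.sum_congr rfl fun j _ => by ring
    rw [hform]
    refine m.pos _ _ fun hzero => hv ?_
    have hv0 : WithLp.toLp 2 v = (0 : EuclideanSpace ℝ (Fin n)) :=
      chartD_injective hy (hzero.trans (map_zero (chartD I p y)).symm)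
    exact congrArg WithLp.ofLp hv0

theorem contMDiffOn_coordVec (p : M) (i : Fin n) :
    ContMDiffOn 𝓘(ℝ, EuclideanSpace ℝ (Fin n)) I.tangent ∞
      (fun y => (⟨(extChartAt I p).symm y, coordVec I p i y⟩ : TangentBundle I M))
      (extChartAt I p).target := by
  have hsymm := (contMDiffOn_extChartAt_symm (I := I) (n := ∞) p).contMDiffOn_tangentMapWithin
    (m := ∞) (by simp) (uniqueDiffOn_extChartAt_target p).uniqueMDiffOn
  have hconst : ContMDiffOn 𝓘(ℝ, EuclideanSpace ℝ (Fin n))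
      (𝓘(ℝ, EuclideanSpace ℝ (Fin n)).tangent) ∞
      (fun y : EuclideanSpace ℝ (Fin n) => (⟨y, EuclideanSpace.single i (1 : ℝ)⟩ :
        TangentBundle 𝓘(ℝ, EuclideanSpace ℝ (Fin n)) (EuclideanSpace ℝ (Fin n))))
      (extChartAt I p).target :=
    contMDiffOn_vectorSpace_iff_contDiffOn.2 contDiffOn_const
  refine (hsymm.comp hconst fun y hy => hy).congr fun y hy => ?_
  simp only [tangentMapWithin, Function.comp_apply, coordVec]
  rw [mfderivWithin_congr_set (I := 𝓘(ℝ, EuclideanSpace ℝ (Fin n))) (I' := I)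
    (f := (extChartAt I p).symm) (extChartAt_target_eventuallyEq_of_mem hy)]

theorem contDiffOn_gram (p : M) (i j : Fin n) :
    ContDiffOn ℝ ∞ (fun y => gram I m p y i j) (extChartAt I p).target := by
  rw [← contMDiffOn_iff_contDiffOn]
  intro y hy
  have hinner : ContMDiffWithinAt 𝓘(ℝ, EuclideanSpace ℝ (Fin n)) (I.prod 𝓘(ℝ)) ∞
      (fun y => Bundle.TotalSpace.mk' ℝ (E := Bundle.Trivial M ℝ) ((extChartAt I p).symm y)
        (m.inner ((extChartAt I p).symm y) (coordVec I p i y) (coordVec I p j y)))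
      (extChartAt I p).target y :=
    ContMDiffWithinAt.clm_bundle_apply₂ (F₁ := EuclideanSpace ℝ (Fin n))
      (F₂ := EuclideanSpace ℝ (Fin n))
      (m.contMDiff.contMDiffAt.comp_contMDiffWithinAt y (contMDiffOn_extChartAt_symm p y hy))
      (contMDiffOn_coordVec p i y hy) (contMDiffOn_coordVec p j y hy)
  rw [Bundle.contMDiffWithinAt_totalSpace] at hinner
  exact hinner.2

theorem isMetricOn_gram (p : M) : IsMetricOn (extChartAt I p).target (gram I m p) :=
  ⟨fun i j => contDiffOn_gram m p i j, fun _ hy => gram_posDef m hy⟩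

theorem isMetricOn_gram_interior (p : M) :
    IsMetricOn (interior (extChartAt I p).target) (gram I m p) :=
  (isMetricOn_gram m p).mono interior_subset

theorem isCoordIsometryAt_transition (hy : y ∈ overlap I p q) :
    IsCoordIsometryAt (range I) (gram I m p) (gram I m q) (transition I p q) y where
  mem := extChartAt_target_subset_range p hy.1
  uniqueDiff := uniqueDiffWithinAt_range hy.1
  differentiableWithinAt := differentiableWithinAt_transition hy
  eventually_mem := mem_of_superset (overlap_mem_nhdsWithin hy) fun _ hz =>
    extChartAt_target_subset_range q (transition_mem_overlap hz).1
  isUnit_det := (isMetricOn_gram m p).isUnit_det hy.1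
  pullback := gram_transition m hy

theorem isCoordIsometryOn_transition (p q : M) :
    IsCoordIsometryOn (range I) (interior (overlap I p q)) (interior (extChartAt I q).target)
      (gram I m p) (gram I m q) (transition I p q) where
  isOpen := isOpen_interior
  isOpen' := isOpen_interior
  subset := (interior_mono inter_subset_left).trans (interior_target_subset_range p)
  subset' := interior_target_subset_range q
  metric := (isMetricOn_gram_interior m p).mono (interior_mono inter_subset_left)
  metric' := isMetricOn_gram_interior m q
  contDiffOn _ hz := ((contDiffWithinAt_transition (interior_subset hz)).of_le
    (WithTop.coe_le_coe.2 le_top)).mono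
      ((interior_mono inter_subset_left).trans (interior_target_subset_range p))
  mapsTo _ hz := (mem_interior_iff q (interior_subset hz).2).1 <|
    (symm_mem_interior_iff (interior_subset hz).1).2 (interior_mono inter_subset_left hz)
  pullback _ hz := gram_transition m (interior_subset hz)

end Charts

/-! ### Functions on the manifold -/

section CoordinateCongr

open Filter Topology

variable {n : ℕ} {S : Set (EuclideanSpace ℝ (Fin n))}
  {γ : EuclideanSpace ℝ (Fin n) → Matrix (Fin n) (Fin n) ℝ} {y : EuclideanSpace ℝ (Fin n)}
  {a a' b b' : EuclideanSpace ℝ (Fin n) → ℝ}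

theorem gradInnerCoord_congr (hy : y ∈ S) (ha : a =ᶠ[𝓝[S] y] a') (hb : b =ᶠ[𝓝[S] y] b') :
    gradInnerCoord S γ a b y = gradInnerCoord S γ a' b' y := by
  simp only [gradInnerCoord, gradCoord, partialD_congr ha (ha.self_of_nhdsWithin hy),
    partialD_congr hb (hb.self_of_nhdsWithin hy)]

theorem laplaceCoord_congr (h : a =ᶠ[𝓝 y] a') :
    laplaceCoord S γ a y = laplaceCoord S γ a' y := by
  have hpartial (j : Fin n) : partialD S j a =ᶠ[𝓝 y] partialD S j a' :=
    h.eventuallyEq_nhds.mono fun z hz => partialD_congr_of_eventuallyEq hz j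
  have hflux (i j : Fin n) : partialD S i (fun z => √(γ z).det * (γ z)⁻¹ i j * partialD S j a z) y
      = partialD S i (fun z => √(γ z).det * (γ z)⁻¹ i j * partialD S j a' z) y :=
    partialD_congr_of_eventuallyEq ((hpartial j).mono fun z hz => by simp only [hz]) i
  simp only [laplaceCoord, hflux]

end CoordinateCongr

section Functions

open Filter Topology

variable {n : ℕ} {H : Type*} [TopologicalSpace H]
  (I : ModelWithCorners ℝ (EuclideanSpace ℝ (Fin n)) H)
  {M : Type*} [TopologicalSpace M] [ChartedSpace H M]

/-- The expression of a function in the chart around `p`. -/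
def inChart (p : M) (f : M → ℝ) (y : EuclideanSpace ℝ (Fin n)) : ℝ := f ((extChartAt I p).symm y)

variable {I} {k : WithTop ℕ∞} {f f' : M → ℝ} {p q x : M} {y : EuclideanSpace ℝ (Fin n)}

theorem inChart_extChartAt (hx : x ∈ (extChartAt I p).source) (f : M → ℝ) :
    inChart I p f (extChartAt I p x) = f x := by
  rw [inChart, (extChartAt I p).left_inv hx]

theorem inChart_eventuallyEq (hy : y ∈ (extChartAt I p).target)
    (h : f =ᶠ[𝓝 ((extChartAt I p).symm y)] f') :
    inChart I p f =ᶠ[𝓝[range I] y] inChart I p f' := by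
  have heventually := (continuousOn_extChartAt_symm (I := I) p y hy).eventually h
  rwa [nhdsWithin_extChartAt_target_eq_of_mem hy] at heventually

theorem inChart_eventuallyEq_self (h : f =ᶠ[𝓝 x] f') :
    inChart I x f =ᶠ[𝓝[range I] (extChartAt I x x)] inChart I x f' :=
  inChart_eventuallyEq (mem_extChartAt_target x) (by rwa [extChartAt_to_inv])

theorem inChart_eventuallyEq_transition (hy : y ∈ overlap I p q) (f : M → ℝ) :
    inChart I p f =ᶠ[𝓝[range I] y] inChart I q f ∘ transition I p q := by
  filter_upwards [overlap_mem_nhdsWithin hy] with z hz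
  rw [Function.comp_apply, inChart, inChart, symm_transition hz]

theorem eventuallyEq_inChart_comp_extChartAt (x : M) (f : M → ℝ) :
    f =ᶠ[𝓝 x] inChart I x f ∘ extChartAt I x := by
  filter_upwards [extChartAt_source_mem_nhds (I := I) x] with z hz
  exact (inChart_extChartAt hz f).symm

theorem continuous_of_continuousOn_inChart
    (h : ∀ p, ContinuousOn (inChart I p f) (extChartAt I p).target) : Continuous f := by
  refine continuous_iff_continuousAt.2 fun x => ?_
  refine ContinuousAt.congr ?_ (eventuallyEq_inChart_comp_extChartAt (I := I) x f).symm
  have hcomp := (h x).comp (continuousOn_extChartAt (I := I) x) (extChartAt I x).mapsTo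
  exact hcomp.continuousAt (extChartAt_source_mem_nhds x)

theorem differentiableWithinAt_inChart (h : MDifferentiableAt I 𝓘(ℝ, ℝ) f x) :
    DifferentiableWithinAt ℝ (inChart I x f) (range I) (extChartAt I x x) :=
  h.differentiableWithinAt_writtenInExtChartAt

theorem continuousOn_partialD_target {a : EuclideanSpace ℝ (Fin n) → ℝ}
    (ha : ContDiffOn ℝ 1 a (extChartAt I p).target) (i : Fin n) :
    ContinuousOn (partialD (range I) i a) (extChartAt I p).target := by
  have hcont : ContinuousOn (fun y => fderivWithin ℝ a (extChartAt I p).target y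
      (EuclideanSpace.single i 1)) (extChartAt I p).target :=
    (ha.continuousOn_fderivWithin (uniqueDiffOn_extChartAt_target p) le_rfl).clm_apply
      continuousOn_const
  refine hcont.congr fun y hy => ?_
  rw [partialD, ← fderivWithin_congr_set (extChartAt_target_eventuallyEq_of_mem hy)]

variable [IsManifold I ∞ M]

theorem contDiffOn_inChart (h : ContMDiff I 𝓘(ℝ, ℝ) k f) (hk : k ≤ ∞) (p : M) :
    ContDiffOn ℝ k (inChart I p f) (extChartAt I p).target := by
  rw [← contMDiffOn_iff_contDiffOn]
  exact h.comp_contMDiffOn ((contMDiffOn_extChartAt_symm (n := ∞) p).of_le hk)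

theorem contDiffOn_inChart_interior (h : ContMDiffOn I 𝓘(ℝ, ℝ) k f (I.interior M)) (hk : k ≤ ∞)
    (p : M) : ContDiffOn ℝ k (inChart I p f) (interior (extChartAt I p).target) := by
  rw [← contMDiffOn_iff_contDiffOn]
  exact h.comp (((contMDiffOn_extChartAt_symm (n := ∞) p).of_le hk).mono interior_subset)
    fun y hy => (symm_mem_interior_iff (interior_subset hy)).2 hy

theorem contMDiffOn_interior_of_inChart (hk : k ≤ ∞)
    (h : ∀ p, ContDiffOn ℝ k (inChart I p f) (interior (extChartAt I p).target)) :
    ContMDiffOn I 𝓘(ℝ, ℝ) k f (I.interior M) := by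
  intro x hx
  have hcoord := (h x).contDiffAt (isOpen_interior.mem_nhds
    ((mem_interior_iff x (mem_extChartAt_source x)).1 hx))
  have hcomp := hcoord.contMDiffAt.comp x ((contMDiffAt_extChartAt (n := ∞)).of_le hk)
  exact (hcomp.congr_of_eventuallyEq
    (eventuallyEq_inChart_comp_extChartAt x f)).contMDiffWithinAt

theorem contMDiffAt_of_mem_interior (h : ContMDiffOn I 𝓘(ℝ, ℝ) k f (I.interior M))
    (hx : x ∈ I.interior M) : ContMDiffAt I 𝓘(ℝ, ℝ) k f x :=
  h.contMDiffAt (isOpen_manifold_interior.mem_nhds hx)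

theorem contMDiff_of_eventuallyEq_zero_boundary (h : ContMDiffOn I 𝓘(ℝ, ℝ) k f (I.interior M))
    (h0 : ∀ x ∈ I.boundary M, f =ᶠ[𝓝 x] 0) : ContMDiff I 𝓘(ℝ, ℝ) k f := by
  intro x
  rcases I.isInteriorPoint_or_isBoundaryPoint x with hx | hx
  · exact contMDiffAt_of_mem_interior h hx
  · exact contMDiffAt_const.congr_of_eventuallyEq (h0 x hx)

variable (m : Bundle.ContMDiffRiemannianMetric I ∞ (EuclideanSpace ℝ (Fin n))
    (fun x : M => TangentSpace I x))

/-- The inner product `⟨∇a, ∇b⟩` of two gradients, computed in the chart around `x`. -/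
def gradInner (a b : M → ℝ) (x : M) : ℝ :=
  gradInnerCoord (range I) (gram I m x) (inChart I x a) (inChart I x b) (extChartAt I x x)

variable {a a' b b' : M → ℝ}

theorem gradInner_eq_gradInnerCoord (hx : x ∈ (extChartAt I p).source)
    (ha : MDifferentiableAt I 𝓘(ℝ, ℝ) a x) (hb : MDifferentiableAt I 𝓘(ℝ, ℝ) b x) :
    gradInner m a b x = gradInnerCoord (range I) (gram I m p) (inChart I p a) (inChart I p b)
      (extChartAt I p x) := by
  have hy := mem_overlap hx (mem_extChartAt_source (I := I) x)
  have ht := transition_extChartAt (I := I) x hx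
  rw [gradInner, ← ht]
  exact ((isCoordIsometryAt_transition m hy).gradInnerCoord_comp
    (ht ▸ differentiableWithinAt_inChart ha) (inChart_eventuallyEq_transition hy a)
    (ht ▸ differentiableWithinAt_inChart hb) (inChart_eventuallyEq_transition hy b)).symm

theorem inChart_gradInner (hy : y ∈ (extChartAt I p).target)
    (ha : MDifferentiableAt I 𝓘(ℝ, ℝ) a ((extChartAt I p).symm y))
    (hb : MDifferentiableAt I 𝓘(ℝ, ℝ) b ((extChartAt I p).symm y)) :
    inChart I p (gradInner m a b) y
      = gradInnerCoord (range I) (gram I m p) (inChart I p a) (inChart I p b) y := by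
  rw [inChart, gradInner_eq_gradInnerCoord m ((extChartAt I p).map_target hy) ha hb,
    (extChartAt I p).right_inv hy]

theorem laplacian_eq_laplaceCoord (hf : ContMDiffOn I 𝓘(ℝ, ℝ) 2 f (I.interior M))
    (hx : x ∈ (extChartAt I p).source) (hxi : x ∈ I.interior M) :
    laplacian I m f x
      = laplaceCoord (range I) (gram I m p) (inChart I p f) (extChartAt I p x) := by
  have hy := mem_overlap hx (mem_extChartAt_source (I := I) x)
  have hyi : extChartAt I p x ∈ interior (overlap I p x) := by
    have hmem := overlap_mem_nhdsWithin hy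
    rw [nhdsWithin_eq_nhds.2 (range_mem_nhds ((mem_interior_iff p hx).1 hxi))] at hmem
    exact mem_interior_iff_mem_nhds.2 hmem
  have hff : EqOn (inChart I p f) (inChart I x f ∘ transition I p x)
      (interior (overlap I p x)) := fun z hz => by
    rw [Function.comp_apply, inChart, inChart, symm_transition (interior_subset hz)]
  rw [(isCoordIsometryOn_transition m p x).laplaceCoord_comp
    (contDiffOn_inChart_interior hf (WithTop.coe_le_coe.2 le_top) x) hff hyi,
    transition_extChartAt x hx]
  rfl

theorem inChart_laplacian (hf : ContMDiffOn I 𝓘(ℝ, ℝ) 2 f (I.interior M))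
    (hy : y ∈ interior (extChartAt I p).target) :
    inChart I p (laplacian I m f) y
      = laplaceCoord (range I) (gram I m p) (inChart I p f) y := by
  have hyt := interior_subset hy
  rw [inChart, laplacian_eq_laplaceCoord m hf ((extChartAt I p).map_target hyt)
    ((symm_mem_interior_iff hyt).2 hy), (extChartAt I p).right_inv hyt]

theorem gradInner_congr (ha : a =ᶠ[𝓝 x] a') (hb : b =ᶠ[𝓝 x] b') :
    gradInner m a b x = gradInner m a' b' x :=
  gradInnerCoord_congr (mem_range_self _) (inChart_eventuallyEq_self ha)
    (inChart_eventuallyEq_self hb)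

theorem laplacian_congr (hf : f =ᶠ[𝓝 x] f') (hx : x ∈ I.interior M) :
    laplacian I m f x = laplacian I m f' x := by
  have hchart := inChart_eventuallyEq_self (I := I) hf
  rw [nhdsWithin_eq_nhds.2
    (range_mem_nhds ((mem_interior_iff x (mem_extChartAt_source x)).1 hx))] at hchart
  exact laplaceCoord_congr hchart

theorem gradInner_comm (a b : M → ℝ) (x : M) : gradInner m a b x = gradInner m b a x := by
  simp only [gradInner, gradInnerCoord, gradCoord, Finset.mul_sum]
  rw [Finset.sum_comm]
  refine Finset.sum_congr rfl fun i _ => Finset.sum_congr rfl fun j _ => ?_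
  rw [(isMetricOn_gram m x).inv_symm (mem_extChartAt_target x)]
  ring

theorem gradInner_mul_left (c : M → ℝ) (ha : MDifferentiableAt I 𝓘(ℝ, ℝ) a x)
    (hb : MDifferentiableAt I 𝓘(ℝ, ℝ) b x) :
    gradInner m (fun z => a z * b z) c x = a x * gradInner m b c x + b x * gradInner m a c x := by
  have hpartial (i : Fin n) :
      partialD (range I) i (inChart I x fun z => a z * b z) (extChartAt I x x)
        = a x * partialD (range I) i (inChart I x b) (extChartAt I x x)
          + b x * partialD (range I) i (inChart I x a) (extChartAt I x x) := by
    have hmul := fderivWithin_fun_mul (uniqueDiffWithinAt_range (mem_extChartAt_target x))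
      (differentiableWithinAt_inChart ha) (differentiableWithinAt_inChart hb)
    rw [inChart_extChartAt (mem_extChartAt_source x),
      inChart_extChartAt (mem_extChartAt_source x)] at hmul
    exact congrArg (fun L => L (EuclideanSpace.single i 1)) hmul
  simp only [gradInner, gradInnerCoord, hpartial, add_mul, Finset.sum_add_distrib,
    Finset.mul_sum, mul_assoc]

theorem gradInner_sum_left {ι : Type*} (s : Finset ι) {a : ι → M → ℝ} (c : M → ℝ)
    (ha : ∀ j ∈ s, MDifferentiableAt I 𝓘(ℝ, ℝ) (a j) x) :
    gradInner m (fun z => ∑ j ∈ s, a j z) c x = ∑ j ∈ s, gradInner m (a j) c x := by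
  have hpartial (i : Fin n) :
      partialD (range I) i (inChart I x fun z => ∑ j ∈ s, a j z) (extChartAt I x x)
        = ∑ j ∈ s, partialD (range I) i (inChart I x (a j)) (extChartAt I x x) := by
    have hsum := fderivWithin_fun_sum (uniqueDiffWithinAt_range (mem_extChartAt_target x))
      fun j hj => differentiableWithinAt_inChart (ha j hj)
    exact (congrArg (fun L => L (EuclideanSpace.single i 1)) hsum).trans (sum_apply ..)
  simp only [gradInner, gradInnerCoord, hpartial, Finset.sum_mul]
  rw [Finset.sum_comm]

theorem gradInner_comp_left {F : ℝ → ℝ} {F' : ℝ} (c : M → ℝ)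
    (hF : HasDerivAt F F' (a x)) (ha : MDifferentiableAt I 𝓘(ℝ, ℝ) a x) :
    gradInner m (fun z => F (a z)) c x = F' * gradInner m a c x := by
  have hpartial (i : Fin n) :
      partialD (range I) i (inChart I x fun z => F (a z)) (extChartAt I x x)
        = F' * partialD (range I) i (inChart I x a) (extChartAt I x x) := by
    rw [← inChart_extChartAt (I := I) (mem_extChartAt_source x) a] at hF
    have hcomp := (hF.comp_hasFDerivWithinAt _ (differentiableWithinAt_inChart
      ha).hasFDerivWithinAt).fderivWithin (uniqueDiffWithinAt_range (mem_extChartAt_target x))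
    exact congrArg (fun L => L (EuclideanSpace.single i 1)) hcomp
  simp only [gradInner, gradInnerCoord, hpartial, mul_assoc, Finset.mul_sum]

theorem gradInner_self_nonneg (a : M → ℝ) (x : M) : 0 ≤ gradInner m a a x := by
  have hinv := ((isMetricOn_gram m x).posDef _ (mem_extChartAt_target x)).inv
  have hquad := hinv.posSemidef.dotProduct_mulVec_nonneg
    fun i => partialD (range I) i (inChart I x a) (extChartAt I x x)
  rwa [star_trivial] at hquad

theorem continuousOn_gradCoord_target {a : EuclideanSpace ℝ (Fin n) → ℝ}
    (ha : ContDiffOn ℝ 1 a (extChartAt I p).target) (i : Fin n) :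
    ContinuousOn (gradCoord (range I) (gram I m p) a i) (extChartAt I p).target :=
  continuousOn_finsetSum _ fun j _ => ((isMetricOn_gram m p).contDiffOn_inv i j).continuousOn.mul
    (continuousOn_partialD_target ha j)

theorem continuous_gradInner (ha : ContMDiff I 𝓘(ℝ, ℝ) 1 a) (hb : ContMDiff I 𝓘(ℝ, ℝ) 1 b) :
    Continuous (gradInner m a b) := by
  refine continuous_of_continuousOn_inChart (I := I) fun p => ?_
  have ha' := contDiffOn_inChart ha (WithTop.coe_le_coe.2 le_top) p
  have hb' := contDiffOn_inChart hb (WithTop.coe_le_coe.2 le_top) p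
  have hcoord : ContinuousOn (gradInnerCoord (range I) (gram I m p) (inChart I p a)
      (inChart I p b)) (extChartAt I p).target :=
    continuousOn_finsetSum _ fun j _ => (continuousOn_partialD_target ha' j).mul
      (continuousOn_gradCoord_target m hb' j)
  exact hcoord.congr fun y hy => inChart_gradInner m hy (ha.mdifferentiable one_ne_zero _)
    (hb.mdifferentiable one_ne_zero _)

theorem inChart_gradInner_eqOn_interior (ha : ContMDiffOn I 𝓘(ℝ, ℝ) 1 a (I.interior M))
    (hb : ContMDiffOn I 𝓘(ℝ, ℝ) 1 b (I.interior M)) (p : M) :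
    EqOn (inChart I p (gradInner m a b))
      (gradInnerCoord (range I) (gram I m p) (inChart I p a) (inChart I p b))
      (interior (extChartAt I p).target) := fun y hy => by
  have hxi := (symm_mem_interior_iff (interior_subset hy)).2 hy
  exact inChart_gradInner m (interior_subset hy)
    ((contMDiffAt_of_mem_interior ha hxi).mdifferentiableAt one_ne_zero)
    ((contMDiffAt_of_mem_interior hb hxi).mdifferentiableAt one_ne_zero)

theorem contMDiffOn_gradInner (hk : k + 1 ≤ ∞)
    (ha : ContMDiffOn I 𝓘(ℝ, ℝ) (k + 1) a (I.interior M))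
    (hb : ContMDiffOn I 𝓘(ℝ, ℝ) (k + 1) b (I.interior M)) :
    ContMDiffOn I 𝓘(ℝ, ℝ) k (gradInner m a b) (I.interior M) := by
  have hk' : k ≤ ∞ := le_self_add.trans hk
  refine contMDiffOn_interior_of_inChart hk' fun p => ?_
  exact ((isMetricOn_gram_interior m p).contDiffOn_gradInnerCoord isOpen_interior
    (interior_target_subset_range p) (contDiffOn_inChart_interior ha hk p)
    (contDiffOn_inChart_interior hb hk p) le_rfl le_rfl hk').congr
    (inChart_gradInner_eqOn_interior m (ha.of_le le_add_self) (hb.of_le le_add_self) p)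

theorem contMDiffOn_laplacian (hk : k + 2 ≤ ∞)
    (hf : ContMDiffOn I 𝓘(ℝ, ℝ) (k + 2) f (I.interior M)) :
    ContMDiffOn I 𝓘(ℝ, ℝ) k (laplacian I m f) (I.interior M) := by
  have hk1 : k + 1 ≤ ∞ := le_trans (by gcongr; norm_num) hk
  refine contMDiffOn_interior_of_inChart (le_self_add.trans hk) fun p => ?_
  exact ((isMetricOn_gram_interior m p).contDiffOn_laplaceCoord isOpen_interior
    (interior_target_subset_range p) (contDiffOn_inChart_interior hf hk p) le_rfl hk1).congr
    fun y hy => inChart_laplacian m (hf.of_le le_add_self) hy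

end Functions

/-! ### The Bochner inequality -/

section ManifoldBochner

open Filter Topology

variable {n : ℕ} {H : Type*} [TopologicalSpace H]
  {I : ModelWithCorners ℝ (EuclideanSpace ℝ (Fin n)) H}
  {M : Type*} [TopologicalSpace M] [ChartedSpace H M] [IsManifold I ∞ M]
  (m : Bundle.ContMDiffRiemannianMetric I ∞ (EuclideanSpace ℝ (Fin n))
    (fun x : M => TangentSpace I x)) {u : M → ℝ} {x : M}

/-- The gradient of `u` at `x`. -/
def gradVec (u : M → ℝ) (x : M) : TangentSpace I x :=
  chartD I x (extChartAt I x x) <| WithLp.toLp 2 fun i =>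
    gradCoord (range I) (gram I m x) (inChart I x u) i (extChartAt I x x)

theorem ricci_gradVec (u : M → ℝ) (x : M) :
    ricci I m x (gradVec m u x) (gradVec m u x)
      = ∑ i, ∑ j, ricciCoord (range I) (gram I m x) i j (extChartAt I x x)
        * gradCoord (range I) (gram I m x) (inChart I x u) i (extChartAt I x x)
        * gradCoord (range I) (gram I m x) (inChart I x u) j (extChartAt I x x) := by
  simp only [ricci, gradVec, coordsOf_chartD]

theorem inner_gradVec_self (u : M → ℝ) (x : M) :
    m.inner x (gradVec m u x) (gradVec m u x) = gradInner m u u x := by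
  have hform := metricForm_chartD m x (extChartAt I x x)
    (WithLp.toLp 2 fun i => gradCoord (range I) (gram I m x) (inChart I x u) i (extChartAt I x x))
    (WithLp.toLp 2 fun i => gradCoord (range I) (gram I m x) (inChart I x u) i (extChartAt I x x))
  rw [extChartAt_to_inv] at hform
  refine hform.trans (Finset.sum_congr rfl fun i _ => ?_)
  rw [← (isMetricOn_gram m x).sum_mul_gradCoord (S := range I) (f := inChart I x u)
    (mem_extChartAt_target x) i, Finset.sum_mul]
  exact Finset.sum_congr rfl fun j _ => by ring

theorem bochner_inequality [NeZero n] {c : ℝ}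
    (hRic : ∀ v : TangentSpace I x, c * m.inner x v v ≤ ricci I m x v v)
    (hu : ContMDiffOn I 𝓘(ℝ, ℝ) 3 u (I.interior M)) (hx : x ∈ I.interior M) :
    laplacian I m u x ^ 2 / n + gradInner m (laplacian I m u) u x + c * gradInner m u u x
      ≤ (1 / 2 : ℝ) * laplacian I m (gradInner m u u) x := by
  have hy := (mem_interior_iff x (mem_extChartAt_source x)).1 hx
  have hy_nhds := isOpen_interior.mem_nhds hy
  have hu1 : ContMDiffOn I 𝓘(ℝ, ℝ) 1 u (I.interior M) := hu.of_le (by norm_num)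
  have hbochner := (isMetricOn_gram_interior m x).bochner_inequality isOpen_interior
    (interior_target_subset_range x)
    (contDiffOn_inChart_interior hu (WithTop.coe_le_coe.2 le_top) x) hy
  have hlaplace : inChart I x (laplacian I m u) =ᶠ[𝓝 (extChartAt I x x)]
      laplaceCoord (range I) (gram I m x) (inChart I x u) :=
    eventuallyEq_of_mem hy_nhds fun z hz => inChart_laplacian m (hu.of_le (by norm_num)) hz
  have hgrad : inChart I x (gradInner m u u) =ᶠ[𝓝 (extChartAt I x x)]
      gradInnerCoord (range I) (gram I m x) (inChart I x u) (inChart I x u) :=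
    (inChart_gradInner_eqOn_interior m hu1 hu1 x).eventuallyEq_of_mem hy_nhds
  rw [← ricci_gradVec m, ← laplaceCoord_congr hgrad,
    ← gradInnerCoord_congr (interior_target_subset_range x hy)
      (hlaplace.filter_mono nhdsWithin_le_nhds) .rfl] at hbochner
  have hricci := hRic (gradVec m u x)
  rw [inner_gradVec_self] at hricci
  exact (add_le_add_right hricci _).trans hbochner

end ManifoldBochner

/-! ### The Riemannian measure -/

section Glue

variable {V X : Type*} [MeasurableSpace V] [MeasurableSpace X]

theorem iSup_restrict_eq {ι : Type*} {ν : ι → Measure X} {U : ι → Set X}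
    (hU : ∀ i, MeasurableSet (U i)) (hν : ∀ i, ν i (U i)ᶜ = 0)
    (hc : ∀ i j A, MeasurableSet A → A ⊆ U i ∩ U j → ν i A = ν j A) (i : ι) :
    (⨆ j, ν j).restrict (U i) = ν i := by
  have hself : (ν i).restrict (U i) = ν i := Measure.restrict_eq_self_of_ae_mem (hν i)
  have hle_inside (j : ι) {A : Set X} (hA : MeasurableSet A) : ν j (A ∩ U i) ≤ ν i A := by
    rw [← Measure.restrict_eq_self_of_ae_mem (hν j), Measure.restrict_apply (hA.inter (hU i)),
      hc j i _ ((hA.inter (hU i)).inter (hU j)) fun x hx => ⟨hx.2, hx.1.2⟩]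
    exact measure_mono (inter_subset_left.trans inter_subset_left)
  have hle : (⨆ j, ν j) ≤ ν i + (⊤ : Measure X).restrict (U i)ᶜ := by
    refine iSup_le fun j => Measure.le_iff.2 fun A hA => ?_
    rw [← measure_inter_add_sdiff A (hU i), Measure.add_apply, Measure.restrict_apply hA]
    exact add_le_add (hle_inside j hA) ((le_top : ν j ≤ ⊤) _)
  refine le_antisymm ?_ (hself.ge.trans (Measure.restrict_mono le_rfl (le_iSup ν i)))
  refine (Measure.restrict_mono le_rfl hle).trans ?_
  rw [Measure.restrict_add, hself, Measure.restrict_restrict (hU i), inter_compl_self,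
    Measure.restrict_empty, add_zero]

theorem isFiniteMeasure_of_isCompact_nhds [TopologicalSpace X] [CompactSpace X] {ν : Measure X}
    (h : ∀ x, ∃ K ∈ nhds x, ν K < ⊤) : IsFiniteMeasure ν :=
  ⟨isCompact_univ.measure_lt_top_of_nhdsWithin fun x _ => by
    rw [nhdsWithin_univ]
    exact h x⟩

theorem measure_eq_zero_of_forall_nhds [TopologicalSpace X] [CompactSpace X] {ν : Measure X}
    {A : Set X} (h : ∀ x, ∃ U, MeasurableSet U ∧ U ∈ nhds x ∧ ν (A ∩ U) = 0) : ν A = 0 := by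
  rw [← Measure.restrict_apply_univ]
  refine isCompact_univ.measure_zero_of_nhdsWithin fun x _ => ?_
  obtain ⟨U, hU, hxU, hnull⟩ := h x
  exact ⟨U, mem_nhdsWithin_of_mem_nhds hxU, by rwa [Measure.restrict_apply hU, inter_comm]⟩

variable [TopologicalSpace V] [BorelSpace V] [TopologicalSpace X] [BorelSpace X]
  {μ : Measure V} {T : Set V} {ρ : V → ENNReal} {g : V → X}

theorem measurableSet_inter_preimage (hT : MeasurableSet T) (hg : ContinuousOn g T) {A : Set X}
    (hA : MeasurableSet A) : MeasurableSet (T ∩ g ⁻¹' A) := by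
  rw [← Subtype.image_preimage_coe]
  exact hT.subtype_image ((continuousOn_iff_continuous_domRestrict.1 hg).measurable hA)

theorem aemeasurable_withDensity (hT : MeasurableSet T) (hg : ContinuousOn g T) :
    AEMeasurable g ((μ.restrict T).withDensity ρ) :=
  (hg.aemeasurable hT).mono_ac (withDensity_absolutelyContinuous _ _)

theorem map_withDensity_apply [SFinite μ] (hT : MeasurableSet T) (hg : ContinuousOn g T)
    {A : Set X} (hA : MeasurableSet A) :
    ((μ.restrict T).withDensity ρ).map g A = ∫⁻ y in T ∩ g ⁻¹' A, ρ y ∂μ := by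
  rw [Measure.map_apply_of_aemeasurable (aemeasurable_withDensity hT hg) hA,
    withDensity_apply', Measure.restrict_restrict' hT, inter_comm]

theorem integral_map_withDensity (hT : MeasurableSet T) (hg : ContinuousOn g T) {r : V → ℝ}
    (hr : ContinuousOn r T) (hr0 : ∀ y ∈ T, 0 ≤ r y) {F : X → ℝ} (hF : Continuous F) :
    ∫ x, F x ∂((μ.restrict T).withDensity fun y => ENNReal.ofReal (r y)).map g
      = ∫ y in T, r y * F (g y) ∂μ := by
  rw [integral_map (aemeasurable_withDensity hT hg) hF.aestronglyMeasurable,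
    integral_withDensity_eq_integral_toReal_smul₀
      (hr.aemeasurable hT).ennreal_ofReal (by simp)]
  refine setIntegral_congr_fun hT fun y hy => ?_
  simp only [ENNReal.toReal_ofReal (hr0 y hy), smul_eq_mul]

end Glue

section ChangeOfVariables

theorem lintegral_eq_of_bijOn_of_det {V : Type*} [NormedAddCommGroup V] [NormedSpace ℝ V]
    [FiniteDimensional ℝ V] [MeasurableSpace V] [BorelSpace V] {μ : Measure V}
    [μ.IsAddHaarMeasure] {B B' : Set V} {τ : V → V} {D : V → V →L[ℝ] V} {r r' : V → ℝ}
    (hB : MeasurableSet B) (hτ : BijOn τ B B') (hD : ∀ y ∈ B, HasFDerivWithinAt τ (D y) B y)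
    (hr : ∀ y ∈ B, r y = |(D y).det| * r' (τ y)) :
    ∫⁻ y in B, ENNReal.ofReal (r y) ∂μ = ∫⁻ z in B', ENNReal.ofReal (r' z) ∂μ := by
  rw [← hτ.image_eq, lintegral_image_eq_lintegral_abs_det_fderiv_mul μ hB hD hτ.injOn]
  refine setLIntegral_congr_fun hB fun y hy => ?_
  simp only [hr y hy, ENNReal.ofReal_mul (abs_nonneg _)]

theorem sqrt_det_transpose_mul_mul {ι : Type*} [Fintype ι] [DecidableEq ι]
    (J γ : Matrix ι ι ℝ) : √(J.transpose * γ * J).det = |J.det| * √γ.det := by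
  rw [Matrix.det_mul, Matrix.det_mul, Matrix.det_transpose,
    show J.det * γ.det * J.det = J.det ^ 2 * γ.det by ring, Real.sqrt_mul (sq_nonneg _),
    Real.sqrt_sq_eq_abs]

theorem det_fderivWithin_eq_det_jacobianMat {n : ℕ} (S : Set (EuclideanSpace ℝ (Fin n)))
    (τ : EuclideanSpace ℝ (Fin n) → EuclideanSpace ℝ (Fin n)) (y : EuclideanSpace ℝ (Fin n)) :
    (fderivWithin ℝ τ S y).det = (jacobianMat S τ y).det := by
  rw [ContinuousLinearMap.det, ← LinearMap.det_toMatrix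
    (EuclideanSpace.basisFun (Fin n) ℝ).toBasis]
  rfl

end ChangeOfVariables

section Volume

variable {n : ℕ} {H : Type*} [TopologicalSpace H]
  {I : ModelWithCorners ℝ (EuclideanSpace ℝ (Fin n)) H}
  {M : Type*} [TopologicalSpace M] [ChartedSpace H M]

theorem measurableSet_target (p : M) : MeasurableSet (extChartAt I p).target := by
  rw [extChartAt_target]
  exact ((chartAt H p).open_target.preimage I.continuous_symm).measurableSet.inter
    I.isClosed_range.measurableSet

theorem bijOn_transition {p q : M} {A : Set M}
    (hA : A ⊆ (extChartAt I p).source ∩ (extChartAt I q).source) :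
    BijOn (transition I p q) ((extChartAt I p).target ∩ (extChartAt I p).symm ⁻¹' A)
      ((extChartAt I q).target ∩ (extChartAt I q).symm ⁻¹' A) := by
  have mapsTo {p q : M} (hAq : A ⊆ (extChartAt I q).source) : MapsTo (transition I p q)
      ((extChartAt I p).target ∩ (extChartAt I p).symm ⁻¹' A)
      ((extChartAt I q).target ∩ (extChartAt I q).symm ⁻¹' A) := fun y hy => by
    refine ⟨(transition_mem_overlap ⟨hy.1, hAq hy.2⟩).1, ?_⟩
    rw [mem_preimage, symm_transition ⟨hy.1, hAq hy.2⟩]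
    exact hy.2
  have hAp := hA.trans inter_subset_left
  have hAq := hA.trans inter_subset_right
  exact InvOn.bijOn ⟨fun y hy => transition_transition ⟨hy.1, hAq hy.2⟩,
    fun y hy => transition_transition ⟨hy.1, hAp hy.2⟩⟩ (mapsTo hAq) (mapsTo hAp)

variable [MeasurableSpace M] [BorelSpace M]

theorem measurableSet_source (p : M) : MeasurableSet (extChartAt I p).source :=
  (isOpen_extChartAt_source p).measurableSet

variable [IsManifold I ∞ M] (m : Bundle.ContMDiffRiemannianMetric I ∞ (EuclideanSpace ℝ (Fin n))
    (fun x : M => TangentSpace I x))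

theorem chartVolume_apply (p : M) {A : Set M} (hA : MeasurableSet A) :
    chartVolume I m p A = ∫⁻ y in (extChartAt I p).target ∩ (extChartAt I p).symm ⁻¹' A,
      ENNReal.ofReal (√(gram I m p y).det) :=
  map_withDensity_apply (measurableSet_target p) (continuousOn_extChartAt_symm p) hA

theorem chartVolume_eq_of_subset (p q : M) {A : Set M} (hA : MeasurableSet A)
    (hApq : A ⊆ (extChartAt I p).source ∩ (extChartAt I q).source) :
    chartVolume I m p A = chartVolume I m q A := by
  have hoverlap {y : EuclideanSpace ℝ (Fin n)}
      (hy : y ∈ (extChartAt I p).target ∩ (extChartAt I p).symm ⁻¹' A) : y ∈ overlap I p q :=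
    ⟨hy.1, (hApq hy.2).2⟩
  rw [chartVolume_apply m p hA, chartVolume_apply m q hA]
  refine lintegral_eq_of_bijOn_of_det (D := fderivWithin ℝ (transition I p q) (range I))
    (measurableSet_inter_preimage (measurableSet_target p) (continuousOn_extChartAt_symm p) hA)
    (bijOn_transition hApq) (fun y hy => ?_) fun y hy => ?_
  · exact (differentiableWithinAt_transition (hoverlap hy)).hasFDerivWithinAt.mono
      (inter_subset_left.trans (extChartAt_target_subset_range p))
  · rw [det_fderivWithin_eq_det_jacobianMat, gram_transition m (hoverlap hy),
      sqrt_det_transpose_mul_mul]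

theorem chartVolume_compl_source (p : M) : chartVolume I m p (extChartAt I p).sourceᶜ = 0 := by
  have hempty : (extChartAt I p).target ∩ (extChartAt I p).symm ⁻¹' (extChartAt I p).sourceᶜ = ∅ :=
    eq_empty_of_forall_notMem fun y hy => hy.2 ((extChartAt I p).map_target hy.1)
  rw [chartVolume_apply m p (measurableSet_source p).compl, hempty, Measure.restrict_empty,
    lintegral_zero_measure]

theorem riemVolume_restrict_source (p : M) :
    (riemVolume I m).restrict (extChartAt I p).source = chartVolume I m p :=
  iSup_restrict_eq (ν := chartVolume I m) (U := fun p => (extChartAt I p).source)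
    measurableSet_source (chartVolume_compl_source m)
    (fun p q _ hA hApq => chartVolume_eq_of_subset m p q hA hApq) p

theorem riemVolume_apply (p : M) {A : Set M} (hA : MeasurableSet A)
    (hAp : A ⊆ (extChartAt I p).source) : riemVolume I m A = chartVolume I m p A := by
  rw [← riemVolume_restrict_source, Measure.restrict_apply hA, inter_eq_left.2 hAp]

theorem integral_riemVolume_of_support_subset (p : M) {F : M → ℝ} (hF : Continuous F)
    (hsupp : Function.support F ⊆ (extChartAt I p).source) :
    ∫ x, F x ∂(riemVolume I m)
      = ∫ y in (extChartAt I p).target, √(gram I m p y).det * inChart I p F y := by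
  rw [← setIntegral_eq_integral_of_forall_compl_eq_zero (s := (extChartAt I p).source)
    fun x hx => Function.notMem_support.1 fun h => hx (hsupp h), riemVolume_restrict_source m p]
  exact integral_map_withDensity (measurableSet_target p) (continuousOn_extChartAt_symm p)
    (isMetricOn_gram m p).contDiffOn_sqrt_det.continuousOn (fun _ _ => Real.sqrt_nonneg _) hF

theorem isFiniteMeasure_riemVolume [T2Space M] [CompactSpace M] :
    IsFiniteMeasure (riemVolume I m) := by
  refine isFiniteMeasure_of_isCompact_nhds fun x => ?_
  obtain ⟨K, hK, hKs, hKx⟩ := local_compact_nhds (extChartAt_source_mem_nhds (I := I) x)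
  refine ⟨K, hK, ?_⟩
  have himage : (extChartAt I x).target ∩ (extChartAt I x).symm ⁻¹' K = extChartAt I x '' K :=
    ((extChartAt I x).image_eq_target_inter_inv_preimage hKs).symm
  rw [riemVolume_apply m x hKx.measurableSet hKs, chartVolume_apply m x hKx.measurableSet, himage]
  have hcompact : IsCompact (extChartAt I x '' K) :=
    hKx.image_of_continuousOn ((continuousOn_extChartAt x).mono hKs)
  refine Integrable.lintegral_lt_top (ContinuousOn.integrableOn_compact hcompact
    ((isMetricOn_gram m x).contDiffOn_sqrt_det.continuousOn.mono ?_))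
  exact ((extChartAt I x).mapsTo.mono_left hKs).image_subset

end Volume

/-! ### The measure of the boundary -/

section BoundaryMeasure

open Filter Topology

variable {d : ℕ}

/-- `hyperplaneIncl` as a continuous linear map. -/
def inclL (d : ℕ) : (Fin d → ℝ) →L[ℝ] EuclideanSpace ℝ (Fin (d + 1)) :=
  LinearMap.toContinuousLinearMap
    { toFun := hyperplaneIncl
      map_add' := fun z w => by
        ext i
        refine Fin.cases ?_ (fun i => ?_) i <;> simp [hyperplaneIncl]
      map_smul' := fun c z => by
        ext i
        refine Fin.cases ?_ (fun i => ?_) i <;> simp [hyperplaneIncl] }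

/-- The projection `y ↦ (y 1, …, y d)`, a left inverse of `hyperplaneIncl`. -/
def tailL (d : ℕ) : EuclideanSpace ℝ (Fin (d + 1)) →L[ℝ] (Fin d → ℝ) :=
  ContinuousLinearMap.pi fun i => EuclideanSpace.proj i.succ

@[simp] theorem hyperplaneIncl_zero (z : Fin d → ℝ) : hyperplaneIncl z 0 = 0 := rfl

@[simp] theorem hyperplaneIncl_succ (z : Fin d → ℝ) (i : Fin d) :
    hyperplaneIncl z i.succ = z i := rfl

theorem tailL_hyperplaneIncl (z : Fin d → ℝ) : tailL d (hyperplaneIncl z) = z := rfl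

theorem hyperplaneIncl_tailL {y : EuclideanSpace ℝ (Fin (d + 1))} (hy : y 0 = 0) :
    hyperplaneIncl (tailL d y) = y := by
  ext i
  exact Fin.cases hy.symm (fun _ => rfl) i

theorem hyperplaneIncl_single (j : Fin d) :
    hyperplaneIncl (Pi.single j 1) = EuclideanSpace.single j.succ (1 : ℝ) := by
  ext i
  refine Fin.cases ?_ (fun i => ?_) i
  · simp [Fin.succ_ne_zero]
  · simp [Pi.single_apply]

theorem continuous_hyperplaneIncl : Continuous (hyperplaneIncl (d := d)) := (inclL d).continuous

theorem continuous_coord (i : Fin (d + 1)) :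
    Continuous fun y : EuclideanSpace ℝ (Fin (d + 1)) => y i :=
  (EuclideanSpace.proj i : EuclideanSpace ℝ (Fin (d + 1)) →L[ℝ] ℝ).continuous

theorem volume_coord_zero_eq_zero :
    volume {y : EuclideanSpace ℝ (Fin (d + 1)) | y 0 = 0} = 0 := by
  refine Measure.addHaar_submodule (volume : Measure (EuclideanSpace ℝ (Fin (d + 1))))
    (LinearMap.ker (EuclideanSpace.proj (0 : Fin (d + 1)) :
      EuclideanSpace ℝ (Fin (d + 1)) →L[ℝ] ℝ).toLinearMap) fun htop => ?_
  have hmem : EuclideanSpace.single (0 : Fin (d + 1)) (1 : ℝ) ∈ LinearMap.ker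
      (EuclideanSpace.proj (0 : Fin (d + 1)) :
        EuclideanSpace ℝ (Fin (d + 1)) →L[ℝ] ℝ).toLinearMap := htop ▸ Submodule.mem_top
  simp at hmem

variable {H : Type*} [TopologicalSpace H]

/-- The model is `ℝᵈ⁺¹` or the closed half-space `0 ≤ y 0`. -/
def IsHalfSpaceModel (I : ModelWithCorners ℝ (EuclideanSpace ℝ (Fin (d + 1))) H) : Prop :=
  range I = univ ∨ range I = {y : EuclideanSpace ℝ (Fin (d + 1)) | 0 ≤ y 0}

variable {I : ModelWithCorners ℝ (EuclideanSpace ℝ (Fin (d + 1))) H}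
  {M : Type*} [TopologicalSpace M] [ChartedSpace H M]

/-- The coordinates of the boundary points in the chart around `p`. -/
def boundaryTarget (I : ModelWithCorners ℝ (EuclideanSpace ℝ (Fin (d + 1))) H) (p : M) :
    Set (Fin d → ℝ) :=
  {z | hyperplaneIncl z ∈ (extChartAt I p).target ∧
    (extChartAt I p).symm (hyperplaneIncl z) ∈ I.boundary M}

/-- The change of coordinates on the boundary. -/
def boundaryTransition (I : ModelWithCorners ℝ (EuclideanSpace ℝ (Fin (d + 1))) H) (p q : M)
    (z : Fin d → ℝ) : Fin d → ℝ :=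
  tailL d (transition I p q (hyperplaneIncl z))

theorem continuousOn_symm_hyperplaneIncl (p : M) :
    ContinuousOn (fun z => (extChartAt I p).symm (hyperplaneIncl z)) (boundaryTarget I p) :=
  (continuousOn_extChartAt_symm p).comp continuous_hyperplaneIncl.continuousOn fun _ hz => hz.1

variable [IsManifold I ∞ M] {p q : M} {y : EuclideanSpace ℝ (Fin (d + 1))} {z : Fin d → ℝ}

theorem range_notMem_nhds_of_symm_mem_boundary (hy : y ∈ (extChartAt I p).target)
    (hb : (extChartAt I p).symm y ∈ I.boundary M) : range I ∉ 𝓝 y := fun hrange => by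
  rw [← I.compl_interior, mem_compl_iff, symm_mem_interior_iff hy, mem_interior_iff_mem_nhds] at hb
  have htarget := extChartAt_target_mem_nhdsWithin_of_mem hy
  rw [nhdsWithin_eq_nhds.2 hrange] at htarget
  exact hb htarget

theorem eq_zero_of_symm_mem_boundary (hI : IsHalfSpaceModel I) (hy : y ∈ (extChartAt I p).target)
    (hb : (extChartAt I p).symm y ∈ I.boundary M) :
    range I = {y : EuclideanSpace ℝ (Fin (d + 1)) | 0 ≤ y 0} ∧ y 0 = 0 := by
  have hrange := range_notMem_nhds_of_symm_mem_boundary hy hb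
  rcases hI with h | h
  · exact absurd (h ▸ univ_mem) hrange
  · have h0 : 0 ≤ y 0 := h.subset (extChartAt_target_subset_range p hy)
    refine ⟨h, by_contra fun hne => hrange ?_⟩
    rw [h]
    filter_upwards [(isOpen_lt continuous_const (continuous_coord 0)).mem_nhds
      (lt_of_le_of_ne h0 (Ne.symm hne))] with z hz
    exact le_of_lt hz

theorem symm_mem_boundary_of_eq_zero
    (hS : range I = {y : EuclideanSpace ℝ (Fin (d + 1)) | 0 ≤ y 0})
    (hy : y ∈ (extChartAt I p).target) (h0 : y 0 = 0) :
    (extChartAt I p).symm y ∈ I.boundary M := by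
  rw [← I.compl_interior, mem_compl_iff, symm_mem_interior_iff hy]
  intro hint
  have hrange := range_mem_nhds hint
  rw [hS] at hrange
  have hline : Tendsto (fun t : ℝ => y - t • EuclideanSpace.single (0 : Fin (d + 1)) (1 : ℝ))
      (𝓝[>] 0) (𝓝 y) := by
    refine ((Continuous.tendsto' ?_ 0 y ?_).mono_left nhdsWithin_le_nhds)
    · fun_prop
    · rw [zero_smul, sub_zero]
  obtain ⟨t, ht, ht0⟩ := ((hline.eventually hrange).and self_mem_nhdsWithin).exists
  have hneg : 0 ≤ -t := by simpa [h0] using ht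
  exact absurd ht0 (not_lt.2 (neg_nonneg.1 hneg))

theorem boundaryTarget_eq (hI : IsHalfSpaceModel I) (p : M) : boundaryTarget I p = ∅ ∨
    (range I = {y : EuclideanSpace ℝ (Fin (d + 1)) | 0 ≤ y 0} ∧
      boundaryTarget I p = hyperplaneIncl ⁻¹' (extChartAt I p).target) := by
  rcases (boundaryTarget I p).eq_empty_or_nonempty with h | ⟨z, hz⟩
  · exact Or.inl h
  · have hS := (eq_zero_of_symm_mem_boundary hI hz.1 hz.2).1
    exact Or.inr ⟨hS, Subset.antisymm (fun w hw => hw.1)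
      fun w hw => ⟨hw, symm_mem_boundary_of_eq_zero hS hw rfl⟩⟩

theorem isOpen_boundaryTarget (hI : IsHalfSpaceModel I) (p : M) :
    IsOpen (boundaryTarget I p) := by
  rcases boundaryTarget_eq hI p with h | ⟨hS, h⟩
  · exact h ▸ isOpen_empty
  · have hpreimage : hyperplaneIncl ⁻¹' (extChartAt I p).target
        = hyperplaneIncl (d := d) ⁻¹' (I.symm ⁻¹' (chartAt H p).target) := by
      rw [extChartAt_target, preimage_inter, inter_eq_left]
      exact fun z _ => hS.superset (le_refl (0 : ℝ))
    rw [h, hpreimage]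
    exact ((chartAt H p).open_target.preimage I.continuous_symm).preimage continuous_hyperplaneIncl

/-! #### Change of coordinates on the boundary -/

theorem hyperplaneIncl_boundaryTransition (hI : IsHalfSpaceModel I) (hz : z ∈ boundaryTarget I p)
    (hq : hyperplaneIncl z ∈ overlap I p q) :
    hyperplaneIncl (boundaryTransition I p q z) = transition I p q (hyperplaneIncl z) := by
  refine hyperplaneIncl_tailL
    (eq_zero_of_symm_mem_boundary hI (transition_mem_overlap hq).1 ?_).2
  rw [symm_transition hq]
  exact hz.2

theorem hasFDerivWithinAt_transition_hyperplaneIncl (hq : hyperplaneIncl z ∈ overlap I p q)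
    {B : Set (Fin d → ℝ)} (hB : ∀ w ∈ B, hyperplaneIncl w ∈ range I) :
    HasFDerivWithinAt (fun w => transition I p q (hyperplaneIncl w))
      (fderivWithin ℝ (transition I p q) (range I) (hyperplaneIncl z) ∘L inclL d) B z :=
  HasFDerivWithinAt.comp (g := transition I p q) (t := range I) z
    (differentiableWithinAt_transition hq).hasFDerivWithinAt
    (inclL d).hasFDerivAt.hasFDerivWithinAt hB

theorem jacobianMat_transition_zero_succ (hI : IsHalfSpaceModel I) (hz : z ∈ boundaryTarget I p)
    (hq : hyperplaneIncl z ∈ overlap I p q) (j : Fin d) :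
    jacobianMat (range I) (transition I p q) (hyperplaneIncl z) 0 j.succ = 0 := by
  have hopen := (isOpen_boundaryTarget hI p).mem_nhds hz
  have hS := (eq_zero_of_symm_mem_boundary hI hz.1 hz.2).1
  have hder := (hasFDerivWithinAt_transition_hyperplaneIncl hq (B := univ)
    fun w _ => hS.superset (le_refl (0 : ℝ))).hasFDerivAt univ_mem
  have hcoord := (EuclideanSpace.proj (0 : Fin (d + 1)) :
    EuclideanSpace ℝ (Fin (d + 1)) →L[ℝ] ℝ).hasFDerivAt.comp z hder
  have hzero : (fun w => transition I p q (hyperplaneIncl w) 0) =ᶠ[𝓝 z] fun _ => (0 : ℝ) := by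
    have hsource := ((continuousOn_symm_hyperplaneIncl p).continuousAt hopen).preimage_mem_nhds
      ((isOpen_extChartAt_source (I := I) q).mem_nhds hq.2)
    filter_upwards [hopen, hsource] with w hw hwq
    rw [← hyperplaneIncl_boundaryTransition hI hw ⟨hw.1, hwq⟩, hyperplaneIncl_zero]
  have hunique := (hcoord.congr_of_eventuallyEq hzero.symm).unique (hasFDerivAt_const (0 : ℝ) z)
  have happly := congrArg (fun L : (Fin d → ℝ) →L[ℝ] ℝ => L (Pi.single j 1)) hunique
  rwa [ContinuousLinearMap.comp_apply, ContinuousLinearMap.comp_apply,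
    show inclL d (Pi.single j 1) = _ from hyperplaneIncl_single j] at happly

theorem det_tailL_comp_comp_inclL (S : Set (EuclideanSpace ℝ (Fin (d + 1))))
    (τ : EuclideanSpace ℝ (Fin (d + 1)) → EuclideanSpace ℝ (Fin (d + 1)))
    (y : EuclideanSpace ℝ (Fin (d + 1))) :
    (tailL d ∘L fderivWithin ℝ τ S y ∘L inclL d).det
      = ((jacobianMat S τ y).submatrix Fin.succ Fin.succ).det := by
  rw [ContinuousLinearMap.det, ← LinearMap.det_toMatrix (Pi.basisFun ℝ (Fin d))]
  congr 1
  ext a i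
  simp only [LinearMap.toMatrix_apply, Pi.basisFun_repr, Pi.basisFun_apply]
  change fderivWithin ℝ τ S y (hyperplaneIncl (Pi.single i 1)) a.succ = _
  rw [hyperplaneIncl_single]
  rfl

theorem bijOn_boundaryTransition (hI : IsHalfSpaceModel I) {A : Set M}
    (hA : A ⊆ (extChartAt I p).source ∩ (extChartAt I q).source) :
    BijOn (boundaryTransition I p q)
      (boundaryTarget I p ∩ (fun z => (extChartAt I p).symm (hyperplaneIncl z)) ⁻¹' A)
      (boundaryTarget I q ∩ (fun z => (extChartAt I q).symm (hyperplaneIncl z)) ⁻¹' A) := by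
  have mapsTo {p q : M} (hAq : A ⊆ (extChartAt I q).source) : MapsTo (boundaryTransition I p q)
      (boundaryTarget I p ∩ (fun z => (extChartAt I p).symm (hyperplaneIncl z)) ⁻¹' A)
      (boundaryTarget I q ∩ (fun z => (extChartAt I q).symm (hyperplaneIncl z)) ⁻¹' A) := by
    rintro z ⟨hz, hzA⟩
    have hq : hyperplaneIncl z ∈ overlap I p q := ⟨hz.1, hAq hzA⟩
    simp only [boundaryTarget, mem_inter_iff, mem_ofPred_eq, mem_preimage,
      hyperplaneIncl_boundaryTransition hI hz hq, symm_transition hq]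
    exact ⟨⟨(transition_mem_overlap hq).1, hz.2⟩, hzA⟩
  have leftInvOn {p q : M} (hAq : A ⊆ (extChartAt I q).source) :
      LeftInvOn (boundaryTransition I q p) (boundaryTransition I p q)
        (boundaryTarget I p ∩ (fun z => (extChartAt I p).symm (hyperplaneIncl z)) ⁻¹' A) := by
    rintro z ⟨hz, hzA⟩
    have hq : hyperplaneIncl z ∈ overlap I p q := ⟨hz.1, hAq hzA⟩
    rw [boundaryTransition, hyperplaneIncl_boundaryTransition hI hz hq, transition_transition hq,
      tailL_hyperplaneIncl]
  have hAp := hA.trans inter_subset_left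
  have hAq := hA.trans inter_subset_right
  exact InvOn.bijOn ⟨leftInvOn hAq, leftInvOn hAp⟩ (mapsTo hAq) (mapsTo hAp)

variable (m : Bundle.ContMDiffRiemannianMetric I ∞ (EuclideanSpace ℝ (Fin (d + 1)))
    (fun x : M => TangentSpace I x))

/-- The volume density of the boundary in the chart around `p`. -/
def areaDensity (p : M) (z : Fin d → ℝ) : ℝ :=
  √((gram I m p (hyperplaneIncl z)).submatrix Fin.succ Fin.succ).det

theorem continuousOn_areaDensity (p : M) :
    ContinuousOn (areaDensity m p) (hyperplaneIncl ⁻¹' (extChartAt I p).target) := by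
  have hdet : ContinuousOn (fun y => ((gram I m p y).submatrix Fin.succ Fin.succ).det)
      (extChartAt I p).target :=
    (contDiffOn_det (k := ∞) (γ := fun y => (gram I m p y).submatrix Fin.succ Fin.succ)
      fun i j => (isMetricOn_gram m p).smooth i.succ j.succ).continuousOn
  exact Real.continuous_sqrt.comp_continuousOn
    (hdet.comp continuous_hyperplaneIncl.continuousOn fun _ hz => hz)

theorem areaDensity_transition (hI : IsHalfSpaceModel I) (hz : z ∈ boundaryTarget I p)
    (hq : hyperplaneIncl z ∈ overlap I p q) :
    areaDensity m p z
      = |(tailL d ∘L fderivWithin ℝ (transition I p q) (range I) (hyperplaneIncl z) ∘L inclL d).det|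
        * areaDensity m q (boundaryTransition I p q z) := by
  set J := jacobianMat (range I) (transition I p q) (hyperplaneIncl z) with hJ
  have hgram : (gram I m p (hyperplaneIncl z)).submatrix Fin.succ Fin.succ
      = (J.submatrix Fin.succ Fin.succ).transpose
        * (gram I m q (transition I p q (hyperplaneIncl z))).submatrix Fin.succ Fin.succ
        * J.submatrix Fin.succ Fin.succ := by
    ext i j
    rw [gram_transition m hq]
    simp only [Matrix.submatrix_apply, Matrix.mul_apply, Matrix.transpose_apply, ← hJ,
      Fin.sum_univ_succ, hJ ▸ jacobianMat_transition_zero_succ hI hz hq, mul_zero, zero_mul,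
      zero_add]
  rw [areaDensity, areaDensity, hgram, sqrt_det_transpose_mul_mul, det_tailL_comp_comp_inclL,
    hyperplaneIncl_boundaryTransition hI hz hq]

/-! #### The boundary measure in a chart -/

variable [MeasurableSpace M] [BorelSpace M]

theorem chartArea_apply (hI : IsHalfSpaceModel I) (p : M) {A : Set M} (hA : MeasurableSet A) :
    chartArea I m p A = ∫⁻ z in boundaryTarget I p
      ∩ (fun z => (extChartAt I p).symm (hyperplaneIncl z)) ⁻¹' A,
      ENNReal.ofReal (areaDensity m p z) :=
  map_withDensity_apply (isOpen_boundaryTarget hI p).measurableSet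
    (continuousOn_symm_hyperplaneIncl p) hA

theorem chartArea_eq_zero (hI : IsHalfSpaceModel I) (p : M) {A : Set M} (hA : MeasurableSet A)
    (h : ∀ z ∈ boundaryTarget I p, (extChartAt I p).symm (hyperplaneIncl z) ∉ A) :
    chartArea I m p A = 0 := by
  have hempty :
      boundaryTarget I p ∩ (fun z => (extChartAt I p).symm (hyperplaneIncl z)) ⁻¹' A = ∅ :=
    eq_empty_of_forall_notMem fun z hz => h z hz.1 hz.2
  rw [chartArea_apply m hI p hA, hempty, Measure.restrict_empty, lintegral_zero_measure]

theorem chartArea_eq_of_subset (hI : IsHalfSpaceModel I) (p q : M) {A : Set M}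
    (hA : MeasurableSet A) (hApq : A ⊆ (extChartAt I p).source ∩ (extChartAt I q).source) :
    chartArea I m p A = chartArea I m q A := by
  have hmeas := measurableSet_inter_preimage (isOpen_boundaryTarget hI p).measurableSet
      (continuousOn_symm_hyperplaneIncl p) hA
  have hoverlap {z : Fin d → ℝ} (hz : z ∈ boundaryTarget I p ∩
      (fun z => (extChartAt I p).symm (hyperplaneIncl z)) ⁻¹' A) :
      hyperplaneIncl z ∈ overlap I p q := ⟨hz.1.1, (hApq hz.2).2⟩
  rw [chartArea_apply m hI p hA, chartArea_apply m hI q hA]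
  refine lintegral_eq_of_bijOn_of_det hmeas (bijOn_boundaryTransition hI hApq) (fun z hz => ?_)
    fun z hz => areaDensity_transition m hI hz.1 (hoverlap hz)
  exact (tailL d).hasFDerivAt.comp_hasFDerivWithinAt z
    (hasFDerivWithinAt_transition_hyperplaneIncl (hoverlap hz)
      fun w hw => extChartAt_target_subset_range p hw.1.1)

theorem boundaryArea_restrict_source (hI : IsHalfSpaceModel I) (p : M) :
    (boundaryArea I m).restrict (extChartAt I p).source = chartArea I m p :=
  iSup_restrict_eq (ν := chartArea I m) (U := fun p => (extChartAt I p).source)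
    measurableSet_source
    (fun p => chartArea_eq_zero m hI p (measurableSet_source p).compl
      fun _ hz h => h ((extChartAt I p).map_target hz.1))
    (fun p q _ hA hApq => chartArea_eq_of_subset m hI p q hA hApq) p

theorem boundaryArea_apply (hI : IsHalfSpaceModel I) (p : M) {A : Set M} (hA : MeasurableSet A)
    (hAp : A ⊆ (extChartAt I p).source) : boundaryArea I m A = chartArea I m p A := by
  rw [← boundaryArea_restrict_source m hI, Measure.restrict_apply hA, inter_eq_left.2 hAp]

theorem integral_boundaryArea_of_support_subset (hI : IsHalfSpaceModel I) (p : M) {F : M → ℝ}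
    (hF : Continuous F) (hsupp : Function.support F ⊆ (extChartAt I p).source) :
    ∫ x, F x ∂(boundaryArea I m)
      = ∫ z in boundaryTarget I p, areaDensity m p z * inChart I p F (hyperplaneIncl z) := by
  rw [← setIntegral_eq_integral_of_forall_compl_eq_zero (s := (extChartAt I p).source)
    fun x hx => Function.notMem_support.1 fun h => hx (hsupp h),
    boundaryArea_restrict_source m hI p]
  exact integral_map_withDensity (isOpen_boundaryTarget hI p).measurableSet
    (continuousOn_symm_hyperplaneIncl p)
    ((continuousOn_areaDensity m p).mono fun _ hz => hz.1) (fun _ _ => Real.sqrt_nonneg _) hF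

theorem isFiniteMeasure_boundaryArea [T2Space M] [CompactSpace M] (hI : IsHalfSpaceModel I) :
    IsFiniteMeasure (boundaryArea I m) := by
  refine isFiniteMeasure_of_isCompact_nhds fun x => ?_
  obtain ⟨K, hK, hKs, hKx⟩ := local_compact_nhds (extChartAt_source_mem_nhds (I := I) x)
  refine ⟨K, hK, ?_⟩
  rw [boundaryArea_apply m hI x hKx.measurableSet hKs, chartArea_apply m hI x hKx.measurableSet]
  have hcompact : IsCompact (tailL d '' (extChartAt I x '' K ∩ {y | y 0 = 0})) :=
    ((hKx.image_of_continuousOn ((continuousOn_extChartAt x).mono hKs)).inter_right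
      (isClosed_eq (continuous_coord 0) continuous_const)).image (tailL d).continuous
  have hsubset : boundaryTarget I x ∩ (fun z => (extChartAt I x).symm (hyperplaneIncl z)) ⁻¹' K
      ⊆ tailL d '' (extChartAt I x '' K ∩ {y | y 0 = 0}) := fun z hz =>
    ⟨hyperplaneIncl z, ⟨⟨_, hz.2, (extChartAt I x).right_inv hz.1.1⟩, rfl⟩, tailL_hyperplaneIncl z⟩
  refine (lintegral_mono_set hsubset).trans_lt (Integrable.lintegral_lt_top
    (ContinuousOn.integrableOn_compact hcompact ((continuousOn_areaDensity m x).mono ?_)))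
  rintro _ ⟨_, ⟨⟨w, hw, rfl⟩, hw0⟩, rfl⟩
  rw [mem_preimage, hyperplaneIncl_tailL hw0]
  exact (extChartAt I x).map_source (hKs hw)

theorem boundaryArea_interior [CompactSpace M] (hI : IsHalfSpaceModel I) :
    boundaryArea I m (I.interior M) = 0 := by
  refine measure_eq_zero_of_forall_nhds fun p => ⟨(extChartAt I p).source,
    measurableSet_source p, extChartAt_source_mem_nhds p, ?_⟩
  have hmeas := (isOpen_manifold_interior (I := I) (M := M)).measurableSet.inter
    (measurableSet_source (I := I) p)
  rw [boundaryArea_apply m hI p hmeas inter_subset_right]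
  exact chartArea_eq_zero m hI p hmeas fun z hz hzA =>
    disjoint_left.1 (I.disjoint_interior_boundary (M := M)) hzA.1 hz.2

theorem riemVolume_boundary [CompactSpace M] (hI : IsHalfSpaceModel I) :
    riemVolume I m (I.boundary M) = 0 := by
  refine measure_eq_zero_of_forall_nhds fun p => ⟨(extChartAt I p).source,
    measurableSet_source p, extChartAt_source_mem_nhds p, ?_⟩
  have hmeas : MeasurableSet (I.boundary M ∩ (extChartAt I p).source) := by
    rw [← I.compl_interior]
    exact isOpen_manifold_interior.measurableSet.compl.inter (measurableSet_source p)
  rw [riemVolume_apply m p hmeas inter_subset_right, chartVolume_apply m p hmeas]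
  exact setLIntegral_measure_zero _ _ (measure_mono_null
    (fun y hy => (eq_zero_of_symm_mem_boundary hI hy.1 hy.2.1).2) volume_coord_zero_eq_zero)

end BoundaryMeasure

/-! ### The divergence theorem in a half-space -/

section Divergence

open Filter Topology

variable {d : ℕ}

theorem integral_divergence_halfSpace_pi {a R : ℝ} (haR : a ≤ R) (hR : 0 ≤ R)
    {V : Fin (d + 1) → (Fin (d + 1) → ℝ) → ℝ}
    {V' : Fin (d + 1) → (Fin (d + 1) → ℝ) → (Fin (d + 1) → ℝ) →L[ℝ] ℝ} {D : (Fin (d + 1) → ℝ) → ℝ}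
    (hVc : ∀ i, ContinuousOn (V i) {x | a ≤ x 0})
    (hVd : ∀ i x, a < x 0 → HasFDerivAt (V i) (V' i x) x)
    (hD : ∀ x, a < x 0 → D x = ∑ i, V' i x (Pi.single i 1)) (hDi : IntegrableOn D {x | a ≤ x 0})
    (hV0 : ∀ i, Function.support (V i) ⊆ {x | ∀ j, |x j| < R})
    (hD0 : Function.support D ⊆ {x | ∀ j, |x j| < R}) :
    ∫ x in {x | a ≤ x 0}, D x = - ∫ z : Fin d → ℝ, V 0 (Fin.cons a z) := by
  set lo : Fin (d + 1) → ℝ := Fin.cons a fun _ => -R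
  set hi : Fin (d + 1) → ℝ := fun _ => R
  have hle : lo ≤ hi := Fin.cons_le.2 ⟨haR, fun _ => neg_le_self hR⟩
  have hsubset : Icc lo hi ⊆ {x | a ≤ x 0} := fun x hx => hx.1 0
  have hbox : ∫ x in {x | a ≤ x 0}, D x = ∫ x in Icc lo hi, D x := by
    refine setIntegral_eq_of_subset_of_forall_sdiff_eq_zero
      (measurableSet_le measurable_const (measurable_pi_apply 0)) hsubset fun x hx => ?_
    refine Function.notMem_support.1 fun hxD => hx.2 ?_
    exact ⟨Fin.cons_le.2 ⟨hx.1, fun j => (abs_lt.1 (hD0 hxD j.succ)).1.le⟩,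
      fun j => (abs_lt.1 (hD0 hxD j)).2.le⟩
  have hae : D =ᵐ[volume.restrict (Icc lo hi)] fun x => ∑ i, V' i x (Pi.single i 1) := by
    have hIoo : (pi univ fun i => Ioo (lo i) (hi i)) =ᵐ[volume] Icc lo hi :=
      Measure.univ_pi_Ioo_ae_eq_Icc
    rw [← Measure.restrict_congr_set hIoo]
    exact (ae_restrict_iff' (MeasurableSet.univ_pi fun i => measurableSet_Ioo)).2
      (Eventually.of_forall fun x hx => hD x (hx 0 (mem_univ _)).1)
  have hface (i : Fin (d + 1)) {c : ℝ} (hc : R ≤ |c|) (x : Fin d → ℝ) :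
      V i (i.insertNth c x) = 0 := by
    refine Function.notMem_support.1 fun hx => not_lt.2 hc ?_
    simpa only [Fin.insertNth_apply_same] using hV0 i hx i
  rw [hbox, integral_congr_ae hae, integral_divergence_of_hasFDerivAt_off_countable' lo hi hle V V'
    ∅ countable_empty (fun i => (hVc i).mono hsubset)
    (fun x hx i => hVd i x (hx.1 0 (mem_univ _)).1) ((hDi.mono_set hsubset).congr_fun_ae hae)]
  have hfront (i : Fin (d + 1)) (x : Fin d → ℝ) : V i (i.insertNth (hi i) x) = 0 :=
    hface i (le_abs_self R) x
  have hback (i : Fin d) (x : Fin d → ℝ) : V i.succ (i.succ.insertNth (lo i.succ) x) = 0 :=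
    hface i.succ ((le_abs_self R).trans_eq (abs_neg R).symm) x
  simp only [hfront, integral_zero, zero_sub, Fin.sum_univ_succ, hback, neg_zero,
    Finset.sum_const_zero, add_zero, Fin.insertNth_zero']
  refine congrArg _ (setIntegral_eq_integral_of_forall_compl_eq_zero fun z hz => ?_)
  refine Function.notMem_support.1 fun hzV => hz ?_
  exact ⟨fun j => (abs_lt.1 (hV0 0 hzV j.succ)).1.le, fun j => (abs_lt.1 (hV0 0 hzV j.succ)).2.le⟩

/-- `D` is the divergence of the field `V`, and both are continuous up to the boundary of `S`. -/
structure IsDivergenceOn (S : Set (EuclideanSpace ℝ (Fin (d + 1))))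
    (V : Fin (d + 1) → EuclideanSpace ℝ (Fin (d + 1)) → ℝ)
    (D : EuclideanSpace ℝ (Fin (d + 1)) → ℝ) : Prop where
  continuousOn : ∀ i, ContinuousOn (V i) S
  differentiableAt : ∀ i, ∀ y ∈ interior S, DifferentiableAt ℝ (V i) y
  continuousOn_div : ContinuousOn D S
  div_eq : ∀ y ∈ interior S, D y = ∑ i, fderiv ℝ (V i) y (EuclideanSpace.single i 1)

theorem exists_abs_coord_lt_of_isCompact {K : Set (EuclideanSpace ℝ (Fin (d + 1)))}
    (hK : IsCompact K) (a : ℝ) : ∃ R, a ≤ R ∧ 0 ≤ R ∧ ∀ y ∈ K, ∀ j, |y j| < R := by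
  obtain ⟨R, hR⟩ := hK.isBounded.exists_norm_le
  have hlt : R < max a (max 0 (R + 1)) :=
    (lt_add_one R).trans_le ((le_max_right _ _).trans (le_max_right _ _))
  exact ⟨max a (max 0 (R + 1)), le_max_left _ _, (le_max_left _ _).trans (le_max_right _ _),
    fun y hy j => ((PiLp.norm_apply_le y j).trans (hR y hy)).trans_lt hlt⟩

namespace IsDivergenceOn

variable {S T K : Set (EuclideanSpace ℝ (Fin (d + 1)))}
  {V : Fin (d + 1) → EuclideanSpace ℝ (Fin (d + 1)) → ℝ}
  {D : EuclideanSpace ℝ (Fin (d + 1)) → ℝ}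

theorem mono (h : IsDivergenceOn S V D) (hTS : T ⊆ S) : IsDivergenceOn T V D where
  continuousOn i := (h.continuousOn i).mono hTS
  differentiableAt i y hy := h.differentiableAt i y (interior_mono hTS hy)
  continuousOn_div := h.continuousOn_div.mono hTS
  div_eq y hy := h.div_eq y (interior_mono hTS hy)

theorem integral_halfSpace {a : ℝ} (h : IsDivergenceOn {y | a ≤ y 0} V D) (hK : IsCompact K)
    (hV : ∀ i, Function.support (V i) ⊆ K) (hD : Function.support D ⊆ K) :
    ∫ y in {y | a ≤ y 0}, D y = - ∫ z : Fin d → ℝ, V 0 (WithLp.toLp 2 (Fin.cons a z)) := by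
  obtain ⟨R, haR, hR, hKR⟩ := exists_abs_coord_lt_of_isCompact hK a
  set L := (EuclideanSpace.equiv (Fin (d + 1)) ℝ).symm
  have hmp : MeasurePreserving L volume volume := PiLp.volume_preserving_toLp (Fin (d + 1))
  have hemb : MeasurableEmbedding L := L.toHomeomorph.measurableEmbedding
  have hclosed : IsClosed {y : EuclideanSpace ℝ (Fin (d + 1)) | a ≤ y 0} :=
    isClosed_le continuous_const (continuous_coord 0)
  have hinterior {x : Fin (d + 1) → ℝ} (hx : a < x 0) :
      L x ∈ interior {y : EuclideanSpace ℝ (Fin (d + 1)) | a ≤ y 0} :=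
    mem_interior_iff_mem_nhds.2 <| mem_of_superset
      ((isOpen_lt continuous_const (continuous_coord 0)).mem_nhds hx) fun y hy =>
      show a ≤ y 0 from le_of_lt hy
  have hDi : IntegrableOn D {y | a ≤ y 0} :=
    ((h.continuousOn_div.mono inter_subset_left).integrableOn_compact
      (hK.inter_left hclosed)).of_forall_sdiff_eq_zero hclosed.measurableSet
      fun y hy => Function.notMem_support.1 fun hyD => hy.2 ⟨hy.1, hD hyD⟩
  rw [← hmp.setIntegral_preimage_emb hemb]
  refine integral_divergence_halfSpace_pi haR hR (V := fun i x => V i (L x))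
    (V' := fun i x => fderiv ℝ (V i) (L x) ∘L L.toContinuousLinearMap)
    (fun i => (h.continuousOn i).comp L.continuous.continuousOn fun x hx => hx)
    (fun i x hx => (h.differentiableAt i _ (hinterior hx)).hasFDerivAt.comp x L.hasFDerivAt)
    (fun x hx => h.div_eq _ (hinterior hx)) ((hmp.integrableOn_comp_preimage hemb).2 hDi)
    (fun i x hx => hKR _ (hV i hx)) fun x hx => hKR _ (hD hx)

theorem integral_univ (h : IsDivergenceOn univ V D) (hK : IsCompact K)
    (hV : ∀ i, Function.support (V i) ⊆ K) (hD : Function.support D ⊆ K) : ∫ y, D y = 0 := by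
  obtain ⟨R, -, -, hKR⟩ := exists_abs_coord_lt_of_isCompact hK 0
  have hlow {y : EuclideanSpace ℝ (Fin (d + 1))} (hy : y 0 ≤ -R) : y ∉ K := fun hyK =>
    hy.not_gt (abs_lt.1 (hKR y hyK 0)).1
  have hflux (z : Fin d → ℝ) : V 0 (WithLp.toLp 2 (Fin.cons (-R) z)) = 0 :=
    Function.notMem_support.1 fun hz => hlow le_rfl (hV 0 hz)
  rw [← setIntegral_eq_integral_of_forall_compl_eq_zero (s := {y | -R ≤ y 0})
      fun y hy => Function.notMem_support.1 fun hyD => hlow (not_le.1 hy).le (hD hyD),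
    (h.mono (subset_univ _)).integral_halfSpace hK hV hD]
  simp only [hflux, integral_zero, neg_zero]

end IsDivergenceOn

section ExtensionByZero

variable {X Y : Type*} [Zero Y] {S T K : Set X} {f : X → Y}

theorem support_indicator_subset_of_eq_zero (hf0 : ∀ y ∈ T, y ∉ K → f y = 0) :
    Function.support (T.indicator f) ⊆ K := fun y hy => by
  by_contra hyK
  exact hy (indicator_apply_eq_zero.2 fun hyT => hf0 y hyT hyK)

variable [TopologicalSpace X]

theorem indicator_eventuallyEq_zero (hK : IsClosed K) (hf0 : ∀ y ∈ T, y ∉ K → f y = 0) {y : X}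
    (hy : y ∉ K) : T.indicator f =ᶠ[𝓝 y] fun _ => 0 := by
  filter_upwards [hK.isOpen_compl.mem_nhds hy] with z hz
  exact indicator_apply_eq_zero.2 fun hzT => hf0 z hzT hz

theorem continuousOn_indicator_of_eq_zero [TopologicalSpace Y] (hT : ∀ y ∈ T, T ∈ 𝓝[S] y)
    (hK : IsClosed K) (hKT : K ⊆ T) (hf : ContinuousOn f T) (hf0 : ∀ y ∈ T, y ∉ K → f y = 0) :
    ContinuousOn (T.indicator f) S := by
  intro y _
  by_cases hyT : y ∈ T
  · refine ((hf y hyT).mono_of_mem_nhdsWithin (hT y hyT)).congr_of_eventuallyEq ?_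
      (indicator_of_mem hyT f)
    filter_upwards [hT y hyT] with z hz using indicator_of_mem hz f
  · exact (continuousAt_const.congr (indicator_eventuallyEq_zero hK hf0
      fun h => hyT (hKT h)).symm).continuousWithinAt

end ExtensionByZero

namespace IsDivergenceOn

variable {S T K : Set (EuclideanSpace ℝ (Fin (d + 1)))}
  {V : Fin (d + 1) → EuclideanSpace ℝ (Fin (d + 1)) → ℝ}
  {D : EuclideanSpace ℝ (Fin (d + 1)) → ℝ}

theorem indicator (h : IsDivergenceOn T V D) (hT : ∀ y ∈ T, T ∈ 𝓝[S] y) (hK : IsClosed K)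
    (hKT : K ⊆ T) (hV0 : ∀ i, ∀ y ∈ T, y ∉ K → V i y = 0) (hD0 : ∀ y ∈ T, y ∉ K → D y = 0) :
    IsDivergenceOn S (fun i => T.indicator (V i)) (T.indicator D) := by
  have hinterior {y : EuclideanSpace ℝ (Fin (d + 1))} (hy : y ∈ interior S) (hyT : y ∈ T) :
      y ∈ interior T := by
    rw [mem_interior_iff_mem_nhds, ← nhdsWithin_eq_nhds.2 (mem_interior_iff_mem_nhds.1 hy)]
    exact hT y hyT
  have heq {y : EuclideanSpace ℝ (Fin (d + 1))} (hy : y ∈ interior T) (i : Fin (d + 1)) :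
      T.indicator (V i) =ᶠ[𝓝 y] V i := by
    filter_upwards [mem_interior_iff_mem_nhds.1 hy] with z hz using indicator_of_mem hz _
  refine ⟨fun i => continuousOn_indicator_of_eq_zero hT hK hKT (h.continuousOn i) (hV0 i),
    fun i y hy => ?_, continuousOn_indicator_of_eq_zero hT hK hKT h.continuousOn_div hD0,
    fun y hy => ?_⟩
  · by_cases hyT : y ∈ T
    · exact (h.differentiableAt i y (hinterior hy hyT)).congr_of_eventuallyEq
        (heq (hinterior hy hyT) i)
    · exact (differentiableAt_const _).congr_of_eventuallyEq
        (indicator_eventuallyEq_zero hK (hV0 i) fun hyK => hyT (hKT hyK))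
  · by_cases hyT : y ∈ T
    · rw [indicator_of_mem hyT, h.div_eq y (hinterior hy hyT)]
      exact Finset.sum_congr rfl fun i _ => by rw [(heq (hinterior hy hyT) i).fderiv_eq]
    · rw [indicator_of_notMem hyT]
      refine (Finset.sum_eq_zero fun i _ => ?_).symm
      rw [(indicator_eventuallyEq_zero hK (hV0 i) fun hyK => hyT (hKT hyK)).fderiv_eq,
        fderiv_fun_const, Pi.zero_apply, zero_apply]

theorem integral_extChartAt_target {H : Type*} [TopologicalSpace H]
    {I : ModelWithCorners ℝ (EuclideanSpace ℝ (Fin (d + 1))) H} (hI : IsHalfSpaceModel I)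
    {M : Type*} [TopologicalSpace M] [ChartedSpace H M] [IsManifold I ∞ M] (p : M)
    (h : IsDivergenceOn (extChartAt I p).target V D) (hK : IsCompact K)
    (hKT : K ⊆ (extChartAt I p).target)
    (hV0 : ∀ i, ∀ y ∈ (extChartAt I p).target, y ∉ K → V i y = 0)
    (hD0 : ∀ y ∈ (extChartAt I p).target, y ∉ K → D y = 0) :
    ∫ y in (extChartAt I p).target, D y = - ∫ z in boundaryTarget I p, V 0 (hyperplaneIncl z) := by
  have hind := h.indicator (S := range I)
    (fun y hy => extChartAt_target_mem_nhdsWithin_of_mem hy) hK.isClosed hKT hV0 hD0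
  have hVK := fun i => support_indicator_subset_of_eq_zero (hV0 i)
  have hDK := support_indicator_subset_of_eq_zero hD0
  rw [← integral_indicator (measurableSet_target p)]
  rcases hI with hS | hS
  · have hempty : boundaryTarget I p = ∅ := eq_empty_of_forall_notMem fun z hz =>
      range_notMem_nhds_of_symm_mem_boundary hz.1 hz.2 (hS ▸ univ_mem)
    rw [hS] at hind
    rw [hind.integral_univ hK hVK hDK, hempty, Measure.restrict_empty,
      integral_zero_measure, neg_zero]
  · have hboundary : boundaryTarget I p = hyperplaneIncl ⁻¹' (extChartAt I p).target :=
      Subset.antisymm (fun z hz => hz.1) fun z hz => ⟨hz, symm_mem_boundary_of_eq_zero hS hz rfl⟩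
    have hsupp : Function.support ((extChartAt I p).target.indicator D) ⊆ range I :=
      support_indicator_subset.trans (extChartAt_target_subset_range p)
    rw [hS] at hind
    rw [← setIntegral_eq_integral_of_forall_compl_eq_zero (s := range I)
        fun y hy => Function.notMem_support.1 fun hyD => hy (hsupp hyD), hS,
      hind.integral_halfSpace hK hVK hDK, hboundary,
      ← integral_indicator ((measurableSet_target p).preimage
        continuous_hyperplaneIncl.measurable)]
    rfl

end IsDivergenceOn

end Divergence

/-! ### Gradients that are normal to the boundary -/

section NormalGradient

open Filter Topology

variable {d : ℕ}

section Matrix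

variable {A : Matrix (Fin (d + 1)) (Fin (d + 1)) ℝ} {v : Fin (d + 1) → ℝ}

theorem sum_mul_of_succ_eq_zero (hv : ∀ i : Fin d, v i.succ = 0) (c : Fin (d + 1) → ℝ) :
    ∑ j, c j * v j = c 0 * v 0 := by
  simp only [Fin.sum_univ_succ, hv, mul_zero, Finset.sum_const_zero, add_zero]

theorem sqrt_inv_quadratic_of_succ_eq_zero (hA : A.PosDef) (hv : ∀ i : Fin d, v i.succ = 0)
    (hv0 : 0 ≤ v 0) : √(∑ i, v i * ∑ j, A⁻¹ i j * v j) = √(A⁻¹ 0 0) * v 0 := by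
  have hquad : ∑ i, v i * ∑ j, A⁻¹ i j * v j = A⁻¹ 0 0 * v 0 ^ 2 := by
    simp only [sum_mul_of_succ_eq_zero hv]
    rw [Finset.sum_congr rfl fun i _ => mul_comm (v i) _, sum_mul_of_succ_eq_zero hv]
    ring
  rw [hquad, Real.sqrt_mul hA.inv.diag_pos.le, Real.sqrt_sq hv0]

theorem det_submatrix_succ_succ (hA : A.det ≠ 0) :
    (A.submatrix Fin.succ Fin.succ).det = A.det * A⁻¹ 0 0 := by
  rw [Matrix.inv_def, Matrix.smul_apply, Matrix.adjugate_fin_succ_eq_det_submatrix,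
    Ring.inverse_eq_inv', smul_eq_mul, mul_inv_cancel_left₀ hA]
  simp

theorem sqrt_det_mul_inv_mulVec_zero (hA : A.PosDef) (hv : ∀ i : Fin d, v i.succ = 0)
    (hv0 : 0 ≤ v 0) : √A.det * ∑ j, A⁻¹ 0 j * v j
      = √(A.submatrix Fin.succ Fin.succ).det * √(∑ i, v i * ∑ j, A⁻¹ i j * v j) := by
  rw [sqrt_inv_quadratic_of_succ_eq_zero hA hv hv0, sum_mul_of_succ_eq_zero hv,
    det_submatrix_succ_succ hA.det_pos.ne', Real.sqrt_mul hA.det_pos.le]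
  linear_combination (-(√A.det * v 0)) * Real.mul_self_sqrt (hA.inv.diag_pos (i := 0)).le

end Matrix

theorem partialD_of_isLocalMinOn {a : EuclideanSpace ℝ (Fin (d + 1)) → ℝ}
    {y : EuclideanSpace ℝ (Fin (d + 1))} (hy : y 0 = 0)
    (ha : DifferentiableWithinAt ℝ a {y | 0 ≤ y 0} y) (hmin : IsLocalMinOn a {y | 0 ≤ y 0} y) :
    (∀ i : Fin d, partialD {y | 0 ≤ y 0} i.succ a y = 0) ∧ 0 ≤ partialD {y | 0 ≤ y 0} 0 a y := by
  have hconv : Convex ℝ {y : EuclideanSpace ℝ (Fin (d + 1)) | 0 ≤ y 0} :=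
    fun x hx z hz s t hs ht _ => add_nonneg (mul_nonneg hs hx) (mul_nonneg ht hz)
  have hcone (v : EuclideanSpace ℝ (Fin (d + 1))) (hv : 0 ≤ v 0) :
      0 ≤ fderivWithin ℝ a {y | 0 ≤ y 0} y v :=
    hmin.hasFDerivWithinAt_nonneg ha.hasFDerivWithinAt <| mem_posTangentConeAt_of_segment_subset <|
      hconv.segment_subset hy.ge (add_nonneg hy.ge hv)
  refine ⟨fun i => le_antisymm ?_ (hcone _ (by simp)), hcone _ (by simp)⟩
  have hneg := hcone (-EuclideanSpace.single i.succ 1) (by simp)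
  rw [map_neg] at hneg
  exact neg_nonneg.1 hneg

variable {H : Type*} [TopologicalSpace H]
  {I : ModelWithCorners ℝ (EuclideanSpace ℝ (Fin (d + 1))) H}
  {M : Type*} [TopologicalSpace M] [ChartedSpace H M] [IsManifold I ∞ M]
  (m : Bundle.ContMDiffRiemannianMetric I ∞ (EuclideanSpace ℝ (Fin (d + 1)))
    (fun x : M => TangentSpace I x))
  {w : M → ℝ}

theorem partialD_inChart_boundary (hI : IsHalfSpaceModel I) (hw : ContMDiff I 𝓘(ℝ, ℝ) 1 w)
    (hw0 : ∀ x ∈ I.boundary M, w x = 0) (hwn : ∀ x, 0 ≤ w x) {p : M}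
    {y : EuclideanSpace ℝ (Fin (d + 1))} (hy : y ∈ (extChartAt I p).target)
    (hyb : (extChartAt I p).symm y ∈ I.boundary M) :
    (∀ i : Fin d, partialD (range I) i.succ (inChart I p w) y = 0) ∧
      0 ≤ partialD (range I) 0 (inChart I p w) y := by
  obtain ⟨hS, hy0⟩ := eq_zero_of_symm_mem_boundary hI hy hyb
  have hdiff : DifferentiableWithinAt ℝ (inChart I p w) (range I) y :=
    ((contDiffOn_inChart hw (WithTop.coe_le_coe.2 le_top) p).differentiableOn one_ne_zero _
      hy).mono_of_mem_nhdsWithin (extChartAt_target_mem_nhdsWithin_of_mem hy)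
  rw [hS] at hdiff ⊢
  exact partialD_of_isLocalMinOn hy0 hdiff
    (Eventually.of_forall fun z => (hw0 _ hyb).trans_le (hwn _))

theorem normalDeriv_eq (hI : IsHalfSpaceModel I) (hw : ContMDiff I 𝓘(ℝ, ℝ) 1 w)
    (hw0 : ∀ x ∈ I.boundary M, w x = 0) (hwn : ∀ x, 0 ≤ w x) {x : M} (hx : x ∈ I.boundary M) :
    normalDeriv I m w x = - √(gradInner m w w x) := by
  have hy := mem_extChartAt_target (I := I) x
  obtain ⟨htangential, hnormal⟩ :=
    partialD_inChart_boundary hI hw hw0 hwn hy (by rwa [extChartAt_to_inv])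
  have hsqrt := sqrt_inv_quadratic_of_succ_eq_zero ((isMetricOn_gram m x).posDef _ hy)
    (v := fun i => partialD (range I) i (inChart I x w) (extChartAt I x x)) htangential hnormal
  have hderiv : normalDeriv I m w x
      = normalCoord I m x 0 * partialD (range I) 0 (inChart I x w) (extChartAt I x x) :=
    sum_mul_of_succ_eq_zero htangential _
  calc normalDeriv I m w x
      = -(√((gram I m x (extChartAt I x x))⁻¹ 0 0)
          * partialD (range I) 0 (inChart I x w) (extChartAt I x x)) := by
        rw [hderiv, normalCoord, neg_div, Real.div_sqrt, neg_mul]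
    _ = -√(gradInner m w w x) := by rw [← hsqrt]; rfl

theorem sqrt_det_mul_gradCoord_zero (hI : IsHalfSpaceModel I) (hw : ContMDiff I 𝓘(ℝ, ℝ) 1 w)
    (hw0 : ∀ x ∈ I.boundary M, w x = 0) (hwn : ∀ x, 0 ≤ w x) {p : M} {z : Fin d → ℝ}
    (hz : z ∈ boundaryTarget I p) :
    √(gram I m p (hyperplaneIncl z)).det
        * gradCoord (range I) (gram I m p) (inChart I p w) 0 (hyperplaneIncl z)
      = areaDensity m p z * √(inChart I p (gradInner m w w) (hyperplaneIncl z)) := by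
  obtain ⟨htangential, hnormal⟩ := partialD_inChart_boundary hI hw hw0 hwn hz.1 hz.2
  rw [inChart_gradInner m hz.1 (hw.mdifferentiable one_ne_zero _)
    (hw.mdifferentiable one_ne_zero _)]
  exact sqrt_det_mul_inv_mulVec_zero ((isMetricOn_gram m p).posDef _ hz.1)
    (v := fun i => partialD (range I) i (inChart I p w) (hyperplaneIncl z)) htangential hnormal

end NormalGradient

/-! ### Green's formula -/

section Green

open Filter Topology

theorem IsMetricOn.sum_partialD_mul_sqrt_det_gradCoord {n : ℕ}
    {S W : Set (EuclideanSpace ℝ (Fin n))}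
    {γ : EuclideanSpace ℝ (Fin n) → Matrix (Fin n) (Fin n) ℝ} {y : EuclideanSpace ℝ (Fin n)}
    {a b : EuclideanSpace ℝ (Fin n) → ℝ} (h : IsMetricOn W γ) (hW : IsOpen W) (hWS : W ⊆ S)
    (ha : DifferentiableAt ℝ a y) (hb : ContDiffOn ℝ 2 b W) (hy : y ∈ W) :
    ∑ i, partialD S i (fun z => a z * (√(γ z).det * gradCoord S γ b i z)) y
      = √(γ y).det * (a y * laplaceCoord S γ b y + gradInnerCoord S γ a b y) := by
  have hS : S ∈ 𝓝 y := mem_of_superset (hW.mem_nhds hy) hWS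
  have hsqrt : DifferentiableAt ℝ (fun z => √(γ z).det) y :=
    differentiableAt_of_contDiffOn h.contDiffOn_sqrt_det (by simp) hW hy
  have hgrad := h.differentiableAt_gradCoord hW hWS hb hy
  rw [h.laplaceCoord_eq_div_gradCoord hW hWS hb hy, gradInnerCoord, Finset.mul_sum,
    ← Finset.sum_add_distrib, Finset.mul_sum]
  refine Finset.sum_congr rfl fun i _ => ?_
  rw [partialD_mul hS ha (hsqrt.fun_mul (hgrad i)), partialD_mul hS hsqrt (hgrad i),
    h.partialD_sqrt_det hW hWS hy]
  ring

theorem exists_finset_smooth_partition {n : ℕ} {H : Type*} [TopologicalSpace H]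
    (I : ModelWithCorners ℝ (EuclideanSpace ℝ (Fin n)) H)
    (M : Type*) [TopologicalSpace M] [ChartedSpace H M] [IsManifold I ∞ M]
    [T2Space M] [CompactSpace M] :
    ∃ (s : Finset M) (ρ : M → M → ℝ), (∀ i, ContMDiff I 𝓘(ℝ, ℝ) ∞ (ρ i)) ∧
      (∀ i, tsupport (ρ i) ⊆ (extChartAt I i).source) ∧ ∀ x, ∑ i ∈ s, ρ i x = 1 := by
  have : LocallyCompactSpace H := I.locallyCompactSpace
  obtain ⟨ρ, hρ⟩ := SmoothPartitionOfUnity.exists_isSubordinate_chartAt_source I M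
  have hfinite : (Function.support fun i => (ρ i : M → ℝ)).Finite :=
    ρ.locallyFinite.finite_nonempty_of_compact.subset fun i hi => Function.ne_iff.1 hi
  refine ⟨hfinite.toFinset, fun i => ρ i, fun i => (ρ i).contMDiff,
    fun i => extChartAt_source I i ▸ hρ i, fun x => ?_⟩
  rw [← ρ.sum_eq_one (mem_univ x), finsum_eq_sum_of_support_subset]
  exact fun i hi => hfinite.mem_toFinset.2 fun hc => hi (congrFun hc x)

section GradInner

variable {n : ℕ} {H : Type*} [TopologicalSpace H]
  {I : ModelWithCorners ℝ (EuclideanSpace ℝ (Fin n)) H}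
  {M : Type*} [TopologicalSpace M] [ChartedSpace H M] [IsManifold I ∞ M]
  (m : Bundle.ContMDiffRiemannianMetric I ∞ (EuclideanSpace ℝ (Fin n))
    (fun x : M => TangentSpace I x))

theorem gradInner_eq_zero_of_eventuallyEq {φ : M → ℝ} {x : M} (b : M → ℝ) (h : φ =ᶠ[𝓝 x] 0) :
    gradInner m φ b x = 0 := by
  rw [gradInner_congr m h (EventuallyEq.refl _ b), gradInner, gradInnerCoord]
  refine Finset.sum_eq_zero fun i _ => ?_
  have hconst : inChart I x (0 : M → ℝ) = fun _ => 0 := rfl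
  rw [partialD, hconst, fderivWithin_fun_const, Pi.zero_apply, zero_apply, zero_mul]

/-- `w` is `C¹` up to the boundary and `C²` inside, and its Laplacian extends to the continuous
function `k`. -/
structure HasContinuousLaplacian (w k : M → ℝ) : Prop where
  contMDiff : ContMDiff I 𝓘(ℝ, ℝ) 1 w
  contMDiffOn : ContMDiffOn I 𝓘(ℝ, ℝ) 2 w (I.interior M)
  continuous_ext : Continuous k
  laplacian_eq : ∀ x ∈ I.interior M, laplacian I m w x = k x

end GradInner

variable {d : ℕ} {H : Type*} [TopologicalSpace H]
  {I : ModelWithCorners ℝ (EuclideanSpace ℝ (Fin (d + 1))) H}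
  {M : Type*} [TopologicalSpace M] [ChartedSpace H M] [IsManifold I ∞ M]
  (m : Bundle.ContMDiffRiemannianMetric I ∞ (EuclideanSpace ℝ (Fin (d + 1)))
    (fun x : M => TangentSpace I x))

/-- The field `φ (det γ)^{1/2} ∇w` in the chart around `p`; its Euclidean divergence is
`(det γ)^{1/2}` times the Riemannian divergence of `φ ∇w`. -/
def fluxCoord (p : M) (φ w : M → ℝ) (i : Fin (d + 1)) (y : EuclideanSpace ℝ (Fin (d + 1))) : ℝ :=
  inChart I p φ y * (√(gram I m p y).det * gradCoord (range I) (gram I m p) (inChart I p w) i y)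

variable {φ w k : M → ℝ} {m}

theorem isDivergenceOn_fluxCoord (hφ : ContMDiff I 𝓘(ℝ, ℝ) 1 φ)
    (hw : HasContinuousLaplacian m w k) (p : M) :
    IsDivergenceOn (extChartAt I p).target (fluxCoord m p φ w)
      fun y => √(gram I m p y).det * inChart I p (fun x => φ x * k x + gradInner m φ w x) y where
  continuousOn i := ((contDiffOn_inChart hφ (WithTop.coe_le_coe.2 le_top) p).continuousOn).mul
    ((isMetricOn_gram m p).contDiffOn_sqrt_det.continuousOn.mul (continuousOn_gradCoord_target m
      (contDiffOn_inChart hw.contMDiff (WithTop.coe_le_coe.2 le_top) p) i))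
  differentiableAt i y hy := by
    have hmet := isMetricOn_gram_interior m p
    refine DifferentiableAt.mul ?_ (DifferentiableAt.mul ?_ ?_)
    · exact differentiableAt_of_contDiffOn (contDiffOn_inChart_interior hφ.contMDiffOn
        (WithTop.coe_le_coe.2 le_top) p) one_ne_zero isOpen_interior hy
    · exact differentiableAt_of_contDiffOn hmet.contDiffOn_sqrt_det (by simp) isOpen_interior hy
    · exact hmet.differentiableAt_gradCoord isOpen_interior (interior_target_subset_range p)
        (contDiffOn_inChart_interior hw.contMDiffOn (WithTop.coe_le_coe.2 le_top) p) hy i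
  continuousOn_div := by
    have hcont : Continuous fun x => φ x * k x + gradInner m φ w x :=
      (hφ.continuous.mul hw.continuous_ext).add (continuous_gradInner m hφ hw.contMDiff)
    exact (isMetricOn_gram m p).contDiffOn_sqrt_det.continuousOn.mul
      (hcont.comp_continuousOn (continuousOn_extChartAt_symm p))
  div_eq y hy := by
    have hφc := differentiableAt_of_contDiffOn (contDiffOn_inChart_interior hφ.contMDiffOn
      (WithTop.coe_le_coe.2 le_top) p) one_ne_zero isOpen_interior hy
    have hwc := contDiffOn_inChart_interior hw.contMDiffOn (WithTop.coe_le_coe.2 le_top) p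
    have hdiv := (isMetricOn_gram_interior m p).sum_partialD_mul_sqrt_det_gradCoord
      isOpen_interior (interior_target_subset_range p) hφc hwc hy
    have hlap := hw.laplacian_eq _ ((symm_mem_interior_iff (interior_subset hy)).2 hy)
    rw [← inChart_laplacian m hw.contMDiffOn hy, ← inChart_gradInner m (interior_subset hy)
      (hφ.mdifferentiable one_ne_zero _) (hw.contMDiff.mdifferentiable one_ne_zero _)] at hdiv
    calc √(gram I m p y).det * inChart I p (fun x => φ x * k x + gradInner m φ w x) y
        = √(gram I m p y).det * (inChart I p φ y * inChart I p (laplacian I m w) y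
            + inChart I p (gradInner m φ w) y) := by simp only [inChart, hlap]
      _ = ∑ i, fderiv ℝ (fluxCoord m p φ w i) y (EuclideanSpace.single i 1) :=
        hdiv.symm.trans <| Finset.sum_congr rfl fun i _ => partialD_eq_fderiv (range_mem_nhds hy) i

theorem fluxCoord_zero_hyperplaneIncl (hI : IsHalfSpaceModel I) (hw : ContMDiff I 𝓘(ℝ, ℝ) 1 w)
    (hb : (∀ x ∈ I.boundary M, φ x = 0) ∨ ((∀ x ∈ I.boundary M, w x = 0) ∧ ∀ x, 0 ≤ w x)) {p : M}
    {z : Fin d → ℝ} (hz : z ∈ boundaryTarget I p) :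
    fluxCoord m p φ w 0 (hyperplaneIncl z) = areaDensity m p z
      * inChart I p (fun x => φ x * √(gradInner m w w x)) (hyperplaneIncl z) := by
  rcases hb with hφ0 | ⟨hw0, hwn⟩
  · simp only [fluxCoord, inChart, hφ0 _ hz.2, zero_mul, mul_zero]
  · rw [fluxCoord, sqrt_det_mul_gradCoord_zero m hI hw hw0 hwn hz]
    simp only [inChart]
    ring

variable [MeasurableSpace M] [BorelSpace M] [CompactSpace M]

theorem green_of_tsupport_subset_source (hI : IsHalfSpaceModel I) (hφ : ContMDiff I 𝓘(ℝ, ℝ) 1 φ)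
    (hw : HasContinuousLaplacian m w k)
    (hb : (∀ x ∈ I.boundary M, φ x = 0) ∨ ((∀ x ∈ I.boundary M, w x = 0) ∧ ∀ x, 0 ≤ w x)) {p : M}
    (hp : tsupport φ ⊆ (extChartAt I p).source) :
    ∫ x, (φ x * k x + gradInner m φ w x) ∂(riemVolume I m)
      = - ∫ x, φ x * √(gradInner m w w x) ∂(boundaryArea I m) := by
  have hφ0 {x : M} (hx : x ∉ tsupport φ) : φ x = 0 := image_eq_zero_of_notMem_tsupport hx
  have hint0 {x : M} (hx : x ∉ tsupport φ) : φ x * k x + gradInner m φ w x = 0 := by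
    rw [hφ0 hx, gradInner_eq_zero_of_eventuallyEq m w (notMem_tsupport_iff_eventuallyEq.1 hx),
      zero_mul, add_zero]
  have hK : IsCompact (extChartAt I p '' tsupport φ) :=
    (isClosed_tsupport φ).isCompact.image_of_continuousOn ((continuousOn_extChartAt p).mono hp)
  have hKT : extChartAt I p '' tsupport φ ⊆ (extChartAt I p).target :=
    image_subset_iff.2 fun x hx => (extChartAt I p).map_source (hp hx)
  have hnotMem {y : EuclideanSpace ℝ (Fin (d + 1))} (hy : y ∈ (extChartAt I p).target)
      (hyK : y ∉ extChartAt I p '' tsupport φ) : (extChartAt I p).symm y ∉ tsupport φ :=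
    fun hc => hyK ⟨_, hc, (extChartAt I p).right_inv hy⟩
  have hcont : Continuous fun x => φ x * k x + gradInner m φ w x :=
    (hφ.continuous.mul hw.continuous_ext).add (continuous_gradInner m hφ hw.contMDiff)
  have hcont_boundary : Continuous fun x => φ x * √(gradInner m w w x) :=
    hφ.continuous.mul (continuous_gradInner m hw.contMDiff hw.contMDiff).sqrt
  rw [integral_riemVolume_of_support_subset m p hcont
      fun x hx => hp (not_not.1 fun h => hx (hint0 h)),
    integral_boundaryArea_of_support_subset m hI p hcont_boundary
      fun x hx => hp (subset_closure (left_ne_zero_of_mul hx)),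
    (isDivergenceOn_fluxCoord hφ hw p).integral_extChartAt_target hI p hK hKT
      (fun i y hy hyK => by rw [fluxCoord, inChart, hφ0 (hnotMem hy hyK), zero_mul])
      fun y hy hyK => by rw [inChart, hint0 (hnotMem hy hyK), mul_zero]]
  exact congrArg _ <| setIntegral_congr_fun (isOpen_boundaryTarget hI p).measurableSet
    fun z hz => fluxCoord_zero_hyperplaneIncl hI hw.contMDiff hb hz

/-- On `∂M` either `φ` vanishes or `∂w/∂ν = -|∇w|`, which gives the boundary term its form. -/
theorem green [T2Space M] (hI : IsHalfSpaceModel I) (hφ : ContMDiff I 𝓘(ℝ, ℝ) 1 φ)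
    (hw : HasContinuousLaplacian m w k)
    (hb : (∀ x ∈ I.boundary M, φ x = 0) ∨ ((∀ x ∈ I.boundary M, w x = 0) ∧ ∀ x, 0 ≤ w x)) :
    ∫ x, (φ x * k x + gradInner m φ w x) ∂(riemVolume I m)
      = - ∫ x, φ x * √(gradInner m w w x) ∂(boundaryArea I m) := by
  have := isFiniteMeasure_riemVolume (I := I) m
  have := isFiniteMeasure_boundaryArea m hI
  obtain ⟨s, ρ, hρ, hρsupp, hρsum⟩ := exists_finset_smooth_partition I M
  have hρφ (i : M) : ContMDiff I 𝓘(ℝ, ℝ) 1 (fun x => ρ i x * φ x) :=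
    ((hρ i).of_le (WithTop.coe_le_coe.2 le_top)).mul hφ
  have hlocal (i : M) := green_of_tsupport_subset_source hI (hρφ i) hw
    (hb.imp_left fun h x hx => by rw [h x hx, mul_zero])
    (tsupport_mul_subset_left.trans (hρsupp i))
  have hinterior (x : M) : φ x * k x + gradInner m φ w x
      = ∑ i ∈ s, (ρ i x * φ x * k x + gradInner m (fun x => ρ i x * φ x) w x) := by
    rw [Finset.sum_add_distrib,
      ← gradInner_sum_left m s w fun i _ => (hρφ i).mdifferentiable one_ne_zero x]
    simp only [← Finset.sum_mul, hρsum, one_mul]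
  have hboundary (x : M) : φ x * √(gradInner m w w x)
      = ∑ i ∈ s, ρ i x * φ x * √(gradInner m w w x) := by
    simp only [← Finset.sum_mul, hρsum, one_mul]
  simp only [hinterior, hboundary]
  rw [integral_finsetSum, integral_finsetSum, ← Finset.sum_neg_distrib]
  · exact Finset.sum_congr rfl fun i _ => hlocal i
  · exact fun i _ => ((hρφ i).continuous.mul (continuous_gradInner m hw.contMDiff
      hw.contMDiff).sqrt).integrable_of_hasCompactSupport (HasCompactSupport.of_compactSpace _)
  · exact fun i _ => (((hρφ i).continuous.mul hw.continuous_ext).add (continuous_gradInner m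
      (hρφ i) hw.contMDiff)).integrable_of_hasCompactSupport (HasCompactSupport.of_compactSpace _)

end Green

/-! ### Green's formula in the interior -/

section GreenInterior

open Filter Topology

variable {d : ℕ} {H : Type*} [TopologicalSpace H]
  {I : ModelWithCorners ℝ (EuclideanSpace ℝ (Fin (d + 1))) H}
  {M : Type*} [TopologicalSpace M] [ChartedSpace H M] [IsManifold I ∞ M]
  (m : Bundle.ContMDiffRiemannianMetric I ∞ (EuclideanSpace ℝ (Fin (d + 1)))
    (fun x : M => TangentSpace I x))
  {φ w k : M → ℝ}

theorem laplacian_zero (x : M) : laplacian I m (fun _ => (0 : ℝ)) x = 0 := by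
  simp only [laplacian, laplaceCoord, partialD, fderivWithin_fun_const, Pi.zero_apply,
    zero_apply, mul_zero, Finset.sum_const_zero]

omit [IsManifold I ∞ M] in
theorem tsupport_subset_interior (hφ : ∀ x ∈ I.boundary M, φ =ᶠ[𝓝 x] 0) :
    tsupport φ ⊆ I.interior M := fun x hx => by
  by_contra hxi
  exact notMem_tsupport_iff_eventuallyEq.2 (hφ x (I.compl_interior (M := M) ▸ hxi)) hx

theorem exists_contMDiff_eventually_one_eventually_zero [T2Space M] [CompactSpace M] {C : Set M}
    (hC : IsClosed C) (hCi : C ⊆ I.interior M) :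
    ∃ θ : M → ℝ, ContMDiff I 𝓘(ℝ, ℝ) ∞ θ ∧ (∀ x ∈ C, θ =ᶠ[𝓝 x] 1) ∧
      ∀ x ∈ I.boundary M, θ =ᶠ[𝓝 x] 0 := by
  have : LocallyCompactSpace H := I.locallyCompactSpace
  obtain ⟨U, hU, hCU, hUi⟩ := normal_exists_closure_subset hC isOpen_manifold_interior hCi
  obtain ⟨θ, hθ1, hθ0, -⟩ := exists_contMDiffMap_one_nhds_of_subset_interior I (n := ⊤)
    hC (hCU.trans hU.interior_eq.ge)
  refine ⟨θ, θ.contMDiff, fun x hx => hθ1.filter_mono (nhds_le_nhdsSet hx), fun x hx => ?_⟩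
  have hxU : x ∉ closure U := fun hc =>
    (I.compl_interior (M := M)).symm.subset hx (hUi hc)
  filter_upwards [isClosed_closure.isOpen_compl.mem_nhds hxU] with z hz
  exact hθ0 z fun hc => hz (subset_closure hc)

theorem exists_hasContinuousLaplacian_eventuallyEq [T2Space M] [CompactSpace M] {C : Set M}
    (hC : IsClosed C) (hCi : C ⊆ I.interior M) (hw : ContMDiffOn I 𝓘(ℝ, ℝ) 2 w (I.interior M)) :
    ∃ w' k, HasContinuousLaplacian m w' k ∧ ∀ x ∈ C, w' =ᶠ[𝓝 x] w := by
  obtain ⟨θ, hθ, hθ1, hθ0⟩ := exists_contMDiff_eventually_one_eventually_zero hC hCi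
  have hθw : ContMDiffOn I 𝓘(ℝ, ℝ) 2 (fun x => θ x * w x) (I.interior M) :=
    (hθ.of_le (WithTop.coe_le_coe.2 le_top)).contMDiffOn.mul hw
  have hθw0 (x : M) (hx : x ∈ I.boundary M) : (fun x => θ x * w x) =ᶠ[𝓝 x] 0 :=
    (hθ0 x hx).mono fun z hz => by simp only [hz, Pi.zero_apply, zero_mul]
  classical
  set k := (I.interior M).indicator (laplacian I m fun x => θ x * w x)
  have hk_interior (x : M) (hx : x ∈ I.interior M) : laplacian I m (fun x => θ x * w x) x = k x :=
    (indicator_of_mem hx _).symm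
  have hk_smooth : ContMDiffOn I 𝓘(ℝ, ℝ) 0 k (I.interior M) :=
    (contMDiffOn_laplacian m (WithTop.coe_le_coe.2 le_top) (by rwa [zero_add])).congr
      fun x hx => (hk_interior x hx).symm
  have hk0 (x : M) (hx : x ∈ I.boundary M) : k =ᶠ[𝓝 x] 0 := by
    filter_upwards [(hθw0 x hx).eventuallyEq_nhds] with z hz
    by_cases hzi : z ∈ I.interior M
    · rw [← hk_interior z hzi, laplacian_congr m hz hzi]
      exact laplacian_zero m z
    · exact indicator_of_notMem hzi _
  refine ⟨_, k, ⟨?_, hθw, ?_, hk_interior⟩, fun x hx => ?_⟩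
  · exact (contMDiff_of_eventuallyEq_zero_boundary hθw hθw0).of_le one_le_two
  · exact (contMDiff_of_eventuallyEq_zero_boundary hk_smooth hk0).continuous
  · exact (hθ1 x hx).mono fun z hz => by simp only [hz, Pi.one_apply, one_mul]

variable [MeasurableSpace M] [BorelSpace M] [CompactSpace M]

theorem integrable_riemVolume [T2Space M] {f : M → ℝ} (hf : Continuous f) :
    Integrable f (riemVolume I m) :=
  have := isFiniteMeasure_riemVolume (I := I) m
  hf.integrable_of_hasCompactSupport (HasCompactSupport.of_compactSpace _)

theorem integrable_boundaryArea [T2Space M] (hI : IsHalfSpaceModel I) {f : M → ℝ}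
    (hf : Continuous f) : Integrable f (boundaryArea I m) :=
  have := isFiniteMeasure_boundaryArea m hI
  hf.integrable_of_hasCompactSupport (HasCompactSupport.of_compactSpace _)

theorem ae_mem_boundary (hI : IsHalfSpaceModel I) :
    ∀ᵐ x ∂(boundaryArea I m), x ∈ I.boundary M := by
  have hcompl : {x | x ∉ I.boundary M} = I.interior M := I.compl_boundary
  rw [ae_iff, hcompl, boundaryArea_interior m hI]

theorem ae_mem_interior (hI : IsHalfSpaceModel I) :
    ∀ᵐ x ∂(riemVolume I m), x ∈ I.interior M := by
  have hcompl : {x | x ∉ I.interior M} = I.boundary M := I.compl_interior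
  rw [ae_iff, hcompl, riemVolume_boundary m hI]

variable [T2Space M] {m}

theorem green_of_eq_zero (hI : IsHalfSpaceModel I) (hφ : ContMDiff I 𝓘(ℝ, ℝ) 1 φ)
    (hw : HasContinuousLaplacian m w k) (hφ0 : ∀ x ∈ I.boundary M, φ x = 0) :
    ∫ x, (φ x * k x + gradInner m φ w x) ∂(riemVolume I m) = 0 := by
  rw [green hI hφ hw (Or.inl hφ0), neg_eq_zero]
  refine integral_eq_zero_of_ae ?_
  filter_upwards [ae_mem_boundary m hI] with x hx
  rw [hφ0 x hx, zero_mul, Pi.zero_apply]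

/-- `F` extends `φ Δw + ⟨∇φ, ∇w⟩` continuously by zero: `w` need not even be bounded near `∂M`. -/
theorem green_interior (hI : IsHalfSpaceModel I) (hφ : ContMDiffOn I 𝓘(ℝ, ℝ) 1 φ (I.interior M))
    (hφ0 : ∀ x ∈ I.boundary M, φ =ᶠ[𝓝 x] 0) (hw : ContMDiffOn I 𝓘(ℝ, ℝ) 2 w (I.interior M)) :
    ∃ F : M → ℝ, Continuous F ∧
      (∀ x ∈ I.interior M, F x = φ x * laplacian I m w x + gradInner m φ w x) ∧
      ∫ x, F x ∂(riemVolume I m) = 0 := by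
  have hφC : ContMDiff I 𝓘(ℝ, ℝ) 1 φ := contMDiff_of_eventuallyEq_zero_boundary hφ hφ0
  obtain ⟨w', k, hw', hw'eq⟩ := exists_hasContinuousLaplacian_eventuallyEq m
    (isClosed_tsupport φ) (tsupport_subset_interior hφ0) hw
  refine ⟨fun x => φ x * k x + gradInner m φ w' x, ?_, fun x hx => ?_,
    green_of_eq_zero hI hφC hw' fun x hx => (hφ0 x hx).self_of_nhds⟩
  · exact (hφC.continuous.mul hw'.continuous_ext).add (continuous_gradInner m hφC hw'.contMDiff)
  · by_cases hxs : x ∈ tsupport φ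
    · simp only [← hw'.laplacian_eq x hx, laplacian_congr m (hw'eq x hxs) hx,
        gradInner_congr m (EventuallyEq.refl _ φ) (hw'eq x hxs)]
    · have hφx := notMem_tsupport_iff_eventuallyEq.1 hxs
      simp only [hφx.self_of_nhds, Pi.zero_apply, zero_mul,
        gradInner_eq_zero_of_eventuallyEq m _ hφx]

end GreenInterior

/-! ### The zero set of a nonnegative function -/

section ZeroSet

open Filter Topology

theorem ae_fderiv_eq_zero_of_eq_zero {E : Type*} [NormedAddCommGroup E] [NormedSpace ℝ E]
    [FiniteDimensional ℝ E] [MeasurableSpace E] [BorelSpace E] (μ : Measure E) [μ.IsAddHaarMeasure]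
    {f : E → ℝ} {Z : Set E} (hZ : MeasurableSet Z) (hf : ∀ y ∈ Z, DifferentiableAt ℝ f y)
    (hf0 : ∀ y ∈ Z, f y = 0) : ∀ᵐ y ∂(μ.restrict Z), fderiv ℝ f y = 0 := by
  rcases subsingleton_or_nontrivial E with hE | hE
  · exact Eventually.of_forall fun y => Subsingleton.elim _ _
  obtain ⟨v, hv⟩ := exists_ne (0 : E)
  have happrox : ApproximatesLinearOn (fun y => f y • v) (0 : E →L[ℝ] E) Z 0 := fun y hy z hz => by
    simp only [hf0 y hy, hf0 z hz, zero_smul, sub_self, zero_apply, norm_zero, NNReal.coe_zero,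
      zero_mul, le_refl]
  have hderiv (y : E) (hy : y ∈ Z) :
      HasFDerivWithinAt (fun y => f y • v) ((fderiv ℝ f y).smulRight v) Z y :=
    ((hf y hy).hasFDerivAt.smul_const v).hasFDerivWithinAt
  filter_upwards [happrox.norm_fderiv_sub_le μ hZ _ hderiv] with y hy
  rw [sub_zero, nonpos_iff_eq_zero, nnnorm_eq_zero] at hy
  ext z
  exact (smul_eq_zero.1 (DFunLike.congr_fun hy z)).resolve_right hv

variable {n : ℕ} {H : Type*} [TopologicalSpace H]
  {I : ModelWithCorners ℝ (EuclideanSpace ℝ (Fin n)) H}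
  {M : Type*} [TopologicalSpace M] [ChartedSpace H M] [IsManifold I ∞ M]
  (m : Bundle.ContMDiffRiemannianMetric I ∞ (EuclideanSpace ℝ (Fin n))
    (fun x : M => TangentSpace I x))
  {u k : M → ℝ}

omit [IsManifold I ∞ M] in
theorem partialD_inChart_eq_zero_of_eq_zero (hu : ∀ x, 0 ≤ u x) {p : M}
    {y : EuclideanSpace ℝ (Fin n)} (hy : y ∈ interior (extChartAt I p).target)
    (h0 : inChart I p u y = 0) (i : Fin n) : partialD (range I) i (inChart I p u) y = 0 := by
  have hmin : IsLocalMin (inChart I p u) y := Eventually.of_forall fun z => h0 ▸ hu _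
  rw [partialD_eq_fderiv (range_mem_nhds hy), hmin.fderiv_eq_zero, zero_apply]

theorem gradInner_eq_zero_of_eq_zero (hu : ∀ x, 0 ≤ u x) (a : M → ℝ) {x : M}
    (hx : x ∈ I.interior M) (h0 : u x = 0) : gradInner m a u x = 0 := by
  have hxs := mem_extChartAt_source (I := I) x
  rw [gradInner_comm, gradInner, gradInnerCoord]
  refine Finset.sum_eq_zero fun i _ => ?_
  rw [partialD_inChart_eq_zero_of_eq_zero hu ((mem_interior_iff x hxs).1 hx)
    (by rw [inChart_extChartAt hxs, h0]), zero_mul]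

theorem measurableSet_inChart_eq_zero (hu : ContMDiffOn I 𝓘(ℝ, ℝ) 2 u (I.interior M)) (p : M) :
    MeasurableSet (interior (extChartAt I p).target ∩ inChart I p u ⁻¹' {0}) :=
  measurableSet_inter_preimage isOpen_interior.measurableSet
    (contDiffOn_inChart_interior hu (WithTop.coe_le_coe.2 le_top) p).continuousOn
    (measurableSet_singleton 0)

theorem ae_laplaceCoord_eq_zero (hun : ∀ x, 0 ≤ u x)
    (hu : ContMDiffOn I 𝓘(ℝ, ℝ) 2 u (I.interior M)) (p : M) :
    ∀ᵐ y ∂(volume.restrict (interior (extChartAt I p).target ∩ inChart I p u ⁻¹' {0})),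
      laplaceCoord (range I) (gram I m p) (inChart I p u) y = 0 := by
  have hZ := measurableSet_inChart_eq_zero hu p
  have hmet := isMetricOn_gram_interior m p
  have hu2 := contDiffOn_inChart_interior hu (WithTop.coe_le_coe.2 le_top) p
  have hgrad (i : Fin n) : ∀ y ∈ interior (extChartAt I p).target ∩ inChart I p u ⁻¹' {0},
      gradCoord (range I) (gram I m p) (inChart I p u) i y = 0 := fun y hy =>
    Finset.sum_eq_zero fun j _ => by
      rw [partialD_inChart_eq_zero_of_eq_zero hun hy.1 hy.2, mul_zero]
  have hfderiv (i : Fin n) := ae_fderiv_eq_zero_of_eq_zero volume hZ (fun y hy =>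
    hmet.differentiableAt_gradCoord isOpen_interior (interior_target_subset_range p) hu2 hy.1 i)
    (hgrad i)
  filter_upwards [ae_all_iff.2 hfderiv, ae_restrict_mem hZ] with y hy hyZ
  rw [hmet.laplaceCoord_eq_div_gradCoord isOpen_interior (interior_target_subset_range p) hu2
    hyZ.1]
  refine Finset.sum_eq_zero fun i _ => ?_
  rw [partialD_eq_fderiv (range_mem_nhds hyZ.1), hy i, hgrad i y hyZ, zero_apply, mul_zero,
    add_zero]

theorem ae_laplacian_eq_zero_of_eq_zero [MeasurableSpace M] [BorelSpace M] [CompactSpace M]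
    {m : Bundle.ContMDiffRiemannianMetric I ∞ (EuclideanSpace ℝ (Fin n))
      (fun x : M => TangentSpace I x)}
    (hun : ∀ x, 0 ≤ u x) (hu : HasContinuousLaplacian m u k) :
    ∀ᵐ x ∂(riemVolume I m), x ∈ I.interior M → u x = 0 → k x = 0 := by
  have hnull : {x | ¬(x ∈ I.interior M → u x = 0 → k x = 0)}
      = I.interior M ∩ (u ⁻¹' {0} ∩ k ⁻¹' {0}ᶜ) := by
    ext x
    simp only [Classical.not_imp, mem_ofPred_eq, mem_inter_iff, mem_preimage, mem_singleton_iff,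
      mem_compl_iff]
  have hmeas : MeasurableSet (I.interior M ∩ (u ⁻¹' {0} ∩ k ⁻¹' {0}ᶜ)) :=
    isOpen_manifold_interior.measurableSet.inter
      ((hu.contMDiff.continuous.measurable (measurableSet_singleton 0)).inter
        (hu.continuous_ext.measurable (measurableSet_singleton 0).compl))
  rw [ae_iff, hnull]
  refine measure_eq_zero_of_forall_nhds fun p => ⟨(extChartAt I p).source, measurableSet_source p,
    extChartAt_source_mem_nhds p, ?_⟩
  have hmeas_p := hmeas.inter (measurableSet_source (I := I) p)
  rw [riemVolume_apply m p hmeas_p inter_subset_right, chartVolume_apply m p hmeas_p]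
  refine setLIntegral_measure_zero _ _ ?_
  have hae := ae_laplaceCoord_eq_zero m hun hu.contMDiffOn p
  rw [ae_restrict_iff' (measurableSet_inChart_eq_zero hu.contMDiffOn p), ae_iff] at hae
  refine measure_mono_null ?_ hae
  rintro y ⟨hy, ⟨hyi, hy0, hyk⟩, -⟩ hlap
  have hy' := (symm_mem_interior_iff hy).1 hyi
  have hk : laplacian I m u ((extChartAt I p).symm y) = 0 :=
    (inChart_laplacian m hu.contMDiffOn hy').trans (hlap ⟨hy', hy0⟩)
  exact hyk (hu.laplacian_eq _ hyi ▸ hk)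

end ZeroSet

/-! ### Cutoff functions -/

section Cutoff

open Filter Topology

/-- Smooth monotone cutoff: zero for `t ≤ ε`, one for `2 ε ≤ t`. -/
def cutoff (ε t : ℝ) : ℝ := Real.smoothTransition (t / ε - 1)

/-- Primitive of the cutoff: a nonnegative approximation of `t ↦ t` that vanishes for `t ≤ ε`. -/
def cutoffPrim (ε t : ℝ) : ℝ := ∫ s in (0 : ℝ)..t, cutoff ε s

variable {ε t : ℝ}

theorem contDiff_cutoff (ε : ℝ) : ContDiff ℝ 1 (cutoff ε) :=
  Real.smoothTransition.contDiff.comp ((contDiff_id.div_const ε).sub contDiff_const)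

theorem continuous_cutoff (ε : ℝ) : Continuous (cutoff ε) := (contDiff_cutoff ε).continuous

theorem cutoff_nonneg (ε t : ℝ) : 0 ≤ cutoff ε t := Real.smoothTransition.nonneg _

theorem cutoff_le_one (ε t : ℝ) : cutoff ε t ≤ 1 := Real.smoothTransition.le_one _

theorem cutoff_eq_zero (hε : 0 < ε) (ht : t ≤ ε) : cutoff ε t = 0 :=
  Real.smoothTransition.zero_of_nonpos (sub_nonpos.2 ((div_le_one hε).2 ht))

theorem cutoff_eq_one (hε : 0 < ε) (ht : 2 * ε ≤ t) : cutoff ε t = 1 := by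
  refine Real.smoothTransition.one_of_one_le ?_
  have := (le_div_iff₀ hε).2 ht
  linarith

theorem deriv_cutoff_nonneg (hε : 0 < ε) (t : ℝ) : 0 ≤ deriv (cutoff ε) t := by
  refine Monotone.deriv_nonneg fun s t hst => Real.smoothTransition.monotone ?_
  gcongr

theorem hasDerivAt_cutoff (ε t : ℝ) : HasDerivAt (cutoff ε) (deriv (cutoff ε) t) t :=
  ((contDiff_cutoff ε).differentiable one_ne_zero t).hasDerivAt

theorem hasDerivAt_cutoffPrim (ε t : ℝ) : HasDerivAt (cutoffPrim ε) (cutoff ε t) t :=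
  ((continuous_cutoff ε).integral_hasStrictDerivAt 0 t).hasDerivAt

theorem contDiff_one_of_hasDerivAt {F f : ℝ → ℝ} (h : ∀ t, HasDerivAt F (f t) t)
    (hf : Continuous f) : ContDiff ℝ 1 F :=
  contDiff_one_iff_deriv.2 ⟨fun t => (h t).differentiableAt,
    (funext fun t => (h t).deriv : deriv F = f) ▸ hf⟩

theorem contDiff_cutoffPrim (ε : ℝ) : ContDiff ℝ 1 (cutoffPrim ε) :=
  contDiff_one_of_hasDerivAt (hasDerivAt_cutoffPrim ε) (continuous_cutoff ε)

theorem cutoffPrim_eq_zero (hε : 0 < ε) (ht : t ≤ ε) : cutoffPrim ε t = 0 :=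
  intervalIntegral.integral_zero_ae (Eventually.of_forall fun _ hs =>
    cutoff_eq_zero hε (hs.2.trans (max_le hε.le ht)))

theorem intervalIntegrable_cutoff (ε a b : ℝ) : IntervalIntegrable (cutoff ε) volume a b :=
  (continuous_cutoff ε).intervalIntegrable a b

theorem cutoffPrim_nonneg (ε : ℝ) (ht : 0 ≤ t) : 0 ≤ cutoffPrim ε t :=
  intervalIntegral.integral_nonneg ht fun s _ => cutoff_nonneg ε s

theorem cutoffPrim_le (ε : ℝ) (ht : 0 ≤ t) : cutoffPrim ε t ≤ t :=
  calc cutoffPrim ε t ≤ ∫ _ in (0 : ℝ)..t, (1 : ℝ) :=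
        intervalIntegral.integral_mono_on ht (intervalIntegrable_cutoff ε 0 t)
          intervalIntegrable_const fun s _ => cutoff_le_one ε s
    _ = t := by rw [integral_one, sub_zero]

theorem le_cutoffPrim (hε : 0 < ε) (ht : 0 ≤ t) : t - 2 * ε ≤ cutoffPrim ε t := by
  rcases le_total t (2 * ε) with h | h
  · exact (sub_nonpos.2 h).trans (cutoffPrim_nonneg ε ht)
  calc t - 2 * ε = ∫ _ in (2 * ε)..t, (1 : ℝ) := integral_one.symm
    _ = ∫ s in (2 * ε)..t, cutoff ε s := intervalIntegral.integral_congr fun s hs =>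
        (cutoff_eq_one hε (uIcc_of_le h ▸ hs).1).symm
    _ ≤ cutoffPrim ε (2 * ε) + ∫ s in (2 * ε)..t, cutoff ε s :=
        le_add_of_nonneg_left (cutoffPrim_nonneg ε (by positivity))
    _ = cutoffPrim ε t := intervalIntegral.integral_add_adjacent_intervals
        (intervalIntegrable_cutoff ε _ _) (intervalIntegrable_cutoff ε _ _)

theorem tendsto_cutoff (ht : 0 < t) :
    Tendsto (fun ε => cutoff ε t) (𝓝[>] 0) (𝓝 1) := by
  have hlim : Tendsto (fun ε : ℝ => 2 * ε) (𝓝[>] 0) (𝓝 0) :=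
    tendsto_nhdsWithin_of_tendsto_nhds (Continuous.tendsto' (by fun_prop) _ _ (mul_zero 2))
  refine tendsto_const_nhds.congr' ?_
  filter_upwards [hlim.eventually (gt_mem_nhds ht), self_mem_nhdsWithin] with ε h2ε hε
  exact (cutoff_eq_one hε h2ε.le).symm

theorem tendsto_cutoffPrim (ht : 0 ≤ t) :
    Tendsto (fun ε => cutoffPrim ε t) (𝓝[>] 0) (𝓝 t) := by
  have hlim : Tendsto (fun ε => t - 2 * ε) (𝓝[>] 0) (𝓝 t) :=
    tendsto_nhdsWithin_of_tendsto_nhds (Continuous.tendsto' (by fun_prop) _ _ (by ring))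
  refine tendsto_of_tendsto_of_tendsto_of_le_of_le' hlim tendsto_const_nhds ?_ ?_
  · exact eventually_mem_nhdsWithin.mono fun ε hε => le_cutoffPrim hε ht
  · exact Eventually.of_forall fun ε => cutoffPrim_le ε ht

end Cutoff

/-! ### Bochner's inequality tested against the solution -/

section TestedBochner

open Filter Topology

variable {d : ℕ} {H : Type*} [TopologicalSpace H]
  {I : ModelWithCorners ℝ (EuclideanSpace ℝ (Fin (d + 1))) H}
  {M : Type*} [TopologicalSpace M] [ChartedSpace H M] [IsManifold I ∞ M]
  (m : Bundle.ContMDiffRiemannianMetric I ∞ (EuclideanSpace ℝ (Fin (d + 1)))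
    (fun x : M => TangentSpace I x))

/-- `u ≥ 0` solves `-Δu = f` inside `M`, vanishes on `∂M` and lies in `C¹(M) ∩ C³(M \ ∂M)`. -/
structure IsDirichletSolution (u f : M → ℝ) : Prop where
  contMDiff : ContMDiff I 𝓘(ℝ, ℝ) 1 u
  contMDiffOn : ContMDiffOn I 𝓘(ℝ, ℝ) 3 u (I.interior M)
  nonneg : ∀ x, 0 ≤ u x
  eq_zero : ∀ x ∈ I.boundary M, u x = 0
  continuous_rhs : Continuous f
  neg_laplacian : ∀ x ∈ I.interior M, - laplacian I m u x = f x

/-- The integrand that Bochner's inequality for `u` leaves after testing with `e` and integrating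
by parts; `h` stands for the derivative of `e` as a function of `u`. -/
def bochnerTerm (c : ℝ) (u f e h : M → ℝ) (x : M) : ℝ :=
  (1 / ((d + 1 : ℕ) : ℝ) - 1) * (e x * f x ^ 2) + 3 / 2 * (h x * (f x * gradInner m u u x))
    + c * (e x * gradInner m u u x)

theorem continuous_bochnerTerm (c : ℝ) {u f e h : M → ℝ} (hu : ContMDiff I 𝓘(ℝ, ℝ) 1 u)
    (hf : Continuous f) (he : Continuous e) (hh : Continuous h) :
    Continuous (bochnerTerm m c u f e h) := by
  have hG : Continuous (gradInner m u u) := continuous_gradInner m hu hu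
  unfold bochnerTerm
  fun_prop

namespace IsDirichletSolution

variable {m} {u f : M → ℝ} (hu : IsDirichletSolution m u f)

include hu

theorem hasContinuousLaplacian : HasContinuousLaplacian m u (fun x => - f x) where
  contMDiff := hu.contMDiff
  contMDiffOn := hu.contMDiffOn.of_le (by norm_num)
  continuous_ext := hu.continuous_rhs.neg
  laplacian_eq x hx := by rw [← hu.neg_laplacian x hx, neg_neg]

theorem contMDiffOn_rhs : ContMDiffOn I 𝓘(ℝ, ℝ) 1 f (I.interior M) :=
  (contMDiffOn_laplacian m (WithTop.coe_le_coe.2 le_top)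
    (hu.contMDiffOn.of_le (by norm_num))).neg.congr fun x hx => (hu.neg_laplacian x hx).symm

theorem contMDiffOn_gradInner_self :
    ContMDiffOn I 𝓘(ℝ, ℝ) 2 (gradInner m u u) (I.interior M) :=
  have hu3 : ContMDiffOn I 𝓘(ℝ, ℝ) (2 + 1) u (I.interior M) := hu.contMDiffOn.of_le (by norm_num)
  contMDiffOn_gradInner m (WithTop.coe_le_coe.2 le_top) hu3 hu3

theorem gradInner_laplacian {x : M} (hx : x ∈ I.interior M) :
    gradInner m (laplacian I m u) u x = - gradInner m f u x := by
  have hneg : laplacian I m u =ᶠ[𝓝 x] fun z => - f z := by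
    filter_upwards [isOpen_manifold_interior.mem_nhds hx] with z hz
    exact hu.hasContinuousLaplacian.laplacian_eq z hz
  rw [gradInner_congr m hneg (EventuallyEq.refl _ u), gradInner_comp_left m u (hasDerivAt_neg (f x))
    ((contMDiffAt_of_mem_interior hu.contMDiffOn_rhs hx).mdifferentiableAt one_ne_zero),
    neg_one_mul]

theorem comp_eventuallyEq_zero {F : ℝ → ℝ} {ε : ℝ} (hε : 0 < ε) (hF : ∀ t ≤ ε, F t = 0) {x : M}
    (hx : x ∈ I.boundary M) : (fun z => F (u z)) =ᶠ[𝓝 x] 0 := by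
  have hlt : ∀ᶠ z in 𝓝 x, u z < ε := hu.contMDiff.continuous.continuousAt.eventually
    (gt_mem_nhds ((hu.eq_zero x hx).trans_lt hε))
  exact hlt.mono fun z hz => hF _ hz.le

theorem contMDiff_comp_mul {F : ℝ → ℝ} {v : M → ℝ} {ε : ℝ} (hε : 0 < ε) (hF : ContDiff ℝ 1 F)
    (hF0 : ∀ t ≤ ε, F t = 0) (hv : ContMDiffOn I 𝓘(ℝ, ℝ) 1 v (I.interior M)) :
    ContMDiff I 𝓘(ℝ, ℝ) 1 (fun x => F (u x) * v x) := by
  refine contMDiff_of_eventuallyEq_zero_boundary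
    ((hF.contMDiff.comp hu.contMDiff).contMDiffOn.mul hv) fun x hx => ?_
  filter_upwards [hu.comp_eventuallyEq_zero hε hF0 hx] with z hz
  simp only [hz, Pi.zero_apply, zero_mul]

theorem gradInner_comp {F : ℝ → ℝ} {F' : ℝ} (v : M → ℝ) {x : M} (hF : HasDerivAt F F' (u x)) :
    gradInner m (fun z => F (u z)) v x = F' * gradInner m u v x :=
  gradInner_comp_left m v hF (hu.contMDiff.mdifferentiable one_ne_zero x)

theorem gradInner_comp_mul {F : ℝ → ℝ} {F' : ℝ} {v : M → ℝ} {x : M} (hF : HasDerivAt F F' (u x))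
    (hv : MDifferentiableAt I 𝓘(ℝ, ℝ) v x) :
    gradInner m (fun z => F (u z) * v z) u x
      = F (u x) * gradInner m v u x + v x * (F' * gradInner m u u x) := by
  have hFu : MDifferentiableAt I 𝓘(ℝ, ℝ) (fun z => F (u z)) x :=
    hF.differentiableAt.mdifferentiableAt.comp x (hu.contMDiff.mdifferentiable one_ne_zero x)
  rw [gradInner_mul_left m u hFu hv, hu.gradInner_comp u hF]

/-- Bochner's inequality times `cutoffPrim ε ∘ u`, each term written as the integrand of a Green
formula. -/
theorem bochnerTerm_cutoff_le {c : ℝ} {x : M}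
    (hRic : ∀ v : TangentSpace I x, c * m.inner x v v ≤ ricci I m x v v) (hx : x ∈ I.interior M)
    (ε : ℝ) :
    bochnerTerm m c u f (fun x => cutoffPrim ε (u x)) (fun x => cutoff ε (u x)) x
        - 1 / 2 * (deriv (cutoff ε) (u x) * gradInner m u u x ^ 2)
      ≤ (cutoffPrim ε (u x) * f x * -f x + gradInner m (fun x => cutoffPrim ε (u x) * f x) u x)
        + 1 / 2 * (cutoffPrim ε (u x) * laplacian I m (gradInner m u u) x
          + gradInner m (fun x => cutoffPrim ε (u x)) (gradInner m u u) x)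
        - 1 / 2 * (cutoff ε (u x) * gradInner m u u x * -f x
          + gradInner m (fun x => cutoff ε (u x) * gradInner m u u x) u x) := by
  have hbochner := mul_le_mul_of_nonneg_left (bochner_inequality m hRic hu.contMDiffOn hx)
    (cutoffPrim_nonneg ε (hu.nonneg x))
  have hfd := (contMDiffAt_of_mem_interior hu.contMDiffOn_rhs hx).mdifferentiableAt one_ne_zero
  have hGd := (contMDiffAt_of_mem_interior hu.contMDiffOn_gradInner_self hx).mdifferentiableAt
    two_ne_zero
  rw [hu.gradInner_laplacian hx, hu.hasContinuousLaplacian.laplacian_eq x hx] at hbochner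
  rw [hu.gradInner_comp_mul (hasDerivAt_cutoffPrim ε (u x)) hfd,
    hu.gradInner_comp_mul (hasDerivAt_cutoff ε (u x)) hGd,
    hu.gradInner_comp _ (hasDerivAt_cutoffPrim ε (u x)), gradInner_comm m u (gradInner m u u),
    bochnerTerm]
  linear_combination hbochner

theorem continuous_bochnerTerm_cutoff (c ε : ℝ) :
    Continuous fun x =>
      bochnerTerm m c u f (fun x => cutoffPrim ε (u x)) (fun x => cutoff ε (u x)) x
        - 1 / 2 * (deriv (cutoff ε) (u x) * gradInner m u u x ^ 2) := by
  have huc : Continuous u := hu.contMDiff.continuous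
  have hG : Continuous (gradInner m u u) := continuous_gradInner m hu.contMDiff hu.contMDiff
  exact (continuous_bochnerTerm m c hu.contMDiff hu.continuous_rhs
    ((contDiff_cutoffPrim ε).continuous.comp huc) ((continuous_cutoff ε).comp huc)).sub
    (continuous_const.mul
      ((((contDiff_cutoff ε).continuous_deriv le_rfl).comp huc).mul (hG.pow 2)))

variable [T2Space M] [CompactSpace M] [MeasurableSpace M] [BorelSpace M]

theorem green_comp_mul (hI : IsHalfSpaceModel I) {F : ℝ → ℝ} {v : M → ℝ} {ε : ℝ} (hε : 0 < ε)
    (hF : ContDiff ℝ 1 F) (hF0 : ∀ t ≤ ε, F t = 0)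
    (hv : ContMDiffOn I 𝓘(ℝ, ℝ) 1 v (I.interior M)) :
    Continuous (fun x => F (u x) * v x * -f x + gradInner m (fun x => F (u x) * v x) u x) ∧
      ∫ x, (F (u x) * v x * -f x + gradInner m (fun x => F (u x) * v x) u x) ∂(riemVolume I m)
        = 0 := by
  have hφ := hu.contMDiff_comp_mul hε hF hF0 hv
  refine ⟨(hφ.continuous.mul hu.continuous_rhs.neg).add (continuous_gradInner m hφ hu.contMDiff),
    green_of_eq_zero hI hφ hu.hasContinuousLaplacian fun x hx => ?_⟩
  rw [hu.eq_zero x hx, hF0 0 hε.le, zero_mul]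

theorem integral_bochnerTerm_cutoff_le (hI : IsHalfSpaceModel I) {c : ℝ}
    (hRic : ∀ (x : M) (v : TangentSpace I x), c * m.inner x v v ≤ ricci I m x v v)
    {ε : ℝ} (hε : 0 < ε) :
    ∫ x, (bochnerTerm m c u f (fun x => cutoffPrim ε (u x)) (fun x => cutoff ε (u x)) x
      - 1 / 2 * (deriv (cutoff ε) (u x) * gradInner m u u x ^ 2)) ∂(riemVolume I m) ≤ 0 := by
  obtain ⟨A, hA, hA_eq, hA_int⟩ := green_interior (m := m) (φ := fun x => cutoffPrim ε (u x)) hI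
    ((contDiff_cutoffPrim ε).contMDiff.comp hu.contMDiff).contMDiffOn
    (fun x => hu.comp_eventuallyEq_zero hε fun _ => cutoffPrim_eq_zero hε)
    hu.contMDiffOn_gradInner_self
  obtain ⟨hB, hB_int⟩ := hu.green_comp_mul hI hε (contDiff_cutoff ε) (fun _ => cutoff_eq_zero hε)
    (hu.contMDiffOn_gradInner_self.of_le one_le_two)
  obtain ⟨hC, hC_int⟩ := hu.green_comp_mul hI hε (contDiff_cutoffPrim ε)
    (fun _ => cutoffPrim_eq_zero hε) hu.contMDiffOn_rhs
  set B : M → ℝ := fun x => cutoff ε (u x) * gradInner m u u x * -f x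
    + gradInner m (fun x => cutoff ε (u x) * gradInner m u u x) u x
  set C : M → ℝ := fun x => cutoffPrim ε (u x) * f x * -f x
    + gradInner m (fun x => cutoffPrim ε (u x) * f x) u x
  have hABC : ∫ x, (C x + 1 / 2 * A x - 1 / 2 * B x) ∂(riemVolume I m) = 0 := by
    rw [integral_sub (integrable_riemVolume m (by fun_prop))
        (integrable_riemVolume m (by fun_prop)),
      integral_add (integrable_riemVolume m hC) (integrable_riemVolume m (by fun_prop)),
      integral_const_mul, integral_const_mul, hA_int, hB_int, hC_int]
    norm_num
  rw [← hABC]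
  refine integral_mono_ae (integrable_riemVolume m (hu.continuous_bochnerTerm_cutoff c ε))
    (integrable_riemVolume m (by fun_prop)) ?_
  filter_upwards [ae_mem_interior m hI] with x hx
  rw [hA_eq x hx]
  exact hu.bochnerTerm_cutoff_le (hRic x) hx ε

/-- The term `deriv (cutoff ε) (u x) * gradInner m u u x ^ 2` concentrates near `∂M` as `ε → 0`;
Green's formula for `cutoff ε ∘ u * ψ` trades it for a multiple of `ψ - gradInner m u u ≥ 0`. -/
theorem integral_bochnerTerm_majorant_le (hI : IsHalfSpaceModel I) {c : ℝ}
    (hRic : ∀ (x : M) (v : TangentSpace I x), c * m.inner x v v ≤ ricci I m x v v)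
    {ψ : M → ℝ} (hψ : ContMDiff I 𝓘(ℝ, ℝ) 1 ψ) (hψG : ∀ x, gradInner m u u x ≤ ψ x)
    {ε : ℝ} (hε : 0 < ε) :
    ∫ x, (bochnerTerm m c u f (fun x => cutoffPrim ε (u x)) (fun x => cutoff ε (u x)) x
      - 1 / 2 * (cutoff ε (u x) * (ψ x * f x - gradInner m ψ u x))) ∂(riemVolume I m) ≤ 0 := by
  have huc : Continuous u := hu.contMDiff.continuous
  have hGψ : Continuous (gradInner m ψ u) := continuous_gradInner m hψ hu.contMDiff
  have hη := (contDiff_cutoffPrim ε).continuous.comp huc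
  have hχ : Continuous fun x => cutoff ε (u x) := (continuous_cutoff ε).comp huc
  have hbochner := continuous_bochnerTerm m c hu.contMDiff hu.continuous_rhs hη hχ
  obtain ⟨hD, hD_int⟩ := hu.green_comp_mul hI hε (contDiff_cutoff ε) (fun _ => cutoff_eq_zero hε)
    hψ.contMDiffOn
  have hint := integrable_riemVolume m (hu.continuous_bochnerTerm_cutoff c ε)
  have hsum := integral_add hint ((integrable_riemVolume m hD).const_mul (1 / 2))
  rw [integral_const_mul, hD_int, mul_zero, add_zero] at hsum
  refine (le_trans ?_ hsum.le).trans (hu.integral_bochnerTerm_cutoff_le hI hRic hε)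
  refine integral_mono (integrable_riemVolume m (hbochner.sub (continuous_const.mul
    (hχ.mul ((hψ.continuous.mul hu.continuous_rhs).sub hGψ)))))
    (hint.add ((integrable_riemVolume m hD).const_mul (1 / 2))) fun x => ?_
  have hnonneg : 0 ≤ deriv (cutoff ε) (u x) * gradInner m u u x * (ψ x - gradInner m u u x) :=
    mul_nonneg (mul_nonneg (deriv_cutoff_nonneg hε _) (gradInner_self_nonneg m u x))
      (sub_nonneg.2 (hψG x))
  beta_reduce
  rw [hu.gradInner_comp_mul (hasDerivAt_cutoff ε (u x)) (hψ.mdifferentiable one_ne_zero x)]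
  linear_combination 1 / 2 * hnonneg

end IsDirichletSolution

end TestedBochner

/-! ### Removing the cutoff and the majorant -/

section Limit

open Filter Topology

variable {d : ℕ} {H : Type*} [TopologicalSpace H]
  {I : ModelWithCorners ℝ (EuclideanSpace ℝ (Fin (d + 1))) H}
  {M : Type*} [TopologicalSpace M] [ChartedSpace H M] [IsManifold I ∞ M]
  (m : Bundle.ContMDiffRiemannianMetric I ∞ (EuclideanSpace ℝ (Fin (d + 1)))
    (fun x : M => TangentSpace I x))

theorem abs_bochnerTerm_sub_le (c : ℝ) {u f e h : M → ℝ} {x : M} (he : 0 ≤ e x) (heu : e x ≤ u x)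
    (hh : 0 ≤ h x) (hh1 : h x ≤ 1) (q : ℝ) :
    |bochnerTerm m c u f e h x - 1 / 2 * (h x * q)| ≤
      |1 / ((d + 1 : ℕ) : ℝ) - 1| * (u x * |f x ^ 2|) + |3 / 2| * |f x * gradInner m u u x|
        + |c| * (u x * |gradInner m u u x|) + |1 / 2| * |q| := by
  refine (abs_sub _ _).trans (add_le_add ((abs_add_three _ _ _).trans ?_) ?_)
  · simp only [abs_mul (_ - _), abs_mul (3 / 2 : ℝ), abs_mul c, abs_mul (e x), abs_mul (h x),
      abs_of_nonneg he, abs_of_nonneg hh]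
    gcongr
    exact mul_le_of_le_one_left (abs_nonneg _) hh1
  · rw [abs_mul, abs_mul, abs_of_nonneg hh]
    gcongr
    exact mul_le_of_le_one_left (abs_nonneg _) hh1

theorem tendsto_bochnerTerm_cutoff (c : ℝ) {u f : M → ℝ} {x : M} {q : ℝ} (hux : 0 ≤ u x)
    (h0 : u x = 0 → f x = 0 ∧ gradInner m u u x = 0 ∧ q = 0) :
    Tendsto (fun ε => bochnerTerm m c u f (fun x => cutoffPrim ε (u x))
      (fun x => cutoff ε (u x)) x - 1 / 2 * (cutoff ε (u x) * q)) (𝓝[>] 0)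
      (𝓝 (bochnerTerm m c u f u (fun _ => 1) x - 1 / 2 * q)) := by
  unfold bochnerTerm
  rcases hux.eq_or_lt with hzero | hpos
  · obtain ⟨hf, hG, hq⟩ := h0 hzero.symm
    simp only [hf, hG, hq, ne_eq, OfNat.ofNat_ne_zero, not_false_eq_true, zero_pow, mul_zero,
      add_zero, sub_zero]
    exact tendsto_const_nhds
  · have hη := tendsto_cutoffPrim hpos.le
    have hχ := tendsto_cutoff hpos
    have hlim := ((((hη.mul_const (f x ^ 2)).const_mul (1 / ((d + 1 : ℕ) : ℝ) - 1)).add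
      ((hχ.mul_const (f x * gradInner m u u x)).const_mul (3 / 2))).add
      ((hη.mul_const (gradInner m u u x)).const_mul c)).sub ((hχ.mul_const q).const_mul (1 / 2))
    simpa only [one_mul] using hlim

theorem exists_contMDiff_mem_Icc [T2Space M] [CompactSpace M] {G : M → ℝ} (hG : Continuous G)
    {δ : ℝ} (hδ : 0 < δ) :
    ∃ ψ : M → ℝ, ContMDiff I 𝓘(ℝ, ℝ) ∞ ψ ∧ ∀ x, ψ x ∈ Icc (G x) (G x + δ) := by
  have : LocallyCompactSpace H := I.locallyCompactSpace
  have hlocal : ∀ x, ∃ a : ℝ, ∀ᶠ z in 𝓝 x, a ∈ Icc (G z) (G z + δ) := fun x => by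
    refine ⟨G x + δ / 2, ?_⟩
    filter_upwards [hG.continuousAt.eventually (Metric.ball_mem_nhds (G x) (half_pos hδ))] with z hz
    rw [Real.dist_eq, abs_lt] at hz
    constructor <;> linarith
  obtain ⟨ψ, hψ⟩ := exists_contMDiffMap_forall_mem_convex_of_local_const I (n := ⊤)
    (fun x => convex_Icc (G x) (G x + δ)) hlocal
  exact ⟨ψ, ψ.contMDiff, hψ⟩

namespace IsDirichletSolution

variable {m} {u f : M → ℝ} (hu : IsDirichletSolution m u f)

include hu

theorem continuous_bochnerTerm_self (c : ℝ) : Continuous (bochnerTerm m c u f u fun _ => 1) :=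
  continuous_bochnerTerm m c hu.contMDiff hu.continuous_rhs hu.contMDiff.continuous
    continuous_const

variable [CompactSpace M] [MeasurableSpace M] [BorelSpace M]

theorem ae_eq_zero_of_eq_zero (hI : IsHalfSpaceModel I) :
    ∀ᵐ x ∂(riemVolume I m), u x = 0 → f x = 0 ∧ ∀ a : M → ℝ, gradInner m a u x = 0 := by
  filter_upwards [ae_mem_interior m hI,
    ae_laplacian_eq_zero_of_eq_zero hu.nonneg hu.hasContinuousLaplacian] with x hx hfx h0
  exact ⟨neg_eq_zero.1 (hfx hx h0), fun a => gradInner_eq_zero_of_eq_zero m hu.nonneg a hx h0⟩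

variable [T2Space M]

theorem integral_majorant_le (hI : IsHalfSpaceModel I) {c : ℝ}
    (hRic : ∀ (x : M) (v : TangentSpace I x), c * m.inner x v v ≤ ricci I m x v v)
    {ψ : M → ℝ} (hψ : ContMDiff I 𝓘(ℝ, ℝ) 1 ψ) (hψG : ∀ x, gradInner m u u x ≤ ψ x) :
    ∫ x, (bochnerTerm m c u f u (fun _ => 1) x
      - 1 / 2 * (ψ x * f x - gradInner m ψ u x)) ∂(riemVolume I m) ≤ 0 := by
  have huc := hu.contMDiff.continuous
  have hfc := hu.continuous_rhs
  have hψc := hψ.continuous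
  have hGc : Continuous (gradInner m u u) := continuous_gradInner m hu.contMDiff hu.contMDiff
  have hGψ : Continuous (gradInner m ψ u) := continuous_gradInner m hψ hu.contMDiff
  have hpos : ∀ᶠ ε : ℝ in 𝓝[>] 0, 0 < ε := self_mem_nhdsWithin
  refine le_of_tendsto (tendsto_integral_filter_of_dominated_convergence
    (fun x => |1 / ((d + 1 : ℕ) : ℝ) - 1| * (u x * |f x ^ 2|)
      + |3 / 2| * |f x * gradInner m u u x| + |c| * (u x * |gradInner m u u x|)
      + |1 / 2| * |ψ x * f x - gradInner m ψ u x|) (Eventually.of_forall fun ε => ?_)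
    (Eventually.of_forall fun ε => Eventually.of_forall fun x => ?_)
    (integrable_riemVolume m (by fun_prop)) ?_)
    (hpos.mono fun ε hε => hu.integral_bochnerTerm_majorant_le hI hRic hψ hψG hε)
  · have hχ := (continuous_cutoff ε).comp huc
    exact (integrable_riemVolume m ((continuous_bochnerTerm m c hu.contMDiff hfc
      ((contDiff_cutoffPrim ε).continuous.comp huc) hχ).sub
      (continuous_const.mul (hχ.mul ((hψc.mul hfc).sub hGψ))))).aestronglyMeasurable
  · exact abs_bochnerTerm_sub_le m c (cutoffPrim_nonneg ε (hu.nonneg x))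
      (cutoffPrim_le ε (hu.nonneg x)) (cutoff_nonneg _ _) (cutoff_le_one _ _) _
  · filter_upwards [hu.ae_eq_zero_of_eq_zero hI] with x hx
    refine tendsto_bochnerTerm_cutoff m c (hu.nonneg x) fun h0 => ?_
    obtain ⟨hfx, hgrad⟩ := hx h0
    exact ⟨hfx, hgrad u, by rw [hfx, hgrad ψ, mul_zero, sub_zero]⟩

theorem integral_bochnerTerm_le_majorant (hI : IsHalfSpaceModel I) {c : ℝ}
    (hRic : ∀ (x : M) (v : TangentSpace I x), c * m.inner x v v ≤ ricci I m x v v)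
    {ψ : M → ℝ} (hψ : ContMDiff I 𝓘(ℝ, ℝ) 1 ψ) (hψG : ∀ x, gradInner m u u x ≤ ψ x) :
    ∫ x, bochnerTerm m c u f u (fun _ => 1) x ∂(riemVolume I m)
      ≤ 1 / 2 * ∫ x, ψ x * √(gradInner m u u x) ∂(boundaryArea I m) := by
  have hgreen := green hI hψ hu.hasContinuousLaplacian (Or.inr ⟨hu.eq_zero, hu.nonneg⟩)
  have hsplit : ∫ x, (bochnerTerm m c u f u (fun _ => 1) x
      - 1 / 2 * (ψ x * f x - gradInner m ψ u x)) ∂(riemVolume I m)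
      = ∫ x, bochnerTerm m c u f u (fun _ => 1) x ∂(riemVolume I m)
        + 1 / 2 * ∫ x, (ψ x * -f x + gradInner m ψ u x) ∂(riemVolume I m) := by
    have hint : Integrable (fun x => ψ x * -f x + gradInner m ψ u x) (riemVolume I m) :=
      integrable_riemVolume m ((hψ.continuous.mul hu.continuous_rhs.neg).add
        (continuous_gradInner m hψ hu.contMDiff))
    rw [← integral_const_mul, ← integral_add
      (integrable_riemVolume m (hu.continuous_bochnerTerm_self c)) (hint.const_mul _)]
    congr with x
    ring
  linarith [hu.integral_majorant_le hI hRic hψ hψG]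

theorem integral_bochnerTerm_le (hI : IsHalfSpaceModel I) {c : ℝ}
    (hRic : ∀ (x : M) (v : TangentSpace I x), c * m.inner x v v ≤ ricci I m x v v) :
    ∫ x, bochnerTerm m c u f u (fun _ => 1) x ∂(riemVolume I m)
      ≤ 1 / 2 * ∫ x, √(gradInner m u u x) ^ 3 ∂(boundaryArea I m) := by
  have hG : Continuous (gradInner m u u) := continuous_gradInner m hu.contMDiff hu.contMDiff
  set s := ∫ x, √(gradInner m u u x) ∂(boundaryArea I m)
  have : 0 ≤ s := integral_nonneg fun x => Real.sqrt_nonneg _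
  have hδ : ∀ δ > 0, ∫ x, bochnerTerm m c u f u (fun _ => 1) x ∂(riemVolume I m)
      ≤ 1 / 2 * (∫ x, √(gradInner m u u x) ^ 3 ∂(boundaryArea I m) + δ * s) := fun δ hδ => by
    obtain ⟨ψ, hψ, hψG⟩ := exists_contMDiff_mem_Icc (I := I) hG hδ
    have hψ1 : ContMDiff I 𝓘(ℝ, ℝ) 1 ψ := hψ.of_le (WithTop.coe_le_coe.2 le_top)
    have hbdry : ∫ x, ψ x * √(gradInner m u u x) ∂(boundaryArea I m)
        ≤ ∫ x, (√(gradInner m u u x) ^ 3 + δ * √(gradInner m u u x)) ∂(boundaryArea I m) := by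
      refine integral_mono (integrable_boundaryArea m hI (hψ.continuous.mul hG.sqrt))
        (integrable_boundaryArea m hI (by fun_prop)) fun x => ?_
      beta_reduce
      rw [pow_succ, Real.sq_sqrt (gradInner_self_nonneg m u x), ← add_mul]
      exact mul_le_mul_of_nonneg_right (hψG x).2 (Real.sqrt_nonneg _)
    rw [integral_add (integrable_boundaryArea m hI (by fun_prop))
      (integrable_boundaryArea m hI (by fun_prop)), integral_const_mul] at hbdry
    linarith [hu.integral_bochnerTerm_le_majorant hI hRic hψ1 fun x => (hψG x).1]
  refine le_of_forall_pos_le_add fun ε hε => (hδ (ε / (s + 1)) (by positivity)).trans ?_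
  have hεs : ε / (s + 1) * s ≤ ε := by
    rw [div_mul_eq_mul_div, div_le_iff₀ (by positivity)]
    nlinarith
  linarith

end IsDirichletSolution

end Limit

/-! ### Eliminating the gradient -/

section NormalDerivative

variable {d : ℕ} {H : Type*} [TopologicalSpace H]
  {I : ModelWithCorners ℝ (EuclideanSpace ℝ (Fin (d + 1))) H}
  {M : Type*} [TopologicalSpace M] [ChartedSpace H M] [IsManifold I ∞ M]
  {m : Bundle.ContMDiffRiemannianMetric I ∞ (EuclideanSpace ℝ (Fin (d + 1)))
    (fun x : M => TangentSpace I x)}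
  [CompactSpace M] [MeasurableSpace M] [BorelSpace M]

theorem boundaryArea_eq_zero (hI : IsHalfSpaceModel I) (hM : I.boundary M = ∅) :
    boundaryArea I m = 0 := by
  rw [← Measure.measure_univ_eq_zero, ← boundaryArea_interior m hI, ← I.compl_boundary, hM,
    compl_empty]

namespace IsDirichletSolution

variable {u f : M → ℝ} {g : ℝ → ℝ}

theorem integral_normalDeriv_pow_three (hu : IsDirichletSolution m u f) (hI : IsHalfSpaceModel I) :
    ∫ x, normalDeriv I m u x ^ 3 ∂(boundaryArea I m)
      = - ∫ x, √(gradInner m u u x) ^ 3 ∂(boundaryArea I m) := by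
  rw [← integral_neg]
  refine integral_congr_ae ?_
  filter_upwards [ae_mem_boundary m hI] with x hx
  rw [normalDeriv_eq m hI hu.contMDiff hu.eq_zero hu.nonneg hx, Odd.neg_pow (by decide)]

variable [T2Space M]

theorem green_comp (hu : IsDirichletSolution m u f) (hI : IsHalfSpaceModel I) {F F' : ℝ → ℝ}
    (hF : ∀ t, HasDerivAt F (F' t) t) (hF' : Continuous F') (hF0 : F 0 = 0) :
    Integrable (fun x => F (u x) * -f x + F' (u x) * gradInner m u u x) (riemVolume I m) ∧
      ∫ x, (F (u x) * -f x + F' (u x) * gradInner m u u x) ∂(riemVolume I m) = 0 := by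
  have hFu := (contDiff_one_of_hasDerivAt hF hF').contMDiff.comp hu.contMDiff
  have hgreen := green_of_eq_zero hI hFu hu.hasContinuousLaplacian fun x hx => by
    rw [Function.comp_apply, hu.eq_zero x hx, hF0]
  simp only [Function.comp_def, hu.gradInner_comp u (hF _)] at hgreen
  exact ⟨integrable_riemVolume m ((hFu.continuous.mul hu.continuous_rhs.neg).add
    ((hF'.comp hu.contMDiff.continuous).mul (continuous_gradInner m hu.contMDiff hu.contMDiff))),
    hgreen⟩

theorem integral_mul_sub_eq (hu : IsDirichletSolution m u fun x => g (u x))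
    (hI : IsHalfSpaceModel I) (hg : Continuous g) (c : ℝ) :
    ∫ x, g (u x) * (2 * (((d + 1 : ℕ) : ℝ) - 1) * u x * g (u x) / ((d + 1 : ℕ) : ℝ)
        - 3 * (∫ σ in (0 : ℝ)..(u x), g σ) - c * (u x) ^ 2) ∂(riemVolume I m)
      = -2 * ∫ x, bochnerTerm m c u (fun x => g (u x)) u (fun _ => 1) x ∂(riemVolume I m) := by
  obtain ⟨hsq, hsq_int⟩ := hu.green_comp hI (F := fun t => t ^ 2) (F' := fun t => 2 * t)
    (fun t => by simpa using hasDerivAt_pow 2 t) (by fun_prop) (zero_pow two_ne_zero)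
  obtain ⟨hG, hG_int⟩ := hu.green_comp hI (F := fun t => ∫ σ in (0 : ℝ)..t, g σ)
    (fun t => (hg.integral_hasStrictDerivAt 0 t).hasDerivAt) hg intervalIntegral.integral_same
  have hsplit (x : M) : g (u x) * (2 * (((d + 1 : ℕ) : ℝ) - 1) * u x * g (u x) / ((d + 1 : ℕ) : ℝ)
        - 3 * (∫ σ in (0 : ℝ)..(u x), g σ) - c * (u x) ^ 2)
      = -2 * bochnerTerm m c u (fun x => g (u x)) u (fun _ => 1) x
        + c * (u x ^ 2 * -g (u x) + 2 * u x * gradInner m u u x)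
        + 3 * ((∫ σ in (0 : ℝ)..(u x), g σ) * -g (u x) + g (u x) * gradInner m u u x) := by
    unfold bochnerTerm
    field_simp
    ring
  have hB := (integrable_riemVolume m (hu.continuous_bochnerTerm_self c)).const_mul (-2)
  simp only [hsplit]
  rw [integral_add (by exact hB.add (hsq.const_mul c)) (hG.const_mul 3),
    integral_add hB (hsq.const_mul c), integral_const_mul, integral_const_mul,
    integral_const_mul, hsq_int, hG_int, mul_zero, mul_zero, add_zero, add_zero]

theorem integral_normalDeriv_pow_three_le (hu : IsDirichletSolution m u fun x => g (u x))
    (hI : IsHalfSpaceModel I) (hg : Continuous g) {c : ℝ}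
    (hRic : ∀ (x : M) (v : TangentSpace I x), c * m.inner x v v ≤ ricci I m x v v) :
    ∫ x, normalDeriv I m u x ^ 3 ∂(boundaryArea I m) ≤
      ∫ x, g (u x) * (2 * (((d + 1 : ℕ) : ℝ) - 1) * u x * g (u x) / ((d + 1 : ℕ) : ℝ)
        - 3 * (∫ σ in (0 : ℝ)..(u x), g σ) - c * (u x) ^ 2) ∂(riemVolume I m) := by
  rw [hu.integral_normalDeriv_pow_three hI, hu.integral_mul_sub_eq hI hg]
  linarith [hu.integral_bochnerTerm_le hI hRic]

end IsDirichletSolution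

end NormalDerivative

end RiemannianGeom

end

/-- `M` is a compact Riemannian manifold of dimension `n = d + 1`, modelled on `ℝⁿ` or on the closed
half-space; the boundary may be empty. -/
theorem theorem1p8
    {d : ℕ} {H : Type*} [TopologicalSpace H]
    (I : ModelWithCorners ℝ (EuclideanSpace ℝ (Fin (d + 1))) H)
    (hI : range I = univ ∨ range I = {y : EuclideanSpace ℝ (Fin (d + 1)) | 0 ≤ y 0})
    {M : Type*} [TopologicalSpace M] [ChartedSpace H M] [IsManifold I ∞ M]
    [T2Space M] [CompactSpace M] [MeasurableSpace M] [BorelSpace M]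
    (m : Bundle.ContMDiffRiemannianMetric I ∞ (EuclideanSpace ℝ (Fin (d + 1)))
      (fun x : M => TangentSpace I x))
    (κ : ℝ)
    (hRic : ∀ (x : M) (v : TangentSpace I x),
      (((d + 1 : ℕ) : ℝ) - 1) * κ * m.inner x v v ≤ RiemannianGeom.ricci I m x v v)
    (g : ℝ → ℝ) (hg : Continuous g)
    (u : M → ℝ)
    (hu_int : ContMDiffOn I 𝓘(ℝ, ℝ) 3 u (I.interior M))
    (hu_bdry : ContMDiff I 𝓘(ℝ, ℝ) 1 u)
    (hu_nonneg : ∀ x, 0 ≤ u x)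
    (hu_eq : ∀ x ∈ I.interior M, - RiemannianGeom.laplacian I m u x = g (u x))
    (hu_zero : ∀ x ∈ I.boundary M, u x = 0) :
    (∫ x, (RiemannianGeom.normalDeriv I m u x) ^ 3 ∂(RiemannianGeom.boundaryArea I m) ≤
      ∫ x, g (u x) *
        (2 * (((d + 1 : ℕ) : ℝ) - 1) * u x * g (u x) / ((d + 1 : ℕ) : ℝ)
          - 3 * (∫ σ in (0 : ℝ)..(u x), g σ)
          - (((d + 1 : ℕ) : ℝ) - 1) * κ * (u x) ^ 2) ∂(RiemannianGeom.riemVolume I m)) ∧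
    (I.boundary M = ∅ →
      0 ≤ ∫ x, g (u x) *
        (2 * (((d + 1 : ℕ) : ℝ) - 1) * u x * g (u x) / ((d + 1 : ℕ) : ℝ)
          - 3 * (∫ σ in (0 : ℝ)..(u x), g σ)
          - (((d + 1 : ℕ) : ℝ) - 1) * κ * (u x) ^ 2) ∂(RiemannianGeom.riemVolume I m)) := by
  have hu : RiemannianGeom.IsDirichletSolution m u fun x => g (u x) :=
    { contMDiff := hu_bdry
      contMDiffOn := hu_int
      nonneg := hu_nonneg
      eq_zero := hu_zero
      continuous_rhs := hg.comp hu_bdry.continuous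
      neg_laplacian := hu_eq }
  have hle := hu.integral_normalDeriv_pow_three_le hI hg hRic
  refine ⟨hle, fun hM => ?_⟩
  rwa [RiemannianGeom.boundaryArea_eq_zero hI hM, integral_zero_measure] at hle
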